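/- **Setting.** There are $T\ge 1$ rounds, $K\ge 1$ actions, a measurable context space $\mathcal X$, and a finite non-empty class $\Pi$ of $N$ measurable policies $\pi:\mathcal X\to[K]$. The triples $(x_t,\ell_t,m_t)\in\mathcal X\times[0,1]^K\times[0,1]^K$, $t=1,\dots,T$, are drawn i.i.d. from a fixed unknown distribution $\mathcal D$. In round $t$ the learner sees $x_t$ and the loss predictor $m_t$, chooses an action $a_t\in[K]$, and then observes $\ell_t(a_t)$ only. Put $d=K\ln N$, $\mathcal E=T\,\mathbb E_{(x,\ell,m)\sim\mathcal D}\|\ell-m\|_\infty^2$ and $\mathrm{Reg}=\max_{\pi\in\Pi}\mathbb E\big[\sum_{t=1}^T\ell_t(a_t)-\sum_{t=1}^T\ell_t(\pi(x_t))\big]$. The learner has an ERM oracle, which maps any finite list $S$ of pairs $(x,c)\in\mathcal X\times\mathbb R^K$ to some $\mathrm{ERM}(S)\in\arg\min_{\pi\in\Pi}\sum_{(x,c)\in S}c(\pi(x))$. **Algorithm ($\epsilon$-Greedy.ARC)**, with parameters $\sigma>0$, $\mu\in(0,1]$ and known $\mathcal E$. Let $\psi(y)=\ln(1+y+y^2/2)$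 for $y\ge 0$ and $\psi(y)=-\ln(1-y+y^2/2)$ for $y<0$. In round $t$: 1. Let $a_t^*\in\arg\min_a m_t(a)$ and $\mathcal A_t=\{a: m_t(a)\le m_t(a_t^*)+\sigma\}$. Let $\phi_t(a)=a$ for $a\in\mathcal A_t$ and $\phi_t(a)=a_t^*$ otherwise. 2. Let $\alpha=\sqrt{2\ln(TN)/(\sigma^2t+K\mathcal E/\mu)}$. For real $z$ let $c_s^{z}(a)=\psi\big(\alpha(\widetilde\ell_s(\phi_s(a))-z)\big)$ for $s<t$, and $\pi^{z}=\mathrm{ERM}(\{(x_s,c_s^{z})\}_{s<t})$. Start with $z_{\rm right}=K/\mu+1$ and $z_{\rm left}=-z_{\rm right}$. While $z_{\rm right}-z_{\rm left}\ge 1/T$, let $z=(z_{\rm left}+z_{\rm right})/2$; if $\sum_{s<t}c_s^{z}(\pi^{z}(x_s))\ge 0$ put $z_{\rm left}=z$, else put $z_{\rm right}=z$. Finally let $\pi_t=\pi^{z_{\rm right}}$ (an approximate minimizer over $\pi\in\Pi$ of the Catoni mean of $\{\widetilde\ell_s(\phi_s(\pi(x_s)))\}_{s<t}$). 3. Sample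 $a_t$ from $p_t(a)=(1-\mu)\mathbb 1[a=\phi_t(\pi_t(x_t))]+\frac{\mu}{|\mathcal A_t|}\mathbb 1[a\in\mathcal A_t]$ and observe $\ell_t(a_t)$. 4. For $a\in\mathcal A_t$ let $\widetilde\ell_t(a)=\frac{\ell_t(a)-m_t(a)}{p_t(a)}\mathbb 1[a_t=a]+m_t(a)-m_t(a_t^*)$. Running time is counted in exact real arithmetic operations (including logarithms and square roots), comparisons and evaluations of policies, plus the size of the oracle's inputs; the running time of the oracle itself is excluded. **Theorem.** There are universal constants $C>0$ and $k\in\mathbb N$ such that the following holds for every such environment, policy class and (measurable) ERM oracle, and every $T\ge 1$. (a) For all $\sigma>0$ and $\mu\in(0,1]$, $$\mathrm{Reg}\le C(1+\ln T)^k\Big(\sqrt{\tfrac{d\mathcal E}{\mu}}+\sigma\sqrt{dT}+\mu T\sigma+\mu\sqrt{\mathcal E T}+\tfrac{\mathcal E}{\sigma}\Big)+1,$$ and the additive $1$ can be omitted if $\sigma\ge 1/T$. The algorithm makes at most $C\,T\,(1+\ln(TK/\mu))$ oracle calls and its running time is at most $C\,T^2K\,(1+\ln(TK/\mu))$. (b)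 If $N\ge 2$ and $\mathcal E>0$, then with $\mu=\min\{\sqrt{d/T},1\}$ and $\sigma=\sqrt{\mathcal E}\,(dT)^{-1/4}$, $$\mathrm{Reg}\le C(1+\ln T)^k\Big(\sqrt{\mathcal E}\,(dT)^{1/4}+\sqrt{d\mathcal E}\Big)+1,$$ and again the additive $1$ can be omitted if $\sigma\ge 1/T$. The number of oracle calls and the running time are at most $C(T+d)^k$, that is, the algorithm is oracle-efficient. -/

import Mathlib

open MeasureTheory

universe u v w

namespace ArcBandit

/-! ### Oracle programs with a step count

A learner is a program over a real-number machine that can also call an empirical risk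
minimization (ERM) oracle.  Programs are finite trees: at each node one instruction is executed,
and the continuation may depend on its result.  A program has no access to the policy class
except through oracle calls and through evaluating a policy that the oracle has returned. -/

/-- Binary arithmetic instructions. -/
inductive BinOp
  | add | sub | mul | div

/-- Unary arithmetic instructions. -/
inductive UnOp
  | log | sqrt

noncomputable def BinOp.apply : BinOp → ℝ → ℝ → ℝ
  | .add, a, b => a + b
  | .sub, a, b => a - b
  | .mul, a, b => a * b
  | .div, a, b => a / b

noncomputable def UnOp.apply : UnOp → ℝ → ℝ
  | .log, a => Real.log a
  | .sqrt, a => Real.sqrt a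

/-- An input of the ERM oracle: a finite list of pairs of a context and a cost vector. -/
abbrev Dataset (X : Type u) (K : ℕ) : Type u := List (X × (Fin K → ℝ))

/-- Oracle programs with contexts in `X`, `K` actions and results in `α`. -/
inductive Prog (X : Type u) (K : ℕ) (α : Type v) : Type (max u v)
  | ret (a : α) : Prog X K α
  | bin (o : BinOp) (a b : ℝ) (k : ℝ → Prog X K α) : Prog X K α
  | un (o : UnOp) (a : ℝ) (k : ℝ → Prog X K α) : Prog X K α
  | le (a b : ℝ) (k : Bool → Prog X K α) : Prog X K α
  | policy (π : X → Fin K) (x : X) (k : Fin K → Prog X K α) : Prog X K α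
  | erm (S : Dataset X K) (k : (X → Fin K) → Prog X K α) : Prog X K α

namespace Prog

variable {X : Type u} {K : ℕ} {α : Type v} {β : Type w}

/-- Sequential composition. -/
def bind : Prog X K α → (α → Prog X K β) → Prog X K β
  | .ret a, f => f a
  | .bin o a b k, f => .bin o a b (fun r => (k r).bind f)
  | .un o a k, f => .un o a (fun r => (k r).bind f)
  | .le a b k, f => .le a b (fun r => (k r).bind f)
  | .policy π x k, f => .policy π x (fun r => (k r).bind f)
  | .erm S k, f => .erm S (fun r => (k r).bind f)

/-- The result of a program when the oracle is the function `O`. -/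
noncomputable def eval (O : Dataset X K → (X → Fin K)) : Prog X K α → α
  | .ret a => a
  | .bin o a b k => (k (o.apply a b)).eval O
  | .un o a k => (k (o.apply a)).eval O
  | .le a b k => (k (decide (a ≤ b))).eval O
  | .policy π x k => (k (π x)).eval O
  | .erm S k => (k (O S)).eval O

/-- The number of oracle calls of a program. -/
noncomputable def calls (O : Dataset X K → (X → Fin K)) : Prog X K α → ℕ
  | .ret _ => 0
  | .bin o a b k => (k (o.apply a b)).calls O
  | .un o a k => (k (o.apply a)).calls O
  | .le a b k => (k (decide (a ≤ b))).calls O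
  | .policy π x k => (k (π x)).calls O
  | .erm S k => (k (O S)).calls O + 1

/-- The running time of a program, excluding the running time of the oracle: every instruction
takes one step, and an oracle call takes in addition one step for each cost that is handed over. -/
noncomputable def steps (O : Dataset X K → (X → Fin K)) : Prog X K α → ℕ
  | .ret _ => 0
  | .bin o a b k => (k (o.apply a b)).steps O + 1
  | .un o a k => (k (o.apply a)).steps O + 1
  | .le a b k => (k (decide (a ≤ b))).steps O + 1
  | .policy π x k => (k (π x)).steps O + 1
  | .erm S k => (k (O S)).steps O + (S.length * K + 1)

/-- Single instructions as programs. -/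
def op (o : BinOp) (a b : ℝ) : Prog X K ℝ := .bin o a b .ret

def op₁ (o : UnOp) (a : ℝ) : Prog X K ℝ := .un o a .ret

def leq (a b : ℝ) : Prog X K Bool := .le a b .ret

def evalPolicy (π : X → Fin K) (x : X) : Prog X K (Fin K) := .policy π x .ret

def callOracle (S : Dataset X K) : Prog X K (X → Fin K) := .erm S .ret

/-- Fill a table with `n` entries. -/
def table : (n : ℕ) → (Fin n → Prog X K α) → Prog X K (Fin n → α)
  | 0, _ => .ret Fin.elim0
  | n + 1, f =>
      (f 0).bind fun a => (table n fun i => f i.succ).bind fun g => .ret (Fin.cons a g)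

/-- Apply a program to all entries of a list. -/
def mapList (f : α → Prog X K β) : List α → Prog X K (List β)
  | [] => .ret []
  | a :: l => (f a).bind fun b => (mapList f l).bind fun l' => .ret (b :: l')

/-- Sum the values computed from the entries of a list. -/
def sumList (f : α → Prog X K ℝ) : List α → Prog X K ℝ
  | [] => .ret 0
  | a :: l => (f a).bind fun b => (sumList f l).bind fun s => op .add b s

theorem eval_bind (O : Dataset X K → (X → Fin K)) (p : Prog X K α) (f : α → Prog X K β) :
    (p.bind f).eval O = (f (p.eval O)).eval O := by
  induction p with
  | ret a => rfl
  | bin o a b k ih => exact ih _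
  | un o a k ih => exact ih _
  | le a b k ih => exact ih _
  | policy π x k ih => exact ih _
  | erm S k ih => exact ih _

end Prog

open Prog

/-! ### The learner -/

/-- The inputs of the learner: number of rounds `T`, number of policies `N`, threshold `σ`,
exploration probability `μ` and total prediction error `E`. -/
structure Params where
  T : ℕ
  N : ℕ
  σ : ℝ
  μ : ℝ
  E : ℝ

section Learner

variable {X : Type u} {K : ℕ}

/-- The influence function: `ln (1 + y + y² / 2)` for `0 ≤ y`, and `- ln (1 - y + y² / 2)`
otherwise. -/
noncomputable def psi (y : ℝ) : Prog X K ℝ :=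
  (op .mul y y).bind fun y2 =>
  (op .div y2 2).bind fun q =>
  (leq 0 y).bind fun nonneg =>
  if nonneg then
    (op .add 1 y).bind fun r => (op .add r q).bind fun r => op₁ .log r
  else
    (op .sub 1 y).bind fun r => (op .add r q).bind fun r => (op₁ .log r).bind fun r => op .sub 0 r

/-- The cost vectors `c_s a = ψ (α (g_s a - z))`.  The entry of the history `h` for a past round
`s` is the pair of its context `x_s` and its remapped estimator `g_s a = ℓ̃_s (φ_s a)`. -/
noncomputable def catoniCosts (α z : ℝ) (h : Dataset X K) : Prog X K (Dataset X K) :=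
  mapList (fun e =>
    (table K fun a => (op .sub (e.2 a) z).bind fun r => (op .mul α r).bind fun y => psi y).bind
      fun c => .ret (e.1, c)) h

/-- The loop `while z_right - z_left ≥ 1 / T` of the binary search, with at most `n` iterations.
It returns the final value of `z_right`. -/
noncomputable def search (T : ℕ) (α : ℝ) (h : Dataset X K) : ℕ → ℝ → ℝ → Prog X K ℝ
  | 0, _, zr => .ret zr
  | n + 1, zl, zr =>
      (op .sub zr zl).bind fun width =>
      (op .div 1 T).bind fun tol =>
      (leq tol width).bind fun continues =>
      if continues then
        (op .add zl zr).bind fun s =>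
        (op .div s 2).bind fun zmid =>
        (catoniCosts α zmid h).bind fun c =>
        (callOracle c).bind fun π =>
        (sumList (fun e => (evalPolicy π e.1).bind fun a => .ret (e.2 a)) c).bind fun total =>
        (leq 0 total).bind fun nonneg =>
        if nonneg then search T α h n zmid zr else search T α h n zl zmid
      else .ret zr

/-- The cap on the number of iterations is immaterial: the interval is halved in each iteration,
so the loop has stopped by itself after `n` iterations as soon as `(zr - zl) * T < 2 ^ n`. -/
theorem eval_search_add (O : Dataset X K → (X → Fin K)) {T : ℕ} (hT : 0 < T) (α : ℝ)
    (h : Dataset X K) (k : ℕ) : ∀ (n : ℕ) (zl zr : ℝ), (zr - zl) * T < 2 ^ n →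
      (search T α h (n + 1 + k) zl zr).eval O = (search T α h (n + 1) zl zr).eval O := by
  have hT' : (0 : ℝ) < T := by exact_mod_cast hT
  intro n
  induction n with
  | zero =>
    intro zl zr hw
    have hlt : ¬ (1 / (T : ℝ) ≤ zr - zl) := by
      rw [div_le_iff₀ hT']
      simpa using hw
    have e : 0 + 1 + k = k + 1 := by omega
    rw [e]
    simp only [search, eval_bind, op, leq, eval, BinOp.apply, hlt, decide_false,
      Bool.false_eq_true, if_false]
  | succ n ih =>
    intro zl zr hw
    have hl : (zr - (zl + zr) / 2) * T < 2 ^ n := by rw [pow_succ] at hw; linarith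
    have hr : ((zl + zr) / 2 - zl) * T < 2 ^ n := by rw [pow_succ] at hw; linarith
    have e : n + 1 + 1 + k = (n + 1 + k) + 1 := by omega
    rw [e]
    by_cases hc : 1 / (T : ℝ) ≤ zr - zl
    · rw [search, search]
      simp only [eval_bind, op, leq, eval, BinOp.apply, hc, decide_true, if_true]
      have key : ∀ b : Bool,
          (if b then search T α h (n + 1 + k) ((zl + zr) / 2) zr
            else search T α h (n + 1 + k) zl ((zl + zr) / 2)).eval O =
          (if b then search T α h (n + 1) ((zl + zr) / 2) zr
            else search T α h (n + 1) zl ((zl + zr) / 2)).eval O := by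
        intro b
        cases b
        · simpa using ih _ _ hr
        · simpa using ih _ _ hl
      exact key _
    · rw [search, search]
      simp only [eval_bind, op, leq, eval, BinOp.apply, hc, decide_false, Bool.false_eq_true,
        if_false]

/-- A number of iterations that is never reached. -/
noncomputable def maxIter (K : ℕ) (P : Params) : ℕ :=
  ⌈2 * (K / P.μ + 1) * P.T⌉₊ + 1

theorem maxIter_sufficient (K : ℕ) (P : Params) :
    ((K / P.μ + 1) - -(K / P.μ + 1)) * P.T < (2 : ℝ) ^ (maxIter K P - 1) := by
  have h1 : 2 * (K / P.μ + 1) * P.T ≤ (⌈2 * (K / P.μ + 1) * P.T⌉₊ : ℝ) := Nat.le_ceil _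
  have h2 : (⌈2 * (K / P.μ + 1) * P.T⌉₊ : ℝ) < (2 : ℝ) ^ ⌈2 * (K / P.μ + 1) * P.T⌉₊ := by
    exact_mod_cast Nat.lt_two_pow_self
  have h3 : maxIter K P - 1 = ⌈2 * (K / P.μ + 1) * P.T⌉₊ := by simp [maxIter]
  rw [h3]
  linarith

/-- The policy of round `t = 1, 2, …`: approximately the policy with the smallest Catoni mean with
parameter `α = √(2 ln (T N) / (σ² t + K E / μ))`, found by binary search with the oracle. -/
noncomputable def choosePolicy (P : Params) (t : ℕ) (h : Dataset X K) :
    Prog X K (X → Fin K) :=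
  (op .mul P.T P.N).bind fun r =>
  (op₁ .log r).bind fun r =>
  (op .mul 2 r).bind fun num =>
  (op .mul P.σ P.σ).bind fun r =>
  (op .mul r t).bind fun den₁ =>
  (op .mul K P.E).bind fun r =>
  (op .div r P.μ).bind fun den₂ =>
  (op .add den₁ den₂).bind fun den =>
  (op .div num den).bind fun r =>
  (op₁ .sqrt r).bind fun α =>
  (op .div K P.μ).bind fun r =>
  (op .add r 1).bind fun zr =>
  (op .sub 0 zr).bind fun zl =>
  (search P.T α h (maxIter K P) zl zr).bind fun z =>
  (catoniCosts α z h).bind fun c =>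
  callOracle c

/-- Scan a list of actions, keeping the first one with the smallest value of `m`. -/
noncomputable def argminScan (m : Fin K → ℝ) : List (Fin K) → Fin K → Prog X K (Fin K)
  | [], b => .ret b
  | a :: l, b => (leq (m b) (m a)).bind fun keep =>
      if keep then argminScan m l b else argminScan m l a

/-- Sample an action from the distribution `p` with the random seed `r ∈ [0, 1]`: the first action
at which the cumulative sum of `p` exceeds `r`. -/
noncomputable def sampleScan [NeZero K] (p : Fin K → ℝ) (r : ℝ) :
    List (Fin K) → ℝ → Prog X K (Fin K)
  | [], _ => .ret 0
  | a :: l, acc =>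
      (op .add acc (p a)).bind fun acc' => (leq acc' r).bind fun continues =>
      if continues then sampleScan p r l acc' else .ret a

/-- What the learner keeps of its decision in a round: `best` is the action `a*` with the smallest
predicted loss, `inA` is the indicator of the set `A` of retained actions, `p` is the sampling
distribution and `action` is the chosen action. -/
structure Decision (K : ℕ) where
  best : Fin K
  inA : Fin K → Bool
  p : Fin K → ℝ
  action : Fin K

/-- The remapping `φ`. -/
def remap (best : Fin K) (inA : Fin K → Bool) (a : Fin K) : Fin K :=
  if inA a then a else best

/-- The decision of round `t` from the history, the context `x`, the predictor `m` and the random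
seed `r`. -/
noncomputable def decideRound [NeZero K] (P : Params) (t : ℕ) (h : Dataset X K) (x : X)
    (m : Fin K → ℝ) (r : ℝ) : Prog X K (Decision K) :=
  (argminScan m (List.finRange K) 0).bind fun best =>
  (op .add (m best) P.σ).bind fun cutoff =>
  (table K fun a => leq (m a) cutoff).bind fun inA =>
  (choosePolicy P t h).bind fun π =>
  (evalPolicy π x).bind fun b =>
  (sumList (fun a => .ret (if inA a then 1 else 0)) (List.finRange K)).bind fun card =>
  (op .div P.μ card).bind fun explore =>
  (op .sub 1 P.μ).bind fun follow =>
  (table K fun a => op .add (if a = remap best inA b then follow else 0)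
    (if inA a then explore else 0)).bind fun p =>
  (sampleScan p r (List.finRange K) 0).bind fun a =>
  .ret ⟨best, inA, p, a⟩

/-- The new entry of the history, from the observed loss `y` of the chosen action: the context and
the remapped estimator `a ↦ ℓ̃ (φ a)`, where
`ℓ̃ b = (y - m b) / p b * 1[action = b] + m b - m best`. -/
noncomputable def estimate (D : Decision K) (x : X) (m : Fin K → ℝ) (y : ℝ) :
    Prog X K (X × (Fin K → ℝ)) :=
  (op .sub y (m D.action)).bind fun r =>
  (op .div r (D.p D.action)).bind fun q =>
  (table K fun a =>
    (op .sub (m (remap D.best D.inA a)) (m D.best)).bind fun shift =>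
    op .add (if D.action = remap D.best D.inA a then q else 0) shift).bind fun g =>
  .ret (x, g)

/-! ### The interaction -/

/-- A triple `(x, ℓ, m)` of a context, a loss vector and a loss predictor. -/
abbrev Obs (X : Type u) (K : ℕ) : Type u := X × (Fin K → ℝ) × (Fin K → ℝ)

/-- One round: the learner sees `x` and `m`, chooses an action and sees the loss of this action
only.  The result is the action and the new history. -/
noncomputable def playRound [NeZero K] (P : Params) (t : ℕ) (h : Dataset X K)
    (z : Obs X K) (r : ℝ) : Prog X K (Fin K × Dataset X K) :=
  (decideRound P t h z.1 z.2.2 r).bind fun D =>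
  (estimate D z.1 z.2.2 (z.2.1 D.action)).bind fun e =>
  .ret (D.action, e :: h)

/-- The first `n` rounds of the game.  The component `ω i` holds the triple of the round `i + 1`
and the random seed of the learner in this round. -/
noncomputable def play [NeZero K] (P : Params) (ω : ℕ → Obs X K × unitInterval) :
    ℕ → Prog X K (Dataset X K)
  | 0 => .ret []
  | n + 1 =>
      (play P ω n).bind fun h =>
      (playRound P (n + 1) h (ω n).1 (ω n).2).bind fun s => .ret s.2

/-- The action chosen in round `i + 1`. -/
noncomputable def action [NeZero K] (O : Dataset X K → (X → Fin K)) (P : Params)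
    (ω : ℕ → Obs X K × unitInterval) (i : ℕ) : Fin K :=
  ((playRound P (i + 1) ((play P ω i).eval O) (ω i).1 (ω i).2).eval O).1

/-- The difference between the total loss of the learner and that of the policy `π`. -/
noncomputable def excessLoss [NeZero K] (O : Dataset X K → (X → Fin K)) (P : Params)
    (π : X → Fin K) (ω : ℕ → Obs X K × unitInterval) : ℝ :=
  ∑ i ∈ Finset.range P.T,
    ((ω i).1.2.1 (action O P ω i) - (ω i).1.2.1 (π (ω i).1.1))

/-- `O` is an ERM oracle for the policy class. -/
def IsERM (pols : Finset (X → Fin K)) (O : Dataset X K → (X → Fin K)) : Prop :=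
  ∀ S : Dataset X K, O S ∈ pols ∧
    ∀ π ∈ pols, (S.map fun e => e.2 (O S e.1)).sum ≤ (S.map fun e => e.2 (π e.1)).sum

variable [MeasurableSpace X]

/-- The law of the whole game: the triples are i.i.d. with law `D`, and the random seeds of the
learner are independent of them, independent of each other and uniform on `[0, 1]`. -/
noncomputable def gameLaw (D : Measure (Obs X K)) [IsProbabilityMeasure D] :
    Measure (ℕ → Obs X K × unitInterval) :=
  Measure.infinitePi fun _ : ℕ => D.prod (volume : Measure unitInterval)

/-- The total prediction error `T * E ‖ℓ - m‖²`, with the sup norm. -/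
noncomputable def totalError (D : Measure (Obs X K)) (T : ℕ) : ℝ :=
  T * ∫ z, ‖z.2.1 - z.2.2‖ ^ 2 ∂D

/-- The pseudo-regret against the best policy. -/
noncomputable def regret [NeZero K] (D : Measure (Obs X K)) [IsProbabilityMeasure D]
    (pols : Finset (X → Fin K)) (hne : pols.Nonempty) (O : Dataset X K → (X → Fin K))
    (P : Params) : ℝ :=
  pols.sup' hne fun π => ∫ ω, excessLoss O P π ω ∂(gameLaw D)

end Learner

end ArcBandit

/-! Fix a round, condition on the past and write `u = ‖ℓ - m‖`, `q = E u²`. An action that is not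
retained has a prediction more than `σ` above the best one, so replacing it by the best action costs
at most `2u - σ ≤ u²/σ`; over all rounds this is `E/σ`. Retained predictions lie within `σ` of the
best, so exploration costs at most `μ(σ + 2u)`. What remains is the difference of `value`, the mean
remapped loss, between the policy followed and the comparator (`integral_roundLoss_le`).

The importance-weighted estimator is unbiased for `value`. Its second moment is at most `2(Kq/μ +
σ²)`, because remapped actions have probability at least `μ/K` and a predicted gap of at most `σ`.
Its range is of order `K/μ`, too large for a bound that depends on the range; Catoni's function `ψ`
satisfies `exp (±ψ y) ≤ 1 ± y + y²/2`, so that the second moment alone controls exponential moments.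
The policy followed depends on the past, but the bound holds whichever policy it is, so the factors
multiply along the game (`lintegral_exp_influenceSum_le`). Markov's inequality and a union bound
over policies, signs and a grid of thresholds give, outside an event of probability `1/T`, for every
policy with value `v` and all `z ∈ [-3, 3]`, `|Q(z) - nα(v - z)| ≤ n((α(v - z))² + b)`, where `b =
25Λ/n` and `Λ = ln (TN)`, for its influence sum `Q` over `n` past rounds, as long as `n` is not
small compared with `Λ`.

The binary search keeps two invariants: at the left end the sums of all policies are nonnegative,
and at the right end the sum of the oracle's policy is nonpositive. If the chosen policy has the
larger value, both roots are then so close to the right end that the quadratic error there is of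
order `b`. At this one point the oracle's policy has the smaller sum, and comparing the two linear
approximations yields a gap of at most `8b/α` (`root_comparison`). The search tolerance `1/T` enters
only through its square, which is harmless when `σ ≥ 1/(2T)`.

With the chosen `α` the gap in round `t` is of order `√(Λ(σ²t + KE/μ))/t`; summing gives the first
two terms of the bound up to logarithms. Early rounds and the bad event are covered by the crude gap
`σ + 2√q`. If `σ < 1/(2T)`, no learning is needed: any retained action loses at most `2σ + u²/σ`
against any other, so the regret is at most `1 + E/σ`. For the running time, the search halves an
interval of length `2(K/μ + 1)` until it is shorter than `1/T`, hence takes logarithmically many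
iterations. -/

namespace ArcBandit

open Prog

/-! ### Results and running times of composed programs -/

section Programs

variable {X : Type u} {K : ℕ} {α : Type v} {β : Type w} (O : Dataset X K → (X → Fin K))

theorem calls_bind (p : Prog X K α) (f : α → Prog X K β) :
    (p.bind f).calls O = p.calls O + (f (p.eval O)).calls O := by
  induction p with
  | ret a => simp [Prog.bind, calls, eval]
  | bin o a b k ih => exact ih _
  | un o a k ih => exact ih _
  | le a b k ih => exact ih _
  | policy π x k ih => exact ih _
  | erm S k ih => simp only [Prog.bind, calls, eval, ih]; omega

theorem steps_bind (p : Prog X K α) (f : α → Prog X K β) :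
    (p.bind f).steps O = p.steps O + (f (p.eval O)).steps O := by
  induction p with
  | ret a => simp [Prog.bind, steps, eval]
  | bin o a b k ih => simp only [Prog.bind, steps, eval, ih]; omega
  | un o a k ih => simp only [Prog.bind, steps, eval, ih]; omega
  | le a b k ih => simp only [Prog.bind, steps, eval, ih]; omega
  | policy π x k ih => simp only [Prog.bind, steps, eval, ih]; omega
  | erm S k ih => simp only [Prog.bind, steps, eval, ih]; omega

theorem eval_table (n : ℕ) (f : Fin n → Prog X K α) :
    (table n f).eval O = fun i => (f i).eval O := by
  induction n with
  | zero => funext i; exact i.elim0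
  | succ n ih =>
    funext i
    simp only [table, eval_bind, eval, ih]
    refine Fin.cases ?_ (fun j => ?_) i <;> simp

theorem calls_table (n : ℕ) (f : Fin n → Prog X K α) (h : ∀ i, (f i).calls O = 0) :
    (table n f).calls O = 0 := by
  induction n with
  | zero => rfl
  | succ n ih => simp [table, calls_bind, calls, h, ih]

theorem steps_table_le (n c : ℕ) (f : Fin n → Prog X K α) (h : ∀ i, (f i).steps O ≤ c) :
    (table n f).steps O ≤ n * c := by
  induction n with
  | zero => simp [table, steps]
  | succ n ih =>
    simp only [table, steps_bind, steps]
    have h1 := ih (fun i => f i.succ) (fun i => h _)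
    have h2 := h 0
    rw [add_mul]
    omega

theorem eval_mapList (f : α → Prog X K β) (l : List α) :
    (mapList f l).eval O = l.map fun a => (f a).eval O := by
  induction l with
  | nil => rfl
  | cons a l ih => simp [mapList, eval_bind, eval, ih]

theorem calls_mapList (f : α → Prog X K β) (l : List α) (h : ∀ a, (f a).calls O = 0) :
    (mapList f l).calls O = 0 := by
  induction l with
  | nil => rfl
  | cons a l ih => simp [mapList, calls_bind, calls, ih, h]

theorem steps_mapList_le (f : α → Prog X K β) (l : List α) (c : ℕ)
    (h : ∀ a, (f a).steps O ≤ c) : (mapList f l).steps O ≤ l.length * c := by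
  induction l with
  | nil => simp [mapList, steps]
  | cons a l ih =>
    simp only [mapList, steps_bind, steps, List.length_cons]
    have h2 := h a
    rw [add_mul]
    omega

theorem eval_sumList (f : α → Prog X K ℝ) (l : List α) :
    (sumList f l).eval O = (l.map fun a => (f a).eval O).sum := by
  induction l with
  | nil => rfl
  | cons a l ih => simp [sumList, eval_bind, eval, op, BinOp.apply, ih]

theorem calls_sumList (f : α → Prog X K ℝ) (l : List α) (h : ∀ a, (f a).calls O = 0) :
    (sumList f l).calls O = 0 := by
  induction l with
  | nil => rfl
  | cons a l ih => simp [sumList, calls_bind, calls, op, ih, h]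

theorem steps_sumList_le (f : α → Prog X K ℝ) (l : List α) (c : ℕ)
    (h : ∀ a, (f a).steps O ≤ c) : (sumList f l).steps O ≤ l.length * (c + 1) := by
  induction l with
  | nil => simp [sumList, steps]
  | cons a l ih =>
    simp only [sumList, steps_bind, steps, op, List.length_cons]
    have h2 := h a
    rw [add_mul]
    omega

end Programs

/-! ### The learner as a mathematical function -/

/-- Catoni's influence function. -/
noncomputable def influence (y : ℝ) : ℝ :=
  if 0 ≤ y then Real.log (1 + y + y * y / 2) else -Real.log (1 - y + y * y / 2)

/-- The cost vectors handed to the oracle. -/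
noncomputable def costData {X : Type u} {K : ℕ} (α z : ℝ) (h : Dataset X K) : Dataset X K :=
  h.map fun e => (e.1, fun a => influence (α * (e.2 a - z)))

/-- The influence of the estimates of the losses of the policy `π`. -/
noncomputable def influenceSum {X : Type u} {K : ℕ} (α : ℝ) (h : Dataset X K) (π : X → Fin K)
    (z : ℝ) : ℝ :=
  (h.map fun e => influence (α * (e.2 (π e.1) - z))).sum

/-- The scale of the influence function in round `t`. -/
noncomputable def scale (K : ℕ) (P : Params) (t : ℕ) : ℝ :=
  √(2 * Real.log (P.T * P.N) / (P.σ * P.σ * t + K * P.E / P.μ))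

/-- The value found by the binary search. -/
noncomputable def searchValue {X : Type u} {K : ℕ} (O : Dataset X K → (X → Fin K)) (P : Params)
    (t : ℕ) (h : Dataset X K) : ℝ :=
  (search P.T (scale K P t) h (maxIter K P) (-(K / P.μ + 1)) (K / P.μ + 1)).eval O

/-- The first action of a list, or `b`, that minimizes `m`. -/
noncomputable def argminList {K : ℕ} (m : Fin K → ℝ) : List (Fin K) → Fin K → Fin K
  | [], b => b
  | a :: l, b => if m b ≤ m a then argminList m l b else argminList m l a

/-- Inversion of the cumulative sums of `p`. -/
noncomputable def sampleList {K : ℕ} [NeZero K] (p : Fin K → ℝ) (r : ℝ) :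
    List (Fin K) → ℝ → Fin K
  | [], _ => 0
  | a :: l, acc => if acc + p a ≤ r then sampleList p r l (acc + p a) else a

section Round

variable {K : ℕ} [NeZero K]

/-- The action with the smallest predicted loss. -/
noncomputable def bestAction (m : Fin K → ℝ) : Fin K := argminList m (List.finRange K) 0

/-- The retained actions. -/
noncomputable def retained (σ : ℝ) (m : Fin K → ℝ) (a : Fin K) : Bool :=
  decide (m a ≤ m (bestAction m) + σ)

/-- The remapping of the actions that are not retained to the best action. -/
noncomputable def target (σ : ℝ) (m : Fin K → ℝ) (a : Fin K) : Fin K :=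
  remap (bestAction m) (retained σ m) a

/-- The number of retained actions. -/
noncomputable def retainedCard (σ : ℝ) (m : Fin K → ℝ) : ℝ :=
  ∑ a, if retained σ m a then 1 else 0

/-- The sampling distribution if the policy recommends the action `b`. -/
noncomputable def weight (σ μ : ℝ) (m : Fin K → ℝ) (b a : Fin K) : ℝ :=
  (if a = target σ m b then 1 - μ else 0) + (if retained σ m a then μ / retainedCard σ m else 0)

/-- The action sampled with the seed `r`. -/
noncomputable def sampled (σ μ : ℝ) (m : Fin K → ℝ) (b : Fin K) (r : ℝ) : Fin K :=
  sampleList (weight σ μ m b) r (List.finRange K) 0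

/-- The remapped loss estimator. -/
noncomputable def estimator (σ μ : ℝ) (m ℓ : Fin K → ℝ) (b : Fin K) (r : ℝ) (a : Fin K) : ℝ :=
  (if sampled σ μ m b r = target σ m a then
    (ℓ (sampled σ μ m b r) - m (sampled σ μ m b r)) / weight σ μ m b (sampled σ μ m b r)
  else 0) + (m (target σ m a) - m (bestAction m))

end Round

section Evaluation

variable {X : Type u} {K : ℕ} (O : Dataset X K → (X → Fin K))

theorem eval_psi (y : ℝ) : (psi y : Prog X K ℝ).eval O = influence y := by
  unfold psi influence
  by_cases h : 0 ≤ y <;>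
    simp [eval_bind, op, op₁, leq, eval, BinOp.apply, UnOp.apply, h]

theorem calls_psi (y : ℝ) : (psi y : Prog X K ℝ).calls O = 0 := by
  unfold psi
  by_cases h : 0 ≤ y <;>
    simp [calls_bind, op, op₁, leq, eval, calls, h]

theorem steps_psi_le (y : ℝ) : (psi y : Prog X K ℝ).steps O ≤ 7 := by
  unfold psi
  by_cases h : 0 ≤ y <;>
    simp [steps_bind, op, op₁, leq, eval, steps, h]

theorem eval_catoniCosts (α z : ℝ) (h : Dataset X K) :
    (catoniCosts α z h).eval O = costData α z h := by
  simp only [catoniCosts, costData, eval_mapList, eval_bind, eval_table, op, eval, BinOp.apply,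
    eval_psi]

theorem calls_catoniCosts (α z : ℝ) (h : Dataset X K) : (catoniCosts α z h).calls O = 0 := by
  refine calls_mapList O _ _ fun a => ?_
  rw [calls_bind, calls_table]
  · rfl
  · intro i
    simp [calls_bind, op, calls, calls_psi]

theorem steps_catoniCosts_le (α z : ℝ) (h : Dataset X K) :
    (catoniCosts α z h).steps O ≤ h.length * (K * 9) := by
  refine steps_mapList_le O _ _ _ fun a => ?_
  rw [steps_bind]
  refine steps_table_le O _ _ _ fun i => ?_
  have := steps_psi_le O (α * (a.2 i - z))
  simp only [steps_bind, op, steps, eval, BinOp.apply]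
  omega

theorem length_costData (α z : ℝ) (h : Dataset X K) : (costData α z h).length = h.length := by
  simp [costData]

theorem sum_costData (α z : ℝ) (h : Dataset X K) (π : X → Fin K) :
    ((costData α z h).map fun e => e.2 (π e.1)).sum = influenceSum α h π z := by
  simp [costData, influenceSum, Function.comp_def]

theorem eval_search_succ (T : ℕ) (α : ℝ) (h : Dataset X K) (n : ℕ) (zl zr : ℝ) :
    (search T α h (n + 1) zl zr).eval O =
      if 1 / (T : ℝ) ≤ zr - zl then
        if 0 ≤ influenceSum α h (O (costData α ((zl + zr) / 2) h)) ((zl + zr) / 2) then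
          (search T α h n ((zl + zr) / 2) zr).eval O
        else (search T α h n zl ((zl + zr) / 2)).eval O
      else zr := by
  rw [search]
  by_cases hc : 1 / (T : ℝ) ≤ zr - zl
  · simp only [eval_bind, op, leq, eval, BinOp.apply, hc, decide_true, if_true, eval_catoniCosts,
      callOracle, eval_sumList, evalPolicy, sum_costData, decide_eq_true_eq]
    split_ifs <;> rfl
  · simp only [eval_bind, op, leq, eval, BinOp.apply, hc, decide_false, Bool.false_eq_true,
      if_false]

theorem eval_choosePolicy (P : Params) (t : ℕ) (h : Dataset X K) :
    (choosePolicy P t h).eval O = O (costData (scale K P t) (searchValue O P t h) h) := by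
  simp [choosePolicy, eval_bind, op, op₁, eval, BinOp.apply, UnOp.apply, eval_catoniCosts,
    callOracle, searchValue, scale]

theorem eval_argminScan (m : Fin K → ℝ) (l : List (Fin K)) (b : Fin K) :
    (argminScan m l b : Prog X K (Fin K)).eval O = argminList m l b := by
  induction l generalizing b with
  | nil => rfl
  | cons a l ih =>
    by_cases hc : m b ≤ m a <;> simp [argminScan, argminList, eval_bind, leq, eval, hc, ih]

theorem eval_sampleScan [NeZero K] (p : Fin K → ℝ) (r : ℝ) (l : List (Fin K)) (acc : ℝ) :
    (sampleScan p r l acc : Prog X K (Fin K)).eval O = sampleList p r l acc := by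
  induction l generalizing acc with
  | nil => rfl
  | cons a l ih =>
    by_cases hc : acc + p a ≤ r <;>
      simp [sampleScan, sampleList, eval_bind, leq, op, BinOp.apply, eval, hc, ih]

theorem eval_decideRound [NeZero K] (P : Params) (t : ℕ) (h : Dataset X K) (x : X)
    (m : Fin K → ℝ) (r : ℝ) :
    (decideRound P t h x m r).eval O =
      ⟨bestAction m, retained P.σ m, weight P.σ P.μ m ((choosePolicy P t h).eval O x),
        sampled P.σ P.μ m ((choosePolicy P t h).eval O x) r⟩ := by
  have hc : ((List.finRange K).map fun a => if retained P.σ m a then (1 : ℝ) else 0).sum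
      = retainedCard P.σ m := by
    rw [retainedCard, Fin.sum_univ_def]
  simp only [decideRound, eval_bind, eval_argminScan, eval_table, eval_sumList, eval_sampleScan,
    eval, op, leq, evalPolicy, BinOp.apply]
  have hr' : ∀ a, decide (m a ≤ m (argminList m (List.finRange K) 0) + P.σ)
      = retained P.σ m a := fun a => rfl
  simp only [hr', hc]
  rfl

theorem eval_playRound [NeZero K] (P : Params) (t : ℕ) (h : Dataset X K) (z : Obs X K) (r : ℝ) :
    (playRound P t h z r).eval O =
      (sampled P.σ P.μ z.2.2 ((choosePolicy P t h).eval O z.1) r,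
        (z.1, estimator P.σ P.μ z.2.2 z.2.1 ((choosePolicy P t h).eval O z.1) r) :: h) := by
  simp only [playRound, eval_bind, eval_decideRound, estimate, eval, op, BinOp.apply, eval_table]
  rfl

end Evaluation

/-! ### Running time -/

section RunningTime

variable {X : Type u} {K : ℕ} (O : Dataset X K → (X → Fin K))

theorem steps_bind_le {α : Type v} {β : Type w} {p : Prog X K α} {f : α → Prog X K β} {a b : ℕ}
    (hp : p.steps O ≤ a) (hf : ∀ r, (f r).steps O ≤ b) : (p.bind f).steps O ≤ a + b := by
  rw [steps_bind]
  exact add_le_add hp (hf _)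

theorem calls_bind_le {α : Type v} {β : Type w} {p : Prog X K α} {f : α → Prog X K β} {a b : ℕ}
    (hp : p.calls O ≤ a) (hf : ∀ r, (f r).calls O ≤ b) : (p.bind f).calls O ≤ a + b := by
  rw [calls_bind]
  exact add_le_add hp (hf _)

/-- The iteration cap `n` is far too large to count with, so the induction carries a second counter
`J`: each iteration halves `(zr - zl) * T`, and at `J = 0` the width is below `1 / T` and the loop
has stopped. -/
theorem calls_search_le {T : ℕ} (hT : 0 < T) (α : ℝ) (h : Dataset X K) (n : ℕ) :
    ∀ (J : ℕ) (zl zr : ℝ), (zr - zl) * T < 2 ^ J → (search T α h n zl zr).calls O ≤ J := by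
  have hT' : (0 : ℝ) < T := by exact_mod_cast hT
  induction n with
  | zero => intro J zl zr _; simp [search, calls]
  | succ n ih =>
    intro J zl zr hw
    change calls O (if decide (1 / (T : ℝ) ≤ zr - zl) = true then _ else _) ≤ J
    by_cases hc : 1 / (T : ℝ) ≤ zr - zl
    · obtain _ | J := J
      · rw [div_le_iff₀ hT'] at hc
        simp at hw
        linarith
      have hl : (zr - (zl + zr) / 2) * T < 2 ^ J := by rw [pow_succ] at hw; linarith
      have hr : ((zl + zr) / 2 - zl) * T < 2 ^ J := by rw [pow_succ] at hw; linarith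
      rw [if_pos (decide_eq_true hc)]
      change calls O ((catoniCosts α ((zl + zr) / 2) h).bind _) ≤ J + 1
      have := calls_bind_le O (calls_catoniCosts O α ((zl + zr) / 2) h).le fun c =>
        calls_bind_le O (show (callOracle c).calls O ≤ 0 + 1 from le_rfl) fun π =>
        calls_bind_le O (calls_sumList O
          (fun e => (evalPolicy π e.1).bind fun a => ret (e.2 a)) c fun _ => rfl).le fun total =>
        calls_bind_le O (show (leq 0 total).calls O ≤ 0 from le_rfl) fun b =>
        show (if b = true then search T α h n ((zl + zr) / 2) zr
          else search T α h n zl ((zl + zr) / 2)).calls O ≤ J by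
          cases b
          · exact ih J _ _ hr
          · exact ih J _ _ hl
      refine this.trans (le_of_eq ?_)
      omega
    · rw [if_neg (by simpa using hc)]
      exact Nat.zero_le _

/-- Per entry of the history an iteration spends `9 * K` steps on the costs, `K` on handing them to
the oracle and `2` on the sum. The `7` collects the single instructions, and the final `3` is the
loop test that fails. -/
theorem steps_search_le {T : ℕ} (hT : 0 < T) (α : ℝ) (h : Dataset X K) (n : ℕ) :
    ∀ (J : ℕ) (zl zr : ℝ), (zr - zl) * T < 2 ^ J →
      (search T α h n zl zr).steps O ≤ J * (h.length * (K * 10 + 2) + 7) + 3 := by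
  have hT' : (0 : ℝ) < T := by exact_mod_cast hT
  induction n with
  | zero => intro J zl zr _; simp [search, steps]
  | succ n ih =>
    intro J zl zr hw
    change steps O (if decide (1 / (T : ℝ) ≤ zr - zl) = true then _ else _) + 3 ≤ _
    by_cases hc : 1 / (T : ℝ) ≤ zr - zl
    · obtain _ | J := J
      · rw [div_le_iff₀ hT'] at hc
        simp at hw
        linarith
      have hl : (zr - (zl + zr) / 2) * T < 2 ^ J := by rw [pow_succ] at hw; linarith
      have hr : ((zl + zr) / 2 - zl) * T < 2 ^ J := by rw [pow_succ] at hw; linarith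
      rw [if_pos (decide_eq_true hc)]
      set c := costData α ((zl + zr) / 2) h with hcd
      have hlen : c.length = h.length := length_costData _ _ _
      have key : steps O ((catoniCosts α ((zl + zr) / 2) h).bind fun c =>
          (callOracle c).bind fun π =>
          (sumList (fun e => (evalPolicy π e.1).bind fun a => .ret (e.2 a)) c).bind fun total =>
          (leq 0 total).bind fun nonneg =>
          if nonneg then search T α h n ((zl + zr) / 2) zr
            else search T α h n zl ((zl + zr) / 2)) ≤
          h.length * (K * 9) + ((c.length * K + 1) + (c.length * (1 + 1) + (1 +
            (J * (h.length * (K * 10 + 2) + 7) + 3)))) := by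
        rw [steps_bind, eval_catoniCosts]
        refine add_le_add (steps_catoniCosts_le O _ _ _) ?_
        refine steps_bind_le O (by rw [callOracle, steps, steps, zero_add]) fun π =>
          steps_bind_le O (steps_sumList_le O _ _ _ fun _ => le_rfl) fun total =>
          steps_bind_le O le_rfl fun b => ?_
        cases b
        · exact ih J _ _ hr
        · exact ih J _ _ hl
      refine (Nat.add_le_add_right key 5).trans ?_
      rw [hlen]
      ring_nf
      omega
    · rw [if_neg (by simpa using hc)]
      simp [steps]

/-- One call per halving, and one more at the final right end. -/
theorem calls_choosePolicy_le (P : Params) (hT : 0 < P.T) (t : ℕ) (h : Dataset X K) (J : ℕ)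
    (hJ : 2 * (K / P.μ + 1) * P.T < 2 ^ J) : (choosePolicy P t h).calls O ≤ J + 1 := by
  simp only [choosePolicy, calls_bind, op, op₁, calls, eval, BinOp.apply, UnOp.apply, callOracle,
    calls_catoniCosts, zero_add]
  gcongr
  refine calls_search_le O hT _ _ _ _ _ _ ?_
  refine lt_of_eq_of_lt ?_ hJ
  ring

theorem steps_choosePolicy_le (P : Params) (hT : 0 < P.T) (t : ℕ) (h : Dataset X K) (J : ℕ)
    (hJ : 2 * (K / P.μ + 1) * P.T < 2 ^ J) :
    (choosePolicy P t h).steps O ≤ (J + 1) * (h.length * (K * 10 + 2) + 7) + 20 := by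
  simp only [choosePolicy, steps_bind, op, op₁, steps, eval, BinOp.apply, UnOp.apply, callOracle,
    eval_catoniCosts, length_costData]
  have h1 := fun α z => steps_catoniCosts_le O α z h
  have h2 := fun α => steps_search_le O hT α h (maxIter K P) J (0 - (K / P.μ + 1)) (K / P.μ + 1)
    (lt_of_eq_of_lt (by ring) hJ)
  have h3 : (J + 1) * (h.length * (K * 10 + 2) + 7)
      = J * (h.length * (K * 10 + 2) + 7) + (h.length * (K * 9) + h.length * K
        + h.length * 2 + 7) := by ring
  rw [h3]
  specialize h2 √(2 * Real.log (P.T * P.N) / (P.σ * P.σ * t + K * P.E / P.μ))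
  specialize h1 √(2 * Real.log (P.T * P.N) / (P.σ * P.σ * t + K * P.E / P.μ))
    (eval O (search P.T √(2 * Real.log (P.T * P.N) / (P.σ * P.σ * t + K * P.E / P.μ)) h
      (maxIter K P) (0 - (K / P.μ + 1)) (K / P.μ + 1)))
  omega

theorem steps_argminScan (m : Fin K → ℝ) (l : List (Fin K)) (b : Fin K) :
    (argminScan m l b : Prog X K (Fin K)).steps O = l.length ∧
      (argminScan m l b : Prog X K (Fin K)).calls O = 0 := by
  induction l generalizing b with
  | nil => exact ⟨rfl, rfl⟩
  | cons a l ih =>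
    by_cases hc : m b ≤ m a <;>
      simp [argminScan, steps_bind, calls_bind, leq, eval, steps, calls, hc, ih, add_comm]

theorem steps_sampleScan_le [NeZero K] (p : Fin K → ℝ) (r : ℝ) (l : List (Fin K)) (acc : ℝ) :
    (sampleScan p r l acc : Prog X K (Fin K)).steps O ≤ l.length * 2 ∧
      (sampleScan p r l acc : Prog X K (Fin K)).calls O = 0 := by
  induction l generalizing acc with
  | nil => simp [sampleScan, steps, calls]
  | cons a l ih =>
    have h1 := (ih (acc + p a)).1
    have h2 := (ih (acc + p a)).2
    by_cases hc : acc + p a ≤ r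
    · simp [sampleScan, steps_bind, calls_bind, leq, op, BinOp.apply, eval, steps, calls, hc, h2]
      omega
    · simp [sampleScan, steps_bind, calls_bind, leq, op, BinOp.apply, eval, steps, calls, hc]

variable [NeZero K]

theorem calls_playRound_le (P : Params) (hT : 0 < P.T) (t : ℕ) (h : Dataset X K) (z : Obs X K)
    (r : ℝ) (J : ℕ) (hJ : 2 * (K / P.μ + 1) * P.T < 2 ^ J) :
    (playRound P t h z r).calls O ≤ J + 1 := by
  have hd : (decideRound P t h z.1 z.2.2 r).calls O
      ≤ 0 + (0 + (0 + ((J + 1) + (0 + (0 + (0 + (0 + (0 + (0 + 0))))))))) :=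
    calls_bind_le O (steps_argminScan O _ _ _).2.le fun _ => calls_bind_le O le_rfl fun _ =>
    calls_bind_le O (calls_table O _ _ fun _ => rfl).le fun _ =>
    calls_bind_le O (calls_choosePolicy_le O P hT t h J hJ) fun _ =>
    calls_bind_le O le_rfl fun _ =>
    calls_bind_le O (calls_sumList O _ _ fun _ => rfl).le fun _ =>
    calls_bind_le O le_rfl fun _ => calls_bind_le O le_rfl fun _ =>
    calls_bind_le O (calls_table O _ _ fun _ => rfl).le fun _ =>
    calls_bind_le O (steps_sampleScan_le O _ _ _ _).2.le fun _ => le_rfl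
  have he : ∀ D : Decision K, (estimate D z.1 z.2.2 (z.2.1 D.action)).calls O ≤ 0 + (0 + (0 + 0)) :=
    fun D => calls_bind_le O le_rfl fun _ => calls_bind_le O le_rfl fun _ =>
    calls_bind_le O (calls_table O _ _ fun _ => rfl).le fun _ => le_rfl
  refine (calls_bind_le O (b := 0 + (0 + (0 + 0)) + 0) hd fun D =>
    calls_bind_le O (he D) fun e => le_rfl).trans (by omega)

theorem steps_playRound_le (P : Params) (hT : 0 < P.T) (t : ℕ) (h : Dataset X K) (z : Obs X K)
    (r : ℝ) (J : ℕ) (hJ : 2 * (K / P.μ + 1) * P.T < 2 ^ J) :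
    (playRound P t h z r).steps O ≤
      (J + 1) * (h.length * (K * 10 + 2) + 7) + (8 * K + 30) := by
  have hl : (List.finRange K).length = K := List.length_finRange
  have hd : (decideRound P t h z.1 z.2.2 r).steps O
      ≤ (List.finRange K).length + (1 + (K * 1 + (((J + 1) * (h.length * (K * 10 + 2) + 7) + 20)
        + (1 + ((List.finRange K).length * (0 + 1) + (1 + (1 + (K * 1 +
          ((List.finRange K).length * 2 + 0))))))))) :=
    steps_bind_le O (steps_argminScan O _ _ _).1.le fun _ => steps_bind_le O le_rfl fun _ =>
    steps_bind_le O (steps_table_le O _ _ _ fun _ => le_rfl) fun _ =>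
    steps_bind_le O (steps_choosePolicy_le O P hT t h J hJ) fun _ =>
    steps_bind_le O le_rfl fun _ =>
    steps_bind_le O (steps_sumList_le O _ _ _ fun _ => le_rfl) fun _ =>
    steps_bind_le O le_rfl fun _ => steps_bind_le O le_rfl fun _ =>
    steps_bind_le O (steps_table_le O _ _ _ fun _ => le_rfl) fun _ =>
    steps_bind_le O (steps_sampleScan_le O _ _ _ _).1 fun _ => le_rfl
  have he : ∀ D : Decision K,
      (estimate D z.1 z.2.2 (z.2.1 D.action)).steps O ≤ 1 + (1 + (K * 2 + 0)) :=
    fun D => steps_bind_le O le_rfl fun _ => steps_bind_le O le_rfl fun _ =>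
    steps_bind_le O (steps_table_le O _ _ _ fun _ => le_rfl) fun _ => le_rfl
  rw [hl] at hd
  refine (steps_bind_le O (b := 1 + (1 + (K * 2 + 0)) + 0) hd fun D =>
    steps_bind_le O (he D) fun e => le_rfl).trans (by omega)

variable (P : Params) (ω : ℕ → Obs X K × unitInterval)

theorem eval_play_succ (n : ℕ) :
    (play P ω (n + 1)).eval O =
      ((ω n).1.1, estimator P.σ P.μ (ω n).1.2.2 (ω n).1.2.1
        ((choosePolicy P (n + 1) ((play P ω n).eval O)).eval O (ω n).1.1) (ω n).2) ::
        (play P ω n).eval O := by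
  simp only [play, eval_bind, eval_playRound, eval]

theorem length_eval_play (n : ℕ) : ((play P ω n).eval O).length = n := by
  induction n with
  | zero => rfl
  | succ n ih => simp [eval_play_succ, ih]

theorem calls_play_le (hT : 0 < P.T) (J : ℕ) (hJ : 2 * (K / P.μ + 1) * P.T < 2 ^ J) (n : ℕ) :
    (play P ω n).calls O ≤ n * (J + 1) := by
  induction n with
  | zero => simp [play, calls]
  | succ n ih =>
    refine (calls_bind_le O (b := J + 1 + 0) ih fun h => calls_bind_le O
      (calls_playRound_le O P hT (n + 1) h (ω n).1 (ω n).2 J hJ) fun s => le_rfl).trans ?_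
    rw [add_mul]
    omega

theorem steps_play_le (hT : 0 < P.T) (J : ℕ) (hJ : 2 * (K / P.μ + 1) * P.T < 2 ^ J) (n : ℕ) :
    (play P ω n).steps O ≤ n * ((J + 1) * (n * (K * 10 + 2) + 7) + (8 * K + 30)) := by
  induction n with
  | zero => simp [play, steps]
  | succ n ih =>
    have h1 := steps_playRound_le O P hT (n + 1) ((play P ω n).eval O) (ω n).1 (ω n).2 J hJ
    rw [length_eval_play] at h1
    have h2 : n * ((J + 1) * (n * (K * 10 + 2) + 7) + (8 * K + 30))
        ≤ n * ((J + 1) * ((n + 1) * (K * 10 + 2) + 7) + (8 * K + 30)) := by gcongr; omega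
    have h3 : (J + 1) * (n * (K * 10 + 2) + 7) ≤ (J + 1) * ((n + 1) * (K * 10 + 2) + 7) := by
      gcongr; omega
    simp only [play, steps_bind, steps]
    rw [add_mul]
    omega

end RunningTime

/-- The number of oracle calls and the running time of the game. -/
theorem play_cost_le {X : Type u} {K : ℕ} [NeZero K] (O : Dataset X K → (X → Fin K)) (P : Params)
    (hT : 1 ≤ P.T) (hμ : 0 < P.μ) (hμ1 : P.μ ≤ 1) (ω : ℕ → Obs X K × unitInterval) :
    ((play P ω P.T).calls O : ℝ) ≤ 6 * P.T * (1 + Real.log (P.T * K / P.μ)) ∧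
      ((play P ω P.T).steps O : ℝ) ≤ 160 * P.T ^ 2 * K * (1 + Real.log (P.T * K / P.μ)) := by
  have hT' : (1 : ℝ) ≤ P.T := by exact_mod_cast hT
  have hK : (1 : ℝ) ≤ K := by exact_mod_cast Nat.one_le_iff_ne_zero.2 (NeZero.ne K)
  set R : ℝ := P.T * K / P.μ with hR
  have hKμ : 1 ≤ K / P.μ := by rw [le_div_iff₀ hμ]; linarith
  have hR1 : 1 ≤ R := by
    rw [hR, mul_div_assoc]
    exact one_le_mul_of_one_le_of_one_le hT' hKμ
  have hlog : 0 ≤ Real.log R := Real.log_nonneg hR1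
  -- The initial width times `T` is `2 * (K / μ + 1) * T ≤ 4 * R`, as `K / μ ≥ 1`. One more than the
  -- floor gives a power of two above `R`, and the other `2` absorbs the factor `4`.
  set J : ℕ := ⌊Real.log R / Real.log 2⌋₊ + 3 with hJ
  have hl2 : (0.5 : ℝ) < Real.log 2 := by have := Real.log_two_gt_d9; linarith
  have hJ' : (J : ℝ) ≤ 2 * Real.log R + 3 := by
    have h1 : (⌊Real.log R / Real.log 2⌋₊ : ℝ) ≤ Real.log R / Real.log 2 :=
      Nat.floor_le (by positivity)
    have h2 : Real.log R / Real.log 2 ≤ 2 * Real.log R := by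
      rw [div_le_iff₀ (by linarith)]
      nlinarith
    rw [hJ]; push_cast; linarith
  have hpow : 2 * (K / P.μ + 1) * P.T < (2 : ℝ) ^ J := by
    have h1 : Real.log R / Real.log 2 < ⌊Real.log R / Real.log 2⌋₊ + 1 := Nat.lt_floor_add_one _
    rw [div_lt_iff₀ (by linarith)] at h1
    have h2 : R < 2 ^ (⌊Real.log R / Real.log 2⌋₊ + 1) := by
      rw [← Real.log_lt_log_iff (by linarith) (by positivity), Real.log_pow]
      push_cast
      exact h1
    have h3 : (2 : ℝ) ^ J = 4 * 2 ^ (⌊Real.log R / Real.log 2⌋₊ + 1) := by rw [hJ]; ring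
    have h4 : 2 * (K / P.μ + 1) * P.T ≤ 4 * R := by
      have : 4 * R = 4 * (K / P.μ) * P.T := by rw [hR]; ring
      rw [this]
      exact mul_le_mul_of_nonneg_right (by linarith) (by linarith)
    linarith
  have hc := calls_play_le O P ω hT J hpow P.T
  have hs := steps_play_le O P ω hT J hpow P.T
  have hc' : ((play P ω P.T).calls O : ℝ) ≤ P.T * (J + 1) := by exact_mod_cast hc
  have hs' : ((play P ω P.T).steps O : ℝ) ≤
      P.T * ((J + 1) * (P.T * (K * 10 + 2) + 7) + (8 * K + 30)) := by exact_mod_cast hs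
  have hTK : 1 ≤ (P.T : ℝ) * K := one_le_mul_of_one_le_of_one_le hT' hK
  have hTK' : (P.T : ℝ) ≤ P.T * K := le_mul_of_one_le_right (by linarith) hK
  have hKT : (K : ℝ) ≤ P.T * K := le_mul_of_one_le_left (by linarith) hT'
  constructor
  · calc ((play P ω P.T).calls O : ℝ) ≤ P.T * (J + 1) := hc'
      _ ≤ P.T * (6 * (1 + Real.log R)) := by gcongr; linarith
      _ = _ := by ring
  · calc ((play P ω P.T).steps O : ℝ) ≤
        P.T * ((J + 1) * (P.T * (K * 10 + 2) + 7) + (8 * K + 30)) := hs'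
      _ ≤ P.T * ((4 * (1 + Real.log R)) * (19 * (P.T * K)) + 38 * (P.T * K) * (1 + Real.log R)) := by
        gcongr
        · linarith
        · nlinarith
        · nlinarith
      _ = 114 * (P.T ^ 2 * K * (1 + Real.log R)) := by ring
      _ ≤ 160 * (P.T ^ 2 * K * (1 + Real.log R)) := by gcongr; norm_num
      _ = _ := by ring

/-! ### The influence function -/

theorem influence_of_nonneg {y : ℝ} (hy : 0 ≤ y) : influence y = Real.log (1 + y + y * y / 2) :=
  if_pos hy

theorem influence_neg (y : ℝ) : influence (-y) = -influence y := by
  unfold influence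
  rcases lt_trichotomy y 0 with h | rfl | h
  · rw [if_pos (by linarith), if_neg (by linarith), neg_neg]
    congr 1; ring
  · simp
  · rw [if_neg (by linarith), if_pos h.le]
    congr 2; ring

theorem influence_zero : influence 0 = 0 := by simp [influence]

/-- For the Lipschitz bound, with `c = b - a` the quotient of the two polynomials is at most `1 + c
+ c²/2 ≤ exp c`. Since the influence is odd, the general case follows in `influence_sub`. -/
theorem influence_sub_of_nonneg {a b : ℝ} (ha : 0 ≤ a) (hab : a ≤ b) :
    0 ≤ influence b - influence a ∧ influence b - influence a ≤ b - a := by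
  rw [influence_of_nonneg ha, influence_of_nonneg (ha.trans hab)]
  have hA : 0 < 1 + a + a * a / 2 := by positivity
  have hb : 0 ≤ b := ha.trans hab
  have hB : 0 < 1 + b + b * b / 2 := by positivity
  refine ⟨sub_nonneg.2 (Real.log_le_log hA (by nlinarith)), ?_⟩
  rw [← Real.log_div hB.ne' hA.ne', Real.log_le_iff_le_exp (by positivity), div_le_iff₀ hA]
  have h1 := Real.quadratic_le_exp_of_nonneg (sub_nonneg.2 hab)
  have h2 : 1 + b + b * b / 2 ≤ (1 + (b - a) + (b - a) ^ 2 / 2) * (1 + a + a * a / 2) := by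
    have h3 : 0 ≤ (b - a) * (a * a) := by have := sub_nonneg.2 hab; positivity
    have h4 : 0 ≤ (b - a) ^ 2 * a := by positivity
    have h5 : 0 ≤ (b - a) ^ 2 * (a * a) := by positivity
    nlinarith
  exact h2.trans (mul_le_mul_of_nonneg_right h1 hA.le)

theorem influence_sub {a b : ℝ} (hab : a ≤ b) :
    0 ≤ influence b - influence a ∧ influence b - influence a ≤ b - a := by
  rcases le_total 0 a with ha | ha
  · exact influence_sub_of_nonneg ha hab
  rcases le_total 0 b with hb | hb
  · have h1 := influence_sub_of_nonneg le_rfl hb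
    have h2 := influence_sub_of_nonneg le_rfl (neg_nonneg.2 ha)
    rw [influence_zero, influence_neg] at *
    constructor <;> linarith [h1.1, h1.2, h2.1, h2.2]
  · have h1 := influence_sub_of_nonneg (neg_nonneg.2 hb) (neg_le_neg hab)
    rw [influence_neg, influence_neg] at h1
    constructor <;> linarith [h1.1, h1.2]

theorem influence_mono : Monotone influence := fun _ _ h => sub_nonneg.1 (influence_sub h).1

theorem abs_influence_sub_le (a b : ℝ) : |influence a - influence b| ≤ |a - b| := by
  rcases le_total a b with h | h
  · have := influence_sub h
    rw [abs_sub_comm, abs_of_nonneg this.1, abs_sub_comm, abs_of_nonneg (sub_nonneg.2 h)]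
    exact this.2
  · have := influence_sub h
    rw [abs_of_nonneg this.1, abs_of_nonneg (sub_nonneg.2 h)]
    exact this.2

/-- For negative `y` the claim is `(1 + y + y²/2)(1 - y + y²/2) = 1 + y⁴/4 ≥ 1`. -/
theorem exp_influence_le (y : ℝ) : Real.exp (influence y) ≤ 1 + y + y ^ 2 / 2 := by
  unfold influence
  split_ifs with h
  · rw [Real.exp_log (by positivity)]
    exact le_of_eq (by ring)
  · have h1 : 0 < 1 - y + y * y / 2 := by nlinarith
    rw [Real.exp_neg, Real.exp_log h1]
    rw [inv_le_iff_one_le_mul₀ h1]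
    nlinarith [sq_nonneg (y ^ 2)]

theorem exp_neg_influence_le (y : ℝ) : Real.exp (-influence y) ≤ 1 - y + y ^ 2 / 2 := by
  have := exp_influence_le (-y)
  rw [influence_neg] at this
  linarith [neg_sq y]

theorem measurable_influence : Measurable influence := influence_mono.measurable

/-! ### The binary search -/

section Search

variable {X : Type u} {K : ℕ} {O : Dataset X K → (X → Fin K)} {pols : Finset (X → Fin K)}

/-- This makes the sign test of the search informative: a nonnegative sum for the oracle's policy
forces nonnegative sums for all policies. -/
theorem IsERM.influenceSum_le (hO : IsERM pols O) (α z : ℝ) (h : Dataset X K) {π : X → Fin K}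
    (hπ : π ∈ pols) :
    influenceSum α h (O (costData α z h)) z ≤ influenceSum α h π z := by
  have := (hO (costData α z h)).2 π hπ
  rwa [sum_costData, sum_costData] at this

/-- The two sign hypotheses are the invariants of the loop. The left end moves to a midpoint only if
the oracle certifies nonnegativity for every policy, the right end only if the oracle's own sum
there is negative. The existential `z` is the final left end, which the program does not return. -/
theorem eval_search_spec (hO : IsERM pols O) {T : ℕ} (hT : 0 < T) (α : ℝ) (h : Dataset X K)
    (n : ℕ) : ∀ zl zr : ℝ, (zr - zl) * T < 2 ^ n → (∀ π ∈ pols, 0 ≤ influenceSum α h π zl) →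
      influenceSum α h (O (costData α zr h)) zr ≤ 0 →
      (∃ z, (search T α h (n + 1) zl zr).eval O - z < 1 / T ∧
        ∀ π ∈ pols, 0 ≤ influenceSum α h π z) ∧
      influenceSum α h (O (costData α ((search T α h (n + 1) zl zr).eval O) h))
        ((search T α h (n + 1) zl zr).eval O) ≤ 0 := by
  have hT' : (0 : ℝ) < T := by exact_mod_cast hT
  induction n with
  | zero =>
    intro zl zr hw hl hr
    have hc : ¬ 1 / (T : ℝ) ≤ zr - zl := by
      rw [div_le_iff₀ hT']
      simpa using hw
    rw [eval_search_succ, if_neg hc]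
    exact ⟨⟨zl, not_le.1 hc, hl⟩, hr⟩
  | succ n ih =>
    intro zl zr hw hl hr
    have h1 : (zr - (zl + zr) / 2) * T < 2 ^ n := by rw [pow_succ] at hw; linarith
    have h2 : ((zl + zr) / 2 - zl) * T < 2 ^ n := by rw [pow_succ] at hw; linarith
    rw [eval_search_succ]
    split_ifs with hc hm
    · exact ih _ _ h1 (fun π hπ => hm.trans (hO.influenceSum_le α _ h hπ)) hr
    · exact ih _ _ h2 hl (not_le.1 hm).le
    · exact ⟨⟨zl, not_le.1 hc, hl⟩, hr⟩

theorem influenceSum_nonneg {α : ℝ} (hα : 0 ≤ α) {h : Dataset X K} {z : ℝ} (π : X → Fin K)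
    (hz : ∀ e ∈ h, ∀ a, z ≤ e.2 a) : 0 ≤ influenceSum α h π z := by
  refine List.sum_nonneg fun c hc => ?_
  obtain ⟨e, he, rfl⟩ := List.mem_map.1 hc
  rw [← influence_zero]
  exact influence_mono (mul_nonneg hα (sub_nonneg.2 (hz e he _)))

theorem influenceSum_nonpos {α : ℝ} (hα : 0 ≤ α) {h : Dataset X K} {z : ℝ} (π : X → Fin K)
    (hz : ∀ e ∈ h, ∀ a, e.2 a ≤ z) : influenceSum α h π z ≤ 0 := by
  refine (List.sum_le_card_nsmul _ 0 fun c hc => ?_).trans (by simp)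
  obtain ⟨e, he, rfl⟩ := List.mem_map.1 hc
  rw [← influence_zero]
  exact influence_mono (mul_nonpos_of_nonneg_of_nonpos hα (sub_nonpos.2 (hz e he _)))

theorem influenceSum_anti {α : ℝ} (hα : 0 ≤ α) (h : Dataset X K) (π : X → Fin K) {z z' : ℝ}
    (hz : z ≤ z') : influenceSum α h π z' ≤ influenceSum α h π z := by
  refine List.sum_le_sum fun e _ => influence_mono ?_
  exact mul_le_mul_of_nonneg_left (by linarith) hα

theorem abs_influenceSum_sub_le {α : ℝ} (hα : 0 ≤ α) (h : Dataset X K) (π : X → Fin K)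
    (z z' : ℝ) :
    |influenceSum α h π z - influenceSum α h π z'| ≤ h.length * (α * |z - z'|) := by
  induction h with
  | nil => simp [influenceSum]
  | cons e h ih =>
    simp only [influenceSum, List.map_cons, List.sum_cons, List.length_cons, Nat.cast_add,
      Nat.cast_one] at ih ⊢
    have h1 := abs_influence_sub_le (α * (e.2 (π e.1) - z)) (α * (e.2 (π e.1) - z'))
    have h2 : |α * (e.2 (π e.1) - z) - α * (e.2 (π e.1) - z')| = α * |z - z'| := by
      rw [← abs_of_nonneg hα, ← abs_mul, abs_of_nonneg hα, ← abs_neg]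
      congr 1; ring
    rw [h2] at h1
    rw [add_sub_add_comm]
    refine (abs_add_le _ _).trans ?_
    linarith

/-- Both invariants hold initially because no estimate leaves `[-(K/μ + 1), K/μ + 1]`: at the ends
of this interval all influences have the same sign. -/
theorem searchValue_spec (hO : IsERM pols O) (P : Params) (hT : 0 < P.T) (t : ℕ)
    (h : Dataset X K) (hh : ∀ e ∈ h, ∀ a, |e.2 a| ≤ K / P.μ + 1) :
    (∃ z, searchValue O P t h - z < 1 / P.T ∧
        ∀ π ∈ pols, 0 ≤ influenceSum (scale K P t) h π z) ∧
      influenceSum (scale K P t) h ((choosePolicy P t h).eval O) (searchValue O P t h) ≤ 0 := by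
  have hα : 0 ≤ scale K P t := Real.sqrt_nonneg _
  have := eval_search_spec hO hT (scale K P t) h (maxIter K P - 1) _ _ (maxIter_sufficient K P)
    (fun π _ => influenceSum_nonneg hα π fun e he a => (abs_le.1 (hh e he a)).1)
    (influenceSum_nonpos hα _ fun e he a => (abs_le.1 (hh e he a)).2)
  have h1 : maxIter K P - 1 + 1 = maxIter K P := by simp [maxIter]
  rw [h1] at this
  rw [eval_choosePolicy]
  exact this

end Search

/-! ### Measurability -/

section Measurability

/-- Used to evaluate at a random action or at a policy with random index: no σ-algebra on the space
of policies is needed. -/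
theorem measurable_eval_of_countable {Ω ι β : Type*} [MeasurableSpace Ω] [Countable ι]
    [MeasurableSpace ι] [MeasurableSingletonClass ι] [MeasurableSpace β] {f : ι → Ω → β}
    (hf : ∀ i, Measurable (f i)) {g : Ω → ι} (hg : Measurable g) :
    Measurable fun ω => f (g ω) ω := by
  have : Measurable fun p : ι × Ω => f p.1 p.2 := measurable_from_prod_countable_right hf
  exact this.comp (hg.prodMk measurable_id)

variable {Ω : Type*} [MeasurableSpace Ω]

theorem measurable_argminList {K : ℕ} (l : List (Fin K)) (b : Fin K) :
    Measurable fun m : Fin K → ℝ => argminList m l b := by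
  induction l generalizing b with
  | nil => exact measurable_const
  | cons a l ih =>
    simp only [argminList]
    exact Measurable.ite (measurableSet_le (measurable_pi_apply _) (measurable_pi_apply _))
      (ih b) (ih a)

theorem measurable_sampleList {K : ℕ} [NeZero K] {p : Ω → Fin K → ℝ} (hp : Measurable p)
    {r : Ω → ℝ} (hr : Measurable r) (l : List (Fin K)) {acc : Ω → ℝ} (hacc : Measurable acc) :
    Measurable fun ω => sampleList (p ω) (r ω) l (acc ω) := by
  induction l generalizing acc with
  | nil => exact measurable_const
  | cons a l ih =>
    simp only [sampleList]
    have h1 : Measurable fun ω => acc ω + p ω a := hacc.add ((measurable_pi_apply a).comp hp)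
    exact Measurable.ite (measurableSet_le h1 hr) (ih h1) measurable_const

section Round

variable {K : ℕ} {m ℓ : Ω → Fin K → ℝ} {r : Ω → ℝ} {b : Ω → Fin K}

theorem measurable_apply_fin (hm : Measurable m) (hb : Measurable b) :
    Measurable fun ω => m ω (b ω) :=
  measurable_eval_of_countable (f := fun a ω => m ω a)
    (fun a => (measurable_pi_apply a).comp hm) hb

variable [NeZero K]

theorem measurable_bestAction (hm : Measurable m) : Measurable fun ω => bestAction (m ω) :=
  (measurable_argminList _ _).comp hm

theorem measurableSet_retained (σ : ℝ) (hm : Measurable m) (a : Fin K) :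
    MeasurableSet {ω | retained σ (m ω) a = true} := by
  simp only [retained, decide_eq_true_eq]
  exact measurableSet_le ((measurable_pi_apply a).comp hm)
    ((measurable_apply_fin hm (measurable_bestAction hm)).add_const σ)

theorem measurable_target (σ : ℝ) (hm : Measurable m) (hb : Measurable b) :
    Measurable fun ω => target σ (m ω) (b ω) :=
  measurable_eval_of_countable (f := fun a ω => target σ (m ω) a)
    (fun a => Measurable.ite (measurableSet_retained σ hm a) measurable_const
      (measurable_bestAction hm)) hb

theorem measurable_weight (σ μ : ℝ) (hm : Measurable m) (hb : Measurable b) :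
    Measurable fun ω => weight σ μ (m ω) (b ω) := by
  refine measurable_pi_lambda _ fun a => ?_
  refine Measurable.add ?_ ?_
  · exact Measurable.ite (measurableSet_eq_fun measurable_const (measurable_target σ hm hb))
      measurable_const measurable_const
  · refine Measurable.ite (measurableSet_retained σ hm a) (measurable_const.div ?_) measurable_const
    exact Finset.measurable_sum _ fun a _ => Measurable.ite (measurableSet_retained σ hm a)
      measurable_const measurable_const

theorem measurable_sampled (σ μ : ℝ) (hm : Measurable m) (hb : Measurable b) (hr : Measurable r) :
    Measurable fun ω => sampled σ μ (m ω) (b ω) (r ω) :=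
  measurable_sampleList (measurable_weight σ μ hm hb) hr _ measurable_const

theorem measurable_estimator (σ μ : ℝ) (hm : Measurable m) (hℓ : Measurable ℓ) (hb : Measurable b)
    (hr : Measurable r) : Measurable fun ω => estimator σ μ (m ω) (ℓ ω) (b ω) (r ω) := by
  refine measurable_pi_lambda _ fun a => ?_
  have hs := measurable_sampled σ μ hm hb hr
  have ht := measurable_target σ hm (measurable_const (a := a))
  refine Measurable.add (Measurable.ite (measurableSet_eq_fun hs ht) ?_ measurable_const) ?_
  · exact ((measurable_apply_fin hℓ hs).sub (measurable_apply_fin hm hs)).div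
      (measurable_apply_fin (measurable_weight σ μ hm hb) hs)
  · exact (measurable_apply_fin hm ht).sub (measurable_apply_fin hm (measurable_bestAction hm))

end Round

section Oracle

variable {X : Type u} [MeasurableSpace X] {K : ℕ}

/-- A random data set of constant length with measurable entries. -/
def MeasurableData (H : Ω → Dataset X K) : Prop :=
  ∃ (n : ℕ) (v : Ω → Fin n → X × (Fin K → ℝ)), Measurable v ∧ ∀ ω, H ω = List.ofFn (v ω)

theorem MeasurableData.nil : MeasurableData fun _ : Ω => ([] : Dataset X K) :=
  ⟨0, fun _ => Fin.elim0, measurable_pi_lambda _ fun i => i.elim0, fun _ => rfl⟩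

theorem MeasurableData.cons {H : Ω → Dataset X K} (hH : MeasurableData H)
    {e : Ω → X × (Fin K → ℝ)} (he : Measurable e) : MeasurableData fun ω => e ω :: H ω := by
  obtain ⟨n, v, hv, hHv⟩ := hH
  refine ⟨n + 1, fun ω => Fin.cons (e ω) (v ω), measurable_pi_lambda _ fun i => ?_, fun ω => ?_⟩
  · refine Fin.cases ?_ (fun j => ?_) i
    · simpa using he
    · simpa using (measurable_pi_apply j).fun_comp hv
  · dsimp only
    rw [hHv, List.ofFn_cons]

theorem MeasurableData.costData {H : Ω → Dataset X K} (hH : MeasurableData H) (α : ℝ)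
    {z : Ω → ℝ} (hz : Measurable z) :
    MeasurableData fun ω => ArcBandit.costData α (z ω) (H ω) := by
  obtain ⟨n, v, hv, hHv⟩ := hH
  refine ⟨n, fun ω j => ((v ω j).1, fun a => influence (α * ((v ω j).2 a - z ω))), ?_, fun ω => ?_⟩
  · refine measurable_pi_lambda _ fun j => ?_
    have hj : Measurable fun ω => v ω j := (measurable_pi_apply j).comp hv
    refine hj.fst.prodMk (measurable_pi_lambda _ fun a => measurable_influence.comp ?_)
    exact (((measurable_pi_apply a).comp hj.snd).sub hz).const_mul α
  · dsimp only
    rw [hHv, ArcBandit.costData, List.map_ofFn]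
    rfl

theorem MeasurableData.influenceSum {H : Ω → Dataset X K} (hH : MeasurableData H) (α : ℝ)
    {z : Ω → ℝ} (hz : Measurable z) {π : X → Fin K} (hπ : Measurable π) :
    Measurable fun ω => ArcBandit.influenceSum α (H ω) π (z ω) := by
  obtain ⟨n, v, hv, hHv⟩ := hH
  have : ∀ ω, ArcBandit.influenceSum α (H ω) π (z ω)
      = ∑ j, influence (α * ((v ω j).2 (π (v ω j).1) - z ω)) := fun ω => by
    rw [hHv, ArcBandit.influenceSum, List.map_ofFn, List.sum_ofFn]
    rfl
  simp only [this]
  refine Finset.measurable_sum _ fun j _ => measurable_influence.comp ?_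
  have hj : Measurable fun ω => v ω j := (measurable_pi_apply j).comp hv
  have h1 : Measurable fun ω => (v ω j).2 (π (v ω j).1) :=
    measurable_eval_of_countable (f := fun a ω => (v ω j).2 a)
      (fun a => (measurable_pi_apply a).comp hj.snd) (hπ.comp hj.fst)
  exact (h1.sub hz).const_mul α

variable {N : ℕ} {pol : Fin N → X → Fin K} {I : Dataset X K → Fin N}

theorem MeasurableData.index {H : Ω → Dataset X K} (hH : MeasurableData H)
    (hI : ∀ n : ℕ, Measurable fun v : Fin n → X × (Fin K → ℝ) => I (List.ofFn v)) :
    Measurable fun ω => I (H ω) := by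
  obtain ⟨n, v, hv, hHv⟩ := hH
  simp only [hHv]
  exact (hI n).comp hv

/-- The interval ends are random, so the induction runs over arbitrary measurable ends. The policy
at the midpoint enters through its index in `Fin N`, and the sum is measurable for each fixed index.
-/
theorem MeasurableData.search (hpol : ∀ i, Measurable (pol i))
    (hI : ∀ n : ℕ, Measurable fun v : Fin n → X × (Fin K → ℝ) => I (List.ofFn v))
    {H : Ω → Dataset X K} (hH : MeasurableData H) (T : ℕ) (α : ℝ) (n : ℕ)
    {zl zr : Ω → ℝ} (hl : Measurable zl) (hr : Measurable zr) :
    Measurable fun ω => (ArcBandit.search T α (H ω) n (zl ω) (zr ω)).eval fun S => pol (I S) := by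
  induction n generalizing zl zr with
  | zero => exact hr
  | succ n ih =>
    simp only [eval_search_succ]
    have hm : Measurable fun ω => (zl ω + zr ω) / 2 := (hl.add hr).div_const 2
    refine Measurable.ite (measurableSet_le measurable_const (hr.sub hl))
      (Measurable.ite (measurableSet_le measurable_const ?_) (ih hm hr) (ih hl hm)) hr
    exact measurable_eval_of_countable
      (f := fun i ω => ArcBandit.influenceSum α (H ω) (pol i) ((zl ω + zr ω) / 2))
      (fun i => hH.influenceSum α hm (hpol i)) ((hH.costData α hm).index hI)

end Oracle

end Measurability

/-! ### The sampling distribution of a round -/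

section Sampling

variable {K : ℕ}

theorem argminList_le (m : Fin K → ℝ) (l : List (Fin K)) (b : Fin K) :
    m (argminList m l b) ≤ m b ∧ ∀ a ∈ l, m (argminList m l b) ≤ m a := by
  induction l generalizing b with
  | nil => simp [argminList]
  | cons a l ih =>
    simp only [argminList]
    split_ifs with hc
    · refine ⟨(ih b).1, fun c hc' => ?_⟩
      rcases List.mem_cons.1 hc' with rfl | h
      · exact (ih b).1.trans hc
      · exact (ih b).2 c h
    · refine ⟨(ih a).1.trans (not_le.1 hc).le, fun c hc' => ?_⟩
      rcases List.mem_cons.1 hc' with rfl | h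
      · exact (ih c).1
      · exact (ih a).2 c h

variable [NeZero K]

theorem bestAction_le (m : Fin K → ℝ) (a : Fin K) : m (bestAction m) ≤ m a :=
  (argminList_le m _ _).2 a (List.mem_finRange a)

variable {σ μ : ℝ}

theorem retained_iff {m : Fin K → ℝ} {a : Fin K} :
    retained σ m a = true ↔ m a ≤ m (bestAction m) + σ := decide_eq_true_iff

theorem retained_target (hσ : 0 ≤ σ) (m : Fin K → ℝ) (a : Fin K) :
    retained σ m (target σ m a) = true := by
  unfold target remap
  split_ifs with h
  · exact h
  · rw [retained_iff]; linarith

theorem target_le (hσ : 0 ≤ σ) (m : Fin K → ℝ) (a : Fin K) :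
    m (target σ m a) ≤ m (bestAction m) + σ := retained_iff.1 (retained_target hσ m a)

theorem one_le_retainedCard (hσ : 0 ≤ σ) (m : Fin K → ℝ) : 1 ≤ retainedCard σ m := by
  unfold retainedCard
  have : (if retained σ m (target σ m 0) = true then (1 : ℝ) else 0)
      ≤ ∑ a, if retained σ m a = true then (1 : ℝ) else 0 :=
    Finset.single_le_sum (f := fun a => if retained σ m a = true then (1 : ℝ) else 0)
      (fun i _ => by positivity) (Finset.mem_univ _)
  rwa [if_pos (retained_target hσ m 0)] at this

theorem retainedCard_le (m : Fin K → ℝ) : retainedCard σ m ≤ K := by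
  unfold retainedCard
  refine (Finset.sum_le_card_nsmul _ _ 1 fun a _ => ?_).trans (by simp)
  split_ifs <;> norm_num

theorem weight_nonneg (hσ : 0 ≤ σ) (hμ : 0 ≤ μ) (hμ1 : μ ≤ 1) (m : Fin K → ℝ) (b a : Fin K) :
    0 ≤ weight σ μ m b a := by
  have := one_le_retainedCard hσ m
  unfold weight
  refine add_nonneg ?_ ?_ <;> split_ifs
  · linarith
  · exact le_rfl
  · positivity
  · exact le_rfl

theorem le_weight (hσ : 0 ≤ σ) (hμ : 0 ≤ μ) (hμ1 : μ ≤ 1) {m : Fin K → ℝ} (b : Fin K) {a : Fin K}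
    (ha : retained σ m a = true) : μ / K ≤ weight σ μ m b a := by
  have h1 := one_le_retainedCard hσ m
  have h2 : retainedCard σ m ≤ K := retainedCard_le m
  unfold weight
  rw [if_pos ha]
  have h3 : 0 ≤ if a = target σ m b then 1 - μ else 0 := by split_ifs <;> linarith
  have h4 : μ / K ≤ μ / retainedCard σ m := by gcongr
  linarith

theorem weight_eq_zero (hσ : 0 ≤ σ) {m : Fin K → ℝ} (b : Fin K) {a : Fin K}
    (ha : ¬ retained σ m a = true) : weight σ μ m b a = 0 := by
  unfold weight
  rw [if_neg ha, if_neg, add_zero]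
  rintro rfl
  exact ha (retained_target hσ m b)

theorem sum_weight_mul (m : Fin K → ℝ) (b : Fin K) (f : Fin K → ℝ) :
    ∑ a, weight σ μ m b a * f a = (1 - μ) * f (target σ m b) +
      μ / retainedCard σ m * ∑ a, if retained σ m a then f a else 0 := by
  simp only [weight, add_mul, Finset.sum_add_distrib, ite_mul, zero_mul]
  rw [Finset.sum_ite_eq' Finset.univ (target σ m b), if_pos (Finset.mem_univ _), Finset.mul_sum]
  congr 1
  refine Finset.sum_congr rfl fun a _ => ?_
  split_ifs <;> simp

theorem sum_weight (hσ : 0 ≤ σ) (m : Fin K → ℝ) (b : Fin K) : ∑ a, weight σ μ m b a = 1 := by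
  have h := sum_weight_mul (σ := σ) (μ := μ) m b fun _ => 1
  have h1 := one_le_retainedCard hσ m
  simp only [mul_one] at h
  rw [h]
  change 1 - μ + μ / retainedCard σ m * retainedCard σ m = 1
  rw [div_mul_cancel₀ _ (by positivity)]
  ring

theorem intervalIntegrable_sampleList (p : Fin K → ℝ) (f : Fin K → ℝ) (l : List (Fin K))
    (acc s t : ℝ) :
    IntervalIntegrable (fun r => f (sampleList p r l acc)) volume s t := by
  rw [intervalIntegrable_iff]
  refine Measure.integrableOn_of_bounded (M := ∑ a, |f a|) (by simp) ?_ ?_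
  · exact ((measurable_of_countable f).comp (measurable_sampleList measurable_const measurable_id l
      measurable_const)).aestronglyMeasurable
  · refine Filter.Eventually.of_forall fun r => ?_
    exact Finset.single_le_sum (f := fun a => |f a|) (fun i _ => abs_nonneg _) (Finset.mem_univ _)

/-- The seeds that select the head of the list form an interval of length `p a`; the integral is
split at its right end and the rest is the induction hypothesis. -/
theorem integral_sampleList {p : Fin K → ℝ} (hp : ∀ a, 0 ≤ p a) (f : Fin K → ℝ)
    (l : List (Fin K)) (acc : ℝ) :
    ∫ r in acc..(acc + (l.map p).sum), f (sampleList p r l acc) =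
      (l.map fun a => p a * f a).sum := by
  induction l generalizing acc with
  | nil => simp
  | cons a l ih =>
    have hl : 0 ≤ (l.map p).sum := List.sum_nonneg fun x hx => by
      obtain ⟨c, _, rfl⟩ := List.mem_map.1 hx
      exact hp c
    simp only [List.map_cons, List.sum_cons]
    rw [← intervalIntegral.integral_add_adjacent_intervals (b := acc + p a)
      (intervalIntegrable_sampleList _ _ _ _ _ _) (intervalIntegrable_sampleList _ _ _ _ _ _),
      ← ih (acc + p a), ← add_assoc]
    congr 1
    · have : ∫ r in acc..(acc + p a), f (sampleList p r (a :: l) acc)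
          = ∫ r in acc..(acc + p a), f a := by
        refine intervalIntegral.integral_congr_ae ?_
        -- At `r = acc + p a` itself the scan already moves on; this single point is null.
        filter_upwards [Measure.ae_ne volume (acc + p a)] with r hr hr'
        rw [Set.uIoc_of_le (by linarith [hp a])] at hr'
        rw [sampleList, if_neg (not_le.2 (lt_of_le_of_ne hr'.2 hr))]
      rw [this]
      simp
    · refine intervalIntegral.integral_congr fun r hr => ?_
      rw [Set.uIcc_of_le (by linarith)] at hr
      simp only [sampleList, if_pos hr.1]

theorem integral_sampled (hσ : 0 ≤ σ) (hμ : 0 ≤ μ) (hμ1 : μ ≤ 1) (m : Fin K → ℝ) (b : Fin K)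
    (f : Fin K → ℝ) :
    ∫ r : unitInterval, f (sampled σ μ m b r) = ∑ a, weight σ μ m b a * f a := by
  have h := integral_sampleList (weight_nonneg hσ hμ hμ1 m b) f (List.finRange K) 0
  rw [← Fin.sum_univ_def, ← Fin.sum_univ_def, sum_weight hσ, zero_add,
    intervalIntegral.integral_of_le zero_le_one, ← integral_Icc_eq_integral_Ioc] at h
  rw [← h]
  exact integral_subtype (s := Set.Icc (0 : ℝ) 1) measurableSet_Icc
    (fun r => f (sampleList (weight σ μ m b) r (List.finRange K) 0))

end Sampling

/-- The loss of an action exceeds that of another by at most the difference of their predictions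
and twice the prediction error. -/
theorem loss_sub_le {K : ℕ} (m ℓ : Fin K → ℝ) (a c : Fin K) :
    ℓ a - ℓ c ≤ m a - m c + 2 * ‖ℓ - m‖ := by
  have h1 := abs_le.1 (norm_le_pi_norm (ℓ - m) a)
  have h2 := abs_le.1 (norm_le_pi_norm (ℓ - m) c)
  simp only [Pi.sub_apply] at h1 h2
  linarith [h1.2, h2.1]

theorem two_mul_le_sq_div_add {σ : ℝ} (hσ : 0 < σ) (u : ℝ) : 2 * u ≤ u ^ 2 / σ + σ := by
  rw [div_add' _ _ _ hσ.ne', le_div_iff₀ hσ]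
  nlinarith [sq_nonneg (u - σ)]

/-! ### Bias and variance of the estimator, and the cost of remapping and exploring. -/

section Estimator

variable {K : ℕ} [NeZero K] {σ μ : ℝ} {m ℓ : Fin K → ℝ}

theorem weight_target_pos (hσ : 0 ≤ σ) (hμ : 0 < μ) (hμ1 : μ ≤ 1) (m : Fin K → ℝ) (b a : Fin K) :
    0 < weight σ μ m b (target σ m a) := by
  have hK : (0 : ℝ) < K := by exact_mod_cast Nat.pos_of_ne_zero (NeZero.ne K)
  exact (div_pos hμ hK).trans_le (le_weight hσ hμ.le hμ1 b (retained_target hσ m a))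

/-- The value of the estimator if the action `c` is sampled. -/
noncomputable def estimateAt (σ μ : ℝ) (m ℓ : Fin K → ℝ) (b a c : Fin K) : ℝ :=
  (if c = target σ m a then (ℓ c - m c) / weight σ μ m b c else 0)
    + (m (target σ m a) - m (bestAction m))

/-- Remapped actions are retained and hence sampled with positive probability, so the importance
weight cancels exactly. The mean does not depend on the followed action `b`. -/
theorem integral_estimator (hσ : 0 ≤ σ) (hμ : 0 < μ) (hμ1 : μ ≤ 1) (m ℓ : Fin K → ℝ)
    (b a : Fin K) :
    ∫ r : unitInterval, estimator σ μ m ℓ b r a = ℓ (target σ m a) - m (bestAction m) := by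
  have h := integral_sampled hσ hμ.le hμ1 m b (estimateAt σ μ m ℓ b a)
  refine h.trans ?_
  have hw := weight_target_pos hσ hμ hμ1 m b a
  simp only [estimateAt, mul_add, Finset.sum_add_distrib, ← Finset.sum_mul, sum_weight hσ, one_mul,
    mul_ite, mul_zero, Finset.sum_ite_eq', Finset.mem_univ, if_true]
  rw [mul_div_cancel₀ _ hw.ne']
  ring

/-- The estimator is an importance-weighted error `q` plus a predicted gap `s ∈ [0, σ]`, and `(q +
s)² ≤ 2q² + 2s²`. Weighting leaves one division by a probability of at least `μ / K`. Without the
remapping, `s` would not be bounded by `σ`. -/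
theorem integral_estimator_sq_le (hσ : 0 ≤ σ) (hμ : 0 < μ) (hμ1 : μ ≤ 1) (m ℓ : Fin K → ℝ)
    (b a : Fin K) :
    ∫ r : unitInterval, estimator σ μ m ℓ b r a ^ 2 ≤ 2 * (K * ‖ℓ - m‖ ^ 2 / μ + σ ^ 2) := by
  have h := integral_sampled hσ hμ.le hμ1 m b fun c => estimateAt σ μ m ℓ b a c ^ 2
  refine (h.le).trans ?_
  have hK : (0 : ℝ) < K := by exact_mod_cast Nat.pos_of_ne_zero (NeZero.ne K)
  have hw := weight_target_pos hσ hμ hμ1 m b a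
  have hw' := le_weight hσ hμ.le hμ1 b (retained_target hσ m a)
  set s := m (target σ m a) - m (bestAction m) with hs
  have hs0 : 0 ≤ s := sub_nonneg.2 (bestAction_le m _)
  have hs1 : s ≤ σ := by have := target_le hσ m a; linarith
  set q := fun c => if c = target σ m a then (ℓ c - m c) / weight σ μ m b c else 0 with hq
  have h1 : ∀ c, weight σ μ m b c * estimateAt σ μ m ℓ b a c ^ 2
      ≤ weight σ μ m b c * (2 * q c ^ 2) + weight σ μ m b c * (2 * s ^ 2) := fun c => by
    rw [← mul_add]
    refine mul_le_mul_of_nonneg_left ?_ (weight_nonneg hσ hμ.le hμ1 m b c)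
    change (q c + s) ^ 2 ≤ _
    nlinarith [sq_nonneg (q c - s)]
  have h2 : ∑ c, weight σ μ m b c * (2 * q c ^ 2)
      = 2 * ((ℓ (target σ m a) - m (target σ m a)) ^ 2 / weight σ μ m b (target σ m a)) := by
    rw [Finset.sum_eq_single (target σ m a)]
    · simp only [hq, if_true]
      field_simp
    · intro c _ hc
      simp [hq, hc]
    · simp
  have h3 : (ℓ (target σ m a) - m (target σ m a)) ^ 2 ≤ ‖ℓ - m‖ ^ 2 := by
    rw [sq_le_sq, abs_norm]
    exact norm_le_pi_norm (ℓ - m) _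
  calc ∑ c, weight σ μ m b c * estimateAt σ μ m ℓ b a c ^ 2
      ≤ ∑ c, (weight σ μ m b c * (2 * q c ^ 2) + weight σ μ m b c * (2 * s ^ 2)) :=
        Finset.sum_le_sum fun c _ => h1 c
    _ = 2 * ((ℓ (target σ m a) - m (target σ m a)) ^ 2 / weight σ μ m b (target σ m a))
        + 2 * s ^ 2 := by
        rw [Finset.sum_add_distrib, h2, ← Finset.sum_mul, sum_weight hσ, one_mul]
    _ ≤ 2 * (‖ℓ - m‖ ^ 2 / (μ / K)) + 2 * σ ^ 2 := by gcongr
    _ = _ := by field_simp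

theorem abs_estimator_le (hσ : 0 ≤ σ) (hμ : 0 < μ) (hμ1 : μ ≤ 1)
    (hm : ∀ a, m a ∈ Set.Icc (0 : ℝ) 1) (hℓ : ∀ a, ℓ a ∈ Set.Icc (0 : ℝ) 1) (b : Fin K) (r : ℝ)
    (a : Fin K) : |estimator σ μ m ℓ b r a| ≤ K / μ + 1 := by
  have hK : (0 : ℝ) < K := by exact_mod_cast Nat.pos_of_ne_zero (NeZero.ne K)
  unfold estimator
  set c := sampled σ μ m b r
  refine (abs_add_le _ _).trans (add_le_add ?_ ?_)
  · split_ifs with hc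
    · have h0 : 0 < weight σ μ m b c := hc ▸ weight_target_pos hσ hμ hμ1 m b a
      rw [abs_div, abs_of_pos h0]
      have h1 : |ℓ c - m c| ≤ 1 := by
        rw [abs_le]; constructor <;> linarith [(hm c).1, (hm c).2, (hℓ c).1, (hℓ c).2]
      have h2 : μ / K ≤ weight σ μ m b c :=
        hc ▸ le_weight hσ hμ.le hμ1 b (retained_target hσ m a)
      calc |ℓ c - m c| / weight σ μ m b c ≤ 1 / (μ / K) := by gcongr
        _ = K / μ := by field_simp
    · simp only [abs_zero]; positivity
  · rw [abs_le]
    constructor <;> linarith [(hm (target σ m a)).1, (hm (target σ m a)).2,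
      (hm (bestAction m)).1, (hm (bestAction m)).2]

/-- If `a` is not retained, its prediction exceeds the best one by more than `σ`, so moving to the
best action costs at most `2u - σ` with `u = ‖ℓ - m‖`, and `2u ≤ u²/σ + σ`. This is the source of
the term `E / σ`. -/
theorem loss_target_sub_le (hσ : 0 < σ) (m ℓ : Fin K → ℝ) (a : Fin K) :
    ℓ (target σ m a) - ℓ a ≤ ‖ℓ - m‖ ^ 2 / σ := by
  by_cases h : retained σ m a = true
  · rw [target, remap, if_pos h, sub_self]
    positivity
  · have h1 := loss_sub_le m ℓ (target σ m a) a
    have h2 : target σ m a = bestAction m := by rw [target, remap, if_neg h]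
    rw [retained_iff, not_le] at h
    rw [h2] at h1 ⊢
    have := two_mul_le_sq_div_add hσ ‖ℓ - m‖
    linarith

theorem loss_target_sub_target_le (hσ : 0 ≤ σ) (m ℓ : Fin K → ℝ) (b a : Fin K) :
    ℓ (target σ m b) - ℓ (target σ m a) ≤ σ + 2 * ‖ℓ - m‖ := by
  have h1 := loss_sub_le m ℓ (target σ m b) (target σ m a)
  have h2 := target_le hσ m b
  have h3 := bestAction_le m (target σ m a)
  linarith

/-- With probability `1 - μ` the remapped recommendation is played; a uniform retained action loses
at most `σ + 2‖ℓ - m‖` more than it. The last term is the bias of remapping `a`. -/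
theorem integral_loss_sampled_le (hσ : 0 < σ) (hμ : 0 < μ) (hμ1 : μ ≤ 1) (m ℓ : Fin K → ℝ)
    (b a : Fin K) :
    ∫ r : unitInterval, (ℓ (sampled σ μ m b r) - ℓ a) ≤
      (ℓ (target σ m b) - ℓ (target σ m a)) + μ * (σ + 2 * ‖ℓ - m‖) + ‖ℓ - m‖ ^ 2 / σ := by
  rw [integral_sampled hσ.le hμ.le hμ1 m b fun c => ℓ c - ℓ a, sum_weight_mul]
  have hc := one_le_retainedCard hσ.le m
  have h1 : ∑ c, (if retained σ m c then ℓ c - ℓ a else 0) ≤ retainedCard σ m *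
      (ℓ (target σ m b) - ℓ a + (σ + 2 * ‖ℓ - m‖)) := by
    rw [retainedCard, Finset.sum_mul]
    refine Finset.sum_le_sum fun c _ => ?_
    split_ifs with h
    · have h2 := loss_target_sub_target_le hσ.le m ℓ c b
      have h3 : target σ m c = c := by rw [target, remap, if_pos h]
      rw [h3] at h2
      linarith
    · simp
  have h2 := mul_le_mul_of_nonneg_left h1 (div_nonneg hμ.le (by linarith : 0 ≤ retainedCard σ m))
  rw [← mul_assoc, div_mul_cancel₀ _ (by positivity)] at h2
  have h3 := loss_target_sub_le hσ m ℓ a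
  linarith

/-- Only retained actions are ever played, and each is predicted within `σ` of every action. The
bound ignores the policy followed, so it needs no concentration and serves for tiny `σ`. -/
theorem integral_loss_sampled_le' (hσ : 0 < σ) (hμ : 0 < μ) (hμ1 : μ ≤ 1) (m ℓ : Fin K → ℝ)
    (b a : Fin K) :
    ∫ r : unitInterval, (ℓ (sampled σ μ m b r) - ℓ a) ≤ 2 * σ + ‖ℓ - m‖ ^ 2 / σ := by
  rw [integral_sampled hσ.le hμ.le hμ1 m b fun c => ℓ c - ℓ a]
  have h1 : ∀ c, weight σ μ m b c * (ℓ c - ℓ a)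
      ≤ weight σ μ m b c * (2 * σ + ‖ℓ - m‖ ^ 2 / σ) := fun c => by
    by_cases h : retained σ m c = true
    · refine mul_le_mul_of_nonneg_left ?_ (weight_nonneg hσ.le hμ.le hμ1 m b c)
      have h1 := loss_sub_le m ℓ c a
      have h2 := bestAction_le m a
      have h3 := two_mul_le_sq_div_add hσ ‖ℓ - m‖
      rw [retained_iff] at h
      linarith
    · simp [weight_eq_zero hσ.le b h]
  refine (Finset.sum_le_sum fun c _ => h1 c).trans ?_
  rw [← Finset.sum_mul, sum_weight hσ.le, one_mul]

end Estimator

/-! ### Expectations over a round -/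

section Expectation

variable {X : Type u} [MeasurableSpace X] {K : ℕ}

/-- The expected squared prediction error of a round. -/
noncomputable def sqError (D : Measure (Obs X K)) : ℝ := ∫ z, ‖z.2.1 - z.2.2‖ ^ 2 ∂D

/-- The losses and the predictions lie in the unit interval. -/
def LossesBounded (D : Measure (Obs X K)) : Prop :=
  ∀ᵐ z ∂D, ∀ a, z.2.1 a ∈ Set.Icc (0 : ℝ) 1 ∧ z.2.2 a ∈ Set.Icc (0 : ℝ) 1

theorem LossesBounded.ae_prod {D : Measure (Obs X K)} (hD : LossesBounded D) :
    ∀ᵐ y ∂(D.prod (volume : Measure unitInterval)),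
      ∀ a, y.1.2.1 a ∈ Set.Icc (0 : ℝ) 1 ∧ y.1.2.2 a ∈ Set.Icc (0 : ℝ) 1 :=
  Measure.quasiMeasurePreserving_fst.ae hD

theorem integrable_of_bounded {Ω : Type*} [MeasurableSpace Ω] {P : Measure Ω} [IsFiniteMeasure P]
    {f : Ω → ℝ} (hf : Measurable f) (C : ℝ) (h : ∀ᵐ ω ∂P, |f ω| ≤ C) : Integrable f P :=
  Integrable.of_bound hf.aestronglyMeasurable C h

theorem norm_sub_le_one_ae {D : Measure (Obs X K)} (hD : LossesBounded D) :
    ∀ᵐ z ∂D, ‖z.2.1 - z.2.2‖ ≤ 1 := by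
  filter_upwards [hD] with z hz
  refine (pi_norm_le_iff_of_nonneg zero_le_one).2 fun a => ?_
  have := hz a
  simp only [Set.mem_Icc] at this
  rw [Pi.sub_apply, Real.norm_eq_abs, abs_le]
  constructor <;> linarith [this.1.1, this.1.2, this.2.1, this.2.2]

theorem integrable_norm_sub {D : Measure (Obs X K)} [IsProbabilityMeasure D]
    (hD : LossesBounded D) : Integrable (fun z : Obs X K => ‖z.2.1 - z.2.2‖) D := by
  refine integrable_of_bounded (by fun_prop) 1 ?_
  filter_upwards [norm_sub_le_one_ae hD] with z hz
  rwa [abs_norm]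

theorem integrable_norm_sub_sq {D : Measure (Obs X K)} [IsProbabilityMeasure D]
    (hD : LossesBounded D) : Integrable (fun z : Obs X K => ‖z.2.1 - z.2.2‖ ^ 2) D := by
  refine integrable_of_bounded (by fun_prop) 1 ?_
  filter_upwards [norm_sub_le_one_ae hD] with z hz
  rw [abs_of_nonneg (by positivity)]
  exact pow_le_one₀ (norm_nonneg _) hz

/-- Jensen's inequality, as nonnegativity of the variance. -/
theorem integral_norm_sub_le {D : Measure (Obs X K)} [IsProbabilityMeasure D]
    (hD : LossesBounded D) : ∫ z, ‖z.2.1 - z.2.2‖ ∂D ≤ √(sqError D) := by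
  set c := ∫ z, ‖z.2.1 - z.2.2‖ ∂D with hc
  refine Real.le_sqrt_of_sq_le ?_
  have h1 : 0 ≤ ∫ z, (‖z.2.1 - z.2.2‖ - c) ^ 2 ∂D := integral_nonneg fun z => sq_nonneg _
  have h2 : ∫ z, (‖z.2.1 - z.2.2‖ - c) ^ 2 ∂D = sqError D - 2 * c * c + c ^ 2 := by
    have h3 : ∀ z : Obs X K, (‖z.2.1 - z.2.2‖ - c) ^ 2
      = ‖z.2.1 - z.2.2‖ ^ 2 - 2 * c * ‖z.2.1 - z.2.2‖ + c ^ 2 := fun z => by ring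
    simp only [h3]
    rw [integral_add, integral_sub, integral_const_mul, ← hc]
    · simp [sqError]
    · exact integrable_norm_sub_sq hD
    · exact (integrable_norm_sub hD).const_mul _
    · exact (integrable_norm_sub_sq hD).sub ((integrable_norm_sub hD).const_mul _)
    · exact integrable_const _
  nlinarith

variable [NeZero K]

/-- The estimated loss of the policy `π` in a round in which the learner follows `ρ`. -/
noncomputable def policyEstimate (σ μ : ℝ) (ρ π : X → Fin K) (y : Obs X K × unitInterval) : ℝ :=
  estimator σ μ y.1.2.2 y.1.2.1 (ρ y.1.1) y.2 (π y.1.1)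

/-- The excess loss over `π` of the learner in a round in which it follows `ρ`. -/
noncomputable def roundLoss (σ μ : ℝ) (ρ π : X → Fin K) (y : Obs X K × unitInterval) : ℝ :=
  y.1.2.1 (sampled σ μ y.1.2.2 (ρ y.1.1) y.2) - y.1.2.1 (π y.1.1)

/-- The loss of the remapped policy `π` relative to the prediction for the best action. -/
noncomputable def remappedLoss (σ : ℝ) (π : X → Fin K) (z : Obs X K) : ℝ :=
  z.2.1 (target σ z.2.2 (π z.1)) - z.2.2 (bestAction z.2.2)

/-- The expected loss of the remapped policy `π` relative to the best predicted loss. -/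
noncomputable def value (D : Measure (Obs X K)) (σ : ℝ) (π : X → Fin K) : ℝ :=
  ∫ z, remappedLoss σ π z ∂D

variable {σ μ : ℝ} {ρ π : X → Fin K}

theorem measurable_policyEstimate (hρ : Measurable ρ) (hπ : Measurable π) :
    Measurable (policyEstimate σ μ ρ π) :=
  measurable_apply_fin (measurable_estimator σ μ measurable_fst.snd.snd measurable_fst.snd.fst
    (hρ.comp measurable_fst.fst) (measurable_subtype_coe.comp measurable_snd))
    (hπ.comp measurable_fst.fst)

theorem measurable_roundLoss (hρ : Measurable ρ) (hπ : Measurable π) :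
    Measurable (roundLoss σ μ ρ π) :=
  (measurable_apply_fin measurable_fst.snd.fst (measurable_sampled σ μ measurable_fst.snd.snd
    (hρ.comp measurable_fst.fst) (measurable_subtype_coe.comp measurable_snd))).sub
    (measurable_apply_fin measurable_fst.snd.fst (hπ.comp measurable_fst.fst))

theorem measurable_remappedLoss (hπ : Measurable π) : Measurable (remappedLoss σ π) :=
  (measurable_apply_fin measurable_snd.fst
    (measurable_target σ measurable_snd.snd (hπ.comp measurable_fst))).sub
    (measurable_apply_fin measurable_snd.snd (measurable_bestAction measurable_snd.snd))

theorem abs_remappedLoss_le_ae {D : Measure (Obs X K)} (hD : LossesBounded D) (σ : ℝ) (π : X → Fin K) : ∀ᵐ z ∂D, |remappedLoss σ π z| ≤ 1 := by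
  filter_upwards [hD] with z hz
  have h1 := (hz (target σ z.2.2 (π z.1))).1
  have h2 := (hz (bestAction z.2.2)).2
  rw [remappedLoss, abs_le]
  constructor <;> linarith [h1.1, h1.2, h2.1, h2.2]

theorem integrable_remappedLoss {D : Measure (Obs X K)} [IsProbabilityMeasure D]
    (hD : LossesBounded D) (hπ : Measurable π) : Integrable (remappedLoss σ π) D :=
  integrable_of_bounded (measurable_remappedLoss hπ) 1 (abs_remappedLoss_le_ae hD σ π)

theorem abs_value_le {D : Measure (Obs X K)} [IsProbabilityMeasure D]
    (hD : LossesBounded D) (σ : ℝ) (π : X → Fin K) : |value D σ π| ≤ 1 := by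
  have := norm_integral_le_of_norm_le_const (f := remappedLoss σ π) (C := 1)
    (abs_remappedLoss_le_ae hD σ π)
  simpa [value] using this

/-- The fallback when concentration is unavailable. It is much better than the trivial `2` when
predictions are good, and keeps failure events at the scale of the regret bound. -/
theorem value_sub_value_le {D : Measure (Obs X K)} [IsProbabilityMeasure D]
    (hD : LossesBounded D) (hσ : 0 ≤ σ) (hρ : Measurable ρ) (hπ : Measurable π) :
    value D σ ρ - value D σ π ≤ σ + 2 * √(sqError D) := by
  rw [value, value, ← integral_sub (integrable_remappedLoss hD hρ) (integrable_remappedLoss hD hπ)]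
  have h1 := integral_norm_sub_le hD
  calc _ ≤ ∫ z, (σ + 2 * ‖z.2.1 - z.2.2‖) ∂D := by
        refine integral_mono ((integrable_remappedLoss hD hρ).sub (integrable_remappedLoss hD hπ))
          ((integrable_const _).add ((integrable_norm_sub hD).const_mul _)) fun z => ?_
        have := loss_target_sub_target_le hσ z.2.2 z.2.1 (ρ z.1) (π z.1)
        simp only [remappedLoss]
        linarith
    _ = σ + 2 * ∫ z, ‖z.2.1 - z.2.2‖ ∂D := by
        rw [integral_add (integrable_const _) ((integrable_norm_sub hD).const_mul _),
          integral_const_mul]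
        simp
    _ ≤ _ := by linarith

theorem abs_policyEstimate_le_ae {D : Measure (Obs X K)} (hD : LossesBounded D) (hσ : 0 ≤ σ) (hμ : 0 < μ) (hμ1 : μ ≤ 1) (ρ π : X → Fin K) :
    ∀ᵐ y ∂(D.prod (volume : Measure unitInterval)), |policyEstimate σ μ ρ π y| ≤ K / μ + 1 := by
  filter_upwards [hD.ae_prod] with y hy
  exact abs_estimator_le hσ hμ hμ1 (fun a => (hy a).2) (fun a => (hy a).1) _ _ _

theorem integrable_policyEstimate {D : Measure (Obs X K)} [IsProbabilityMeasure D]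
    (hD : LossesBounded D) (hσ : 0 ≤ σ) (hμ : 0 < μ) (hμ1 : μ ≤ 1) (hρ : Measurable ρ)
    (hπ : Measurable π) :
    Integrable (policyEstimate σ μ ρ π) (D.prod (volume : Measure unitInterval)) :=
  integrable_of_bounded (measurable_policyEstimate hρ hπ) _
    (abs_policyEstimate_le_ae hD hσ hμ hμ1 ρ π)

theorem integrable_policyEstimate_sq {D : Measure (Obs X K)} [IsProbabilityMeasure D]
    (hD : LossesBounded D) (hσ : 0 ≤ σ) (hμ : 0 < μ) (hμ1 : μ ≤ 1) (hρ : Measurable ρ)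
    (hπ : Measurable π) :
    Integrable (fun y => policyEstimate σ μ ρ π y ^ 2) (D.prod (volume : Measure unitInterval)) := by
  refine integrable_of_bounded ((measurable_policyEstimate hρ hπ).pow_const 2) ((K / μ + 1) ^ 2) ?_
  filter_upwards [abs_policyEstimate_le_ae hD hσ hμ hμ1 ρ π] with y hy
  rw [abs_pow]
  gcongr

theorem integral_policyEstimate {D : Measure (Obs X K)} [IsProbabilityMeasure D]
    (hD : LossesBounded D) (hσ : 0 ≤ σ) (hμ : 0 < μ) (hμ1 : μ ≤ 1) (hρ : Measurable ρ)
    (hπ : Measurable π) :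
    ∫ y, policyEstimate σ μ ρ π y ∂(D.prod (volume : Measure unitInterval)) = value D σ π := by
  rw [integral_prod _ (integrable_policyEstimate hD hσ hμ hμ1 hρ hπ)]
  exact integral_congr_ae (Filter.Eventually.of_forall fun z =>
    integral_estimator hσ hμ hμ1 z.2.2 z.2.1 (ρ z.1) (π z.1))

theorem integral_policyEstimate_sq_le {D : Measure (Obs X K)} [IsProbabilityMeasure D]
    (hD : LossesBounded D) (hσ : 0 ≤ σ) (hμ : 0 < μ) (hμ1 : μ ≤ 1) (hρ : Measurable ρ)
    (hπ : Measurable π) :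
    ∫ y, policyEstimate σ μ ρ π y ^ 2 ∂(D.prod (volume : Measure unitInterval)) ≤
      2 * (K * sqError D / μ + σ ^ 2) := by
  have hi := integrable_policyEstimate_sq hD hσ hμ hμ1 hρ hπ
  have hs := integrable_norm_sub_sq hD
  have hs' : Integrable (fun z : Obs X K => K * ‖z.2.1 - z.2.2‖ ^ 2 / μ) D :=
    (hs.const_mul _).div_const _
  have hs'' : Integrable (fun z : Obs X K => 2 * (K * ‖z.2.1 - z.2.2‖ ^ 2 / μ + σ ^ 2)) D :=
    (hs'.add (integrable_const _)).const_mul _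
  rw [integral_prod _ hi]
  refine (integral_mono hi.integral_prod_left hs'' fun z =>
    integral_estimator_sq_le hσ hμ hμ1 z.2.2 z.2.1 (ρ z.1) (π z.1)).trans (le_of_eq ?_)
  rw [integral_const_mul, integral_add hs' (integrable_const _), integral_div, integral_const_mul]
  simp [sqError]

/-- The exponential moments of the influence of an estimate. -/
theorem lintegral_exp_influence_le {D : Measure (Obs X K)} [IsProbabilityMeasure D]
    (hD : LossesBounded D) (hσ : 0 ≤ σ) (hμ : 0 < μ) (hμ1 : μ ≤ 1) (hρ : Measurable ρ)
    (hπ : Measurable π) {s : ℝ} (hs : s = 1 ∨ s = -1) (α z : ℝ) :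
    ∫⁻ y, ENNReal.ofReal (Real.exp (s * influence (α * (policyEstimate σ μ ρ π y - z))))
        ∂(D.prod (volume : Measure unitInterval)) ≤
      ENNReal.ofReal (Real.exp (s * (α * (value D σ π - z)) +
        α ^ 2 / 2 * (2 * (K * sqError D / μ + σ ^ 2) + (value D σ π - z) ^ 2))) := by
  have hi := integrable_policyEstimate hD hσ hμ hμ1 hρ hπ
  have hi2 := integrable_policyEstimate_sq hD hσ hμ hμ1 hρ hπ
  have h2 := integral_policyEstimate_sq_le hD hσ hμ hμ1 hρ hπ
  have h1 := integral_policyEstimate hD hσ hμ hμ1 hρ hπ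
  set v := value D σ π
  set V := 2 * (K * sqError D / μ + σ ^ 2)
  set g := policyEstimate σ μ ρ π
  -- The bound `1 + s * y + y² / 2` on `exp (s * ψ y)` at `y = α (g - z)`, sorted by powers of `g`
  -- so that only the first two moments of `g` enter.
  have hpt : ∀ y, Real.exp (s * influence (α * (g y - z))) ≤
      (1 - s * α * z + α ^ 2 / 2 * z ^ 2) + (s * α - α ^ 2 * z) * g y + α ^ 2 / 2 * g y ^ 2 := by
    intro y
    rcases hs with rfl | rfl
    · have := exp_influence_le (α * (g y - z))
      rw [one_mul]
      refine this.trans (le_of_eq ?_)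
      ring
    · have := exp_neg_influence_le (α * (g y - z))
      rw [neg_one_mul]
      refine this.trans (le_of_eq ?_)
      ring
  have hint' : Integrable (fun y => (1 - s * α * z + α ^ 2 / 2 * z ^ 2) +
      (s * α - α ^ 2 * z) * g y) (D.prod (volume : Measure unitInterval)) :=
    (integrable_const _).add (hi.const_mul _)
  have hint : Integrable (fun y => (1 - s * α * z + α ^ 2 / 2 * z ^ 2) +
      (s * α - α ^ 2 * z) * g y + α ^ 2 / 2 * g y ^ 2) (D.prod (volume : Measure unitInterval)) :=
    hint'.add (hi2.const_mul _)
  calc _ ≤ ∫⁻ y, ENNReal.ofReal ((1 - s * α * z + α ^ 2 / 2 * z ^ 2) +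
        (s * α - α ^ 2 * z) * g y + α ^ 2 / 2 * g y ^ 2)
          ∂(D.prod (volume : Measure unitInterval)) :=
        lintegral_mono fun y => ENNReal.ofReal_le_ofReal (hpt y)
    _ = ENNReal.ofReal (∫ y, ((1 - s * α * z + α ^ 2 / 2 * z ^ 2) +
        (s * α - α ^ 2 * z) * g y + α ^ 2 / 2 * g y ^ 2)
          ∂(D.prod (volume : Measure unitInterval))) :=
        (ofReal_integral_eq_lintegral_ofReal hint (Filter.Eventually.of_forall fun y =>
          (Real.exp_pos _).le.trans (hpt y))).symm
    _ ≤ _ := by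
        refine ENNReal.ofReal_le_ofReal ?_
        rw [integral_add hint' (hi2.const_mul _),
          integral_add (integrable_const _) (hi.const_mul _), integral_const_mul,
          integral_const_mul, h1]
        refine le_trans ?_ (Real.add_one_le_exp _)
        have h3 : α ^ 2 / 2 * ∫ y, g y ^ 2 ∂(D.prod (volume : Measure unitInterval))
            ≤ α ^ 2 / 2 * V := by gcongr
        -- `V` bounds the second moment about `0`, not the variance; `V - 2 * v * z + z²` becomes `V
        -- + (v - z)²` at the price of `v²`.
        have h4 : 0 ≤ α ^ 2 / 2 * v ^ 2 := by positivity
        simp only [integral_const, probReal_univ, smul_eq_mul, one_mul]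
        nlinarith

theorem abs_roundLoss_le_ae {D : Measure (Obs X K)} (hD : LossesBounded D) (σ μ : ℝ) (ρ π : X → Fin K) :
    ∀ᵐ y ∂(D.prod (volume : Measure unitInterval)), |roundLoss σ μ ρ π y| ≤ 1 := by
  filter_upwards [hD.ae_prod] with y hy
  have h1 := (hy (sampled σ μ y.1.2.2 (ρ y.1.1) y.2)).1
  have h2 := (hy (π y.1.1)).1
  rw [roundLoss, abs_le]
  constructor <;> linarith [h1.1, h1.2, h2.1, h2.2]

theorem integrable_roundLoss {D : Measure (Obs X K)} [IsProbabilityMeasure D]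
    (hD : LossesBounded D) (hρ : Measurable ρ) (hπ : Measurable π) :
    Integrable (roundLoss σ μ ρ π) (D.prod (volume : Measure unitInterval)) :=
  integrable_of_bounded (measurable_roundLoss hρ hπ) _ (abs_roundLoss_le_ae hD σ μ ρ π)

theorem integral_roundLoss_le {D : Measure (Obs X K)} [IsProbabilityMeasure D]
    (hD : LossesBounded D) (hσ : 0 < σ) (hμ : 0 < μ) (hμ1 : μ ≤ 1) (hρ : Measurable ρ)
    (hπ : Measurable π) :
    ∫ y, roundLoss σ μ ρ π y ∂(D.prod (volume : Measure unitInterval)) ≤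
      (value D σ ρ - value D σ π) + μ * (σ + 2 * √(sqError D)) + sqError D / σ := by
  have hi : Integrable (roundLoss σ μ ρ π) (D.prod (volume : Measure unitInterval)) :=
    integrable_roundLoss hD hρ hπ
  have hs := integrable_norm_sub_sq hD
  have hn := integrable_norm_sub hD
  have hv : Integrable (fun z => remappedLoss σ ρ z - remappedLoss σ π z) D :=
    (integrable_remappedLoss hD hρ).sub (integrable_remappedLoss hD hπ)
  have hu : Integrable (fun z : Obs X K => μ * (σ + 2 * ‖z.2.1 - z.2.2‖)) D :=
    ((integrable_const _).add (hn.const_mul _)).const_mul _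
  have hvu : Integrable (fun z : Obs X K => (remappedLoss σ ρ z - remappedLoss σ π z) +
      μ * (σ + 2 * ‖z.2.1 - z.2.2‖)) D := hv.add hu
  have h1 := integral_norm_sub_le hD
  rw [integral_prod _ hi]
  calc _ ≤ ∫ z, ((remappedLoss σ ρ z - remappedLoss σ π z) + μ * (σ + 2 * ‖z.2.1 - z.2.2‖) +
          ‖z.2.1 - z.2.2‖ ^ 2 / σ) ∂D := by
        refine integral_mono hi.integral_prod_left (hvu.add (hs.div_const _)) fun z => ?_
        refine (integral_loss_sampled_le hσ hμ hμ1 z.2.2 z.2.1 (ρ z.1) (π z.1)).trans ?_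
        simp only [remappedLoss]
        linarith
    _ = (value D σ ρ - value D σ π) + μ * (σ + 2 * ∫ z, ‖z.2.1 - z.2.2‖ ∂D) + sqError D / σ := by
        rw [integral_add hvu (hs.div_const _), integral_add hv hu, integral_sub
          (integrable_remappedLoss hD hρ) (integrable_remappedLoss hD hπ), integral_const_mul,
          integral_add (integrable_const _) (hn.const_mul _), integral_const_mul, integral_div]
        simp [sqError, value]
    _ ≤ _ := by gcongr

theorem integral_roundLoss_le' {D : Measure (Obs X K)} [IsProbabilityMeasure D]
    (hD : LossesBounded D) (hσ : 0 < σ) (hμ : 0 < μ) (hμ1 : μ ≤ 1) (hρ : Measurable ρ)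
    (hπ : Measurable π) :
    ∫ y, roundLoss σ μ ρ π y ∂(D.prod (volume : Measure unitInterval)) ≤
      2 * σ + sqError D / σ := by
  have hi : Integrable (roundLoss σ μ ρ π) (D.prod (volume : Measure unitInterval)) :=
    integrable_roundLoss hD hρ hπ
  have hs := integrable_norm_sub_sq hD
  rw [integral_prod _ hi]
  calc _ ≤ ∫ z, (2 * σ + ‖z.2.1 - z.2.2‖ ^ 2 / σ) ∂D :=
        integral_mono hi.integral_prod_left ((integrable_const _).add (hs.div_const _)) fun z =>
          integral_loss_sampled_le' hσ hμ hμ1 z.2.2 z.2.1 (ρ z.1) (π z.1)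
    _ = _ := by
        rw [integral_add (integrable_const _) (hs.div_const _), integral_div]
        simp [sqError]

end Expectation

/-! ### The random process -/

section Independence

variable {Y β : Type*} [MeasurableSpace Y] [MeasurableSpace β] {ν : Measure Y}
  [IsProbabilityMeasure ν] {A : (ℕ → Y) → β} {n : ℕ}

/-- A function of the first `n` coordinates is independent of the next coordinate. -/
theorem map_past_prod_eq (hA : Measurable A)
    (hdep : ∀ ω ω' : ℕ → Y, (∀ i < n, ω i = ω' i) → A ω = A ω') :
    (Measure.infinitePi fun _ : ℕ => ν).map (fun ω => (A ω, ω n)) =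
      ((Measure.infinitePi fun _ : ℕ => ν).map A).prod ν := by
  obtain ⟨y₀⟩ : Nonempty Y := nonempty_of_isProbabilityMeasure ν
  have hind : ProbabilityTheory.iIndepFun (fun i (ω : ℕ → Y) => ω i)
      (Measure.infinitePi fun _ : ℕ => ν) :=
    ProbabilityTheory.iIndepFun_infinitePi (X := fun _ y => y) fun _ => measurable_id
  have h1 := hind.indepFun_finset (Finset.range n) {n} (by simp) fun i => measurable_pi_apply i
  -- Filling the remaining coordinates with a constant factors `A` through the first `n`
  -- coordinates, to which independence of disjoint blocks applies.
  let ext : (Finset.range n → Y) → ℕ → Y :=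
    fun v i => if h : i ∈ Finset.range n then v ⟨i, h⟩ else y₀
  have hext : Measurable ext := by
    refine measurable_pi_lambda _ fun i => ?_
    by_cases h : i ∈ Finset.range n
    · simpa only [ext, h, dif_pos] using measurable_pi_apply _
    · simpa only [ext, h, dif_neg, not_false_iff] using measurable_const
  have hψ : Measurable fun v : ({n} : Finset ℕ) → Y => v ⟨n, Finset.mem_singleton_self n⟩ :=
    measurable_pi_apply _
  have h2 := h1.comp (hA.comp hext) hψ
  have h3 : (A ∘ ext) ∘ (fun (ω : ℕ → Y) (i : Finset.range n) => ω i) = A := by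
    funext ω
    refine hdep _ _ fun i hi => ?_
    simp [ext, hi]
  rw [h3] at h2
  rw [show ((fun v : ({n} : Finset ℕ) → Y => v ⟨n, Finset.mem_singleton_self n⟩) ∘
    fun (ω : ℕ → Y) (i : ({n} : Finset ℕ)) => ω i) = fun ω => ω n from rfl] at h2
  have h4 := h2.map_prod_eq_prod_map_map hA.aemeasurable (measurable_pi_apply n).aemeasurable
  rw [Measure.infinitePi_map_eval] at h4
  exact h4

theorem lintegral_past_fresh (hA : Measurable A)
    (hdep : ∀ ω ω' : ℕ → Y, (∀ i < n, ω i = ω' i) → A ω = A ω') {G : β × Y → ENNReal}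
    (hG : Measurable G) :
    ∫⁻ ω, G (A ω, ω n) ∂(Measure.infinitePi fun _ : ℕ => ν) =
      ∫⁻ ω, ∫⁻ y, G (A ω, y) ∂ν ∂(Measure.infinitePi fun _ : ℕ => ν) := by
  rw [← lintegral_map (f := G) hG (hA.prodMk (measurable_pi_apply n)), map_past_prod_eq hA hdep,
    lintegral_prod _ hG.aemeasurable, lintegral_map hG.lintegral_prod_right' hA]

theorem integral_past_fresh (hA : Measurable A)
    (hdep : ∀ ω ω' : ℕ → Y, (∀ i < n, ω i = ω' i) → A ω = A ω') {G : β × Y → ℝ}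
    (hG : Measurable G)
    (hi : Integrable (fun ω => G (A ω, ω n)) (Measure.infinitePi fun _ : ℕ => ν)) :
    ∫ ω, G (A ω, ω n) ∂(Measure.infinitePi fun _ : ℕ => ν) =
      ∫ ω, ∫ y, G (A ω, y) ∂ν ∂(Measure.infinitePi fun _ : ℕ => ν) := by
  have hm : Measurable fun ω : ℕ → Y => (A ω, ω n) := hA.prodMk (measurable_pi_apply n)
  have hi' := (integrable_map_measure hG.aestronglyMeasurable hm.aemeasurable).2 hi
  rw [← integral_map (f := G) hm.aemeasurable hG.aestronglyMeasurable]
  rw [map_past_prod_eq hA hdep] at hi' ⊢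
  rw [integral_prod _ hi', integral_map hA.aemeasurable]
  exact hG.stronglyMeasurable.integral_prod_right'.aestronglyMeasurable

end Independence

/-! ### The history as a random variable, and exponential moments along the game. -/

section RoundLaw

theorem ae_gameLaw {X : Type u} [MeasurableSpace X] {K : ℕ} {D : Measure (Obs X K)}
    [IsProbabilityMeasure D] (hD : LossesBounded D) : ∀ᵐ ω ∂(gameLaw D), ∀ n a,
    (ω n).1.2.1 a ∈ Set.Icc (0 : ℝ) 1 ∧ (ω n).1.2.2 a ∈ Set.Icc (0 : ℝ) 1 := by
  rw [ae_all_iff]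
  intro n
  exact (measurePreserving_eval_infinitePi
    (fun _ : ℕ => D.prod (volume : Measure unitInterval)) n).quasiMeasurePreserving.ae hD.ae_prod

variable {X : Type u} {K : ℕ} [NeZero K] {N : ℕ}

/-- The history after `n` rounds. -/
noncomputable def history (pol : Fin N → X → Fin K) (I : Dataset X K → Fin N) (P : Params) (n : ℕ)
    (ω : ℕ → Obs X K × unitInterval) : Dataset X K :=
  (play P ω n).eval fun S => pol (I S)

/-- The index of the policy chosen in round `n + 1`. -/
noncomputable def chosen (pol : Fin N → X → Fin K) (I : Dataset X K → Fin N) (P : Params) (n : ℕ)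
    (ω : ℕ → Obs X K × unitInterval) : Fin N :=
  I (costData (scale K P (n + 1))
    (searchValue (fun S => pol (I S)) P (n + 1) (history pol I P n ω)) (history pol I P n ω))

variable {pol : Fin N → X → Fin K} {I : Dataset X K → Fin N} {P : Params}

theorem eval_choosePolicy_history (n : ℕ) (ω : ℕ → Obs X K × unitInterval) :
    (choosePolicy P (n + 1) (history pol I P n ω)).eval (fun S => pol (I S)) =
      pol (chosen pol I P n ω) := eval_choosePolicy _ _ _ _

theorem history_succ (n : ℕ) (ω : ℕ → Obs X K × unitInterval) :
    history pol I P (n + 1) ω =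
      ((ω n).1.1, estimator P.σ P.μ (ω n).1.2.2 (ω n).1.2.1 (pol (chosen pol I P n ω) (ω n).1.1)
        (ω n).2) :: history pol I P n ω := by
  have h := eval_play_succ (fun S => pol (I S)) P ω n
  have h2 := eval_choosePolicy_history (pol := pol) (I := I) (P := P) n ω
  unfold history at h2 ⊢
  rw [h, h2]

theorem length_history (n : ℕ) (ω : ℕ → Obs X K × unitInterval) :
    (history pol I P n ω).length = n := length_eval_play _ _ _ _

/-- The history after `n` rounds is a function of the coordinates below `n`, hence independent of
coordinate `n`, the data of the next round. -/
theorem history_congr (n : ℕ) (ω ω' : ℕ → Obs X K × unitInterval)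
    (h : ∀ i < n, ω i = ω' i) : history pol I P n ω = history pol I P n ω' := by
  induction n with
  | zero => rfl
  | succ n ih =>
    rw [history_succ, history_succ, h n (Nat.lt_succ_self n)]
    unfold chosen
    rw [ih fun i hi => h i (hi.trans (Nat.lt_succ_self n))]

theorem chosen_congr (n : ℕ) (ω ω' : ℕ → Obs X K × unitInterval)
    (h : ∀ i < n, ω i = ω' i) : chosen pol I P n ω = chosen pol I P n ω' := by
  unfold chosen
  rw [history_congr n ω ω' h]

theorem influenceSum_history_succ (α : ℝ) (π : X → Fin K) (z : ℝ) (n : ℕ)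
    (ω : ℕ → Obs X K × unitInterval) :
    influenceSum α (history pol I P (n + 1) ω) π z =
      influence (α * (policyEstimate P.σ P.μ (pol (chosen pol I P n ω)) π (ω n) - z)) +
        influenceSum α (history pol I P n ω) π z := by
  rw [history_succ]
  simp [influenceSum, policyEstimate]

theorem excessLoss_eq (π : X → Fin K) (ω : ℕ → Obs X K × unitInterval) :
    excessLoss (fun S => pol (I S)) P π ω = ∑ n ∈ Finset.range P.T,
      roundLoss P.σ P.μ (pol (chosen pol I P n ω)) π (ω n) := by
  unfold excessLoss
  refine Finset.sum_congr rfl fun n _ => ?_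
  have h : action (fun S => pol (I S)) P ω n =
      sampled P.σ P.μ (ω n).1.2.2 (pol (chosen pol I P n ω) (ω n).1.1) (ω n).2 := by
    rw [action, eval_playRound]
    exact congrArg (fun p : X → Fin K => sampled P.σ P.μ (ω n).1.2.2 (p (ω n).1.1) (ω n).2)
      (eval_choosePolicy_history n ω)
  rw [h]
  rfl

variable [MeasurableSpace X]

theorem abs_history_le_ae {D : Measure (Obs X K)} [IsProbabilityMeasure D] (hD : LossesBounded D)
    (hσ : 0 ≤ P.σ) (hμ : 0 < P.μ) (hμ1 : P.μ ≤ 1) :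
    ∀ᵐ ω ∂(gameLaw D), ∀ n, ∀ e ∈ history pol I P n ω, ∀ a, |e.2 a| ≤ K / P.μ + 1 := by
  filter_upwards [ae_gameLaw hD] with ω hω n
  induction n with
  | zero => simp [history, play, Prog.eval]
  | succ n ih =>
    rw [history_succ]
    intro e he a
    rcases List.mem_cons.1 he with rfl | he
    · exact abs_estimator_le hσ hμ hμ1 (fun a => (hω n a).2) (fun a => (hω n a).1) _ _ _
    · exact ih e he a

variable (hpol : ∀ i, Measurable (pol i))
  (hI : ∀ n : ℕ, Measurable fun v : Fin n → X × (Fin K → ℝ) => I (List.ofFn v))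

include hpol hI

theorem measurable_chosen_of_history {n : ℕ} (h : MeasurableData (history pol I P n)) :
    Measurable (chosen pol I P n) :=
  (h.costData _ (MeasurableData.search hpol hI h P.T _ _ measurable_const measurable_const)).index hI

theorem measurableData_history (n : ℕ) : MeasurableData (history pol I P n) := by
  induction n with
  | zero => exact MeasurableData.nil
  | succ n ih =>
    have hc := measurable_chosen_of_history hpol hI ih
    have hω : Measurable fun ω : ℕ → Obs X K × unitInterval => ω n := measurable_pi_apply n
    have : history pol I P (n + 1) = fun ω => ((ω n).1.1, estimator P.σ P.μ (ω n).1.2.2 (ω n).1.2.1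
        (pol (chosen pol I P n ω) (ω n).1.1) (ω n).2) :: history pol I P n ω :=
      funext fun ω => history_succ n ω
    rw [this]
    refine ih.cons (hω.fst.fst.prodMk (measurable_estimator _ _ hω.fst.snd.snd hω.fst.snd.fst
      ?_ (measurable_subtype_coe.comp hω.snd)))
    exact measurable_eval_of_countable (f := fun i (ω : ℕ → Obs X K × unitInterval) => pol i (ω n).1.1)
      (fun i => (hpol i).comp hω.fst.fst) hc

theorem measurable_chosen (n : ℕ) : Measurable (chosen pol I P n) :=
  measurable_chosen_of_history hpol hI (measurableData_history hpol hI n)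

theorem measurable_influenceSum_history (α z : ℝ) (i : Fin N) (n : ℕ) :
    Measurable fun ω => influenceSum α (history pol I P n ω) (pol i) z :=
  (measurableData_history hpol hI n).influenceSum α measurable_const (hpol i)

variable {D : Measure (Obs X K)} [IsProbabilityMeasure D] (hD : LossesBounded D)

include hD

/-- The estimates are neither independent nor identically distributed, since each round follows a
policy learned from the past. Given the past, the last factor is still at most `exp R` whatever that
policy is, so one factor is peeled off per round. -/
theorem lintegral_exp_influenceSum_le (hσ : 0 ≤ P.σ) (hμ : 0 < P.μ) (hμ1 : P.μ ≤ 1) {s : ℝ}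
    (hs : s = 1 ∨ s = -1) (α z : ℝ) (i : Fin N) (n : ℕ) :
    ∫⁻ ω, ENNReal.ofReal (Real.exp (s * influenceSum α (history pol I P n ω) (pol i) z))
        ∂(gameLaw D) ≤
      ENNReal.ofReal (Real.exp (n * (s * (α * (value D P.σ (pol i) - z)) + α ^ 2 / 2 *
        (2 * (K * sqError D / P.μ + P.σ ^ 2) + (value D P.σ (pol i) - z) ^ 2)))) := by
  set R := s * (α * (value D P.σ (pol i) - z)) + α ^ 2 / 2 *
        (2 * (K * sqError D / P.μ + P.σ ^ 2) + (value D P.σ (pol i) - z) ^ 2) with hR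
  induction n with
  | zero =>
    have : IsProbabilityMeasure (gameLaw D) := by unfold gameLaw; infer_instance
    simp [history, play, Prog.eval, influenceSum]
  | succ n ih =>
    -- The past enters only through the sum so far and the index of the policy to be followed.
    let G : (ℝ × Fin N) × (Obs X K × unitInterval) → ENNReal := fun p =>
      ENNReal.ofReal (Real.exp (s * p.1.1)) * ENNReal.ofReal (Real.exp (s * influence
        (α * (policyEstimate P.σ P.μ (pol p.1.2) (pol i) p.2 - z))))
    have hG : Measurable G := by
      refine Measurable.mul (Real.measurable_exp.comp (measurable_fst.fst.const_mul s)).ennreal_ofReal ?_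
      refine (Real.measurable_exp.comp ((measurable_influence.comp ?_).const_mul s)).ennreal_ofReal
      refine Measurable.const_mul (Measurable.sub_const ?_ z) α
      exact measurable_eval_of_countable
        (f := fun j (p : (ℝ × Fin N) × (Obs X K × unitInterval)) =>
          policyEstimate P.σ P.μ (pol j) (pol i) p.2)
        (fun j => (measurable_policyEstimate (hpol j) (hpol i)).comp measurable_snd)
        measurable_fst.snd
    have hA : Measurable fun ω => (influenceSum α (history pol I P n ω) (pol i) z,
        chosen pol I P n ω) :=
      (measurable_influenceSum_history hpol hI α z i n).prodMk (measurable_chosen hpol hI n)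
    have h1 := lintegral_past_fresh (ν := D.prod (volume : Measure unitInterval)) (n := n) hA
      (fun ω ω' h => by rw [history_congr n ω ω' h, chosen_congr n ω ω' h]) hG
    have h2 : ∀ ω, ENNReal.ofReal (Real.exp (s *
        influenceSum α (history pol I P (n + 1) ω) (pol i) z)) =
        G ((influenceSum α (history pol I P n ω) (pol i) z, chosen pol I P n ω), ω n) := fun ω => by
      rw [influenceSum_history_succ, mul_add, Real.exp_add, mul_comm,
        ENNReal.ofReal_mul (Real.exp_pos _).le]
    simp only [h2]
    refine h1.le.trans ?_
    calc _ ≤ ∫⁻ ω, ENNReal.ofReal (Real.exp (s * influenceSum α (history pol I P n ω) (pol i) z)) *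
          ENNReal.ofReal (Real.exp R) ∂(gameLaw D) := by
          refine lintegral_mono fun ω => ?_
          simp only [G]
          rw [lintegral_const_mul' _ _ ENNReal.ofReal_ne_top]
          gcongr
          exact lintegral_exp_influence_le hD hσ hμ hμ1 (hpol _) (hpol i) hs α z
      _ ≤ ENNReal.ofReal (Real.exp (n * R)) * ENNReal.ofReal (Real.exp R) := by
          rw [lintegral_mul_const' _ _ ENNReal.ofReal_ne_top]
          gcongr
      _ = _ := by
          rw [← ENNReal.ofReal_mul (Real.exp_pos _).le, ← Real.exp_add]
          push_cast
          ring_nf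

/-- Markov's inequality for the exponential: both tails come from `s = 1` and `s = -1`. -/
theorem measure_influenceSum_ge_le (hσ : 0 ≤ P.σ) (hμ : 0 < P.μ) (hμ1 : P.μ ≤ 1) {s : ℝ}
    (hs : s = 1 ∨ s = -1) (α z : ℝ) (i : Fin N) (n : ℕ) (L : ℝ) :
    gameLaw D {ω | n * (s * (α * (value D P.σ (pol i) - z)) + α ^ 2 / 2 *
        (2 * (K * sqError D / P.μ + P.σ ^ 2) + (value D P.σ (pol i) - z) ^ 2)) + L ≤
          s * influenceSum α (history pol I P n ω) (pol i) z} ≤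
      ENNReal.ofReal (Real.exp (-L)) := by
  have h := lintegral_exp_influenceSum_le hpol hI hD hσ hμ hμ1 hs α z i n
  set R := s * (α * (value D P.σ (pol i) - z)) + α ^ 2 / 2 *
        (2 * (K * sqError D / P.μ + P.σ ^ 2) + (value D P.σ (pol i) - z) ^ 2) with hR
  have hm : Measurable fun ω =>
      ENNReal.ofReal (Real.exp (s * influenceSum α (history pol I P n ω) (pol i) z)) :=
    (Real.measurable_exp.comp
      ((measurable_influenceSum_history hpol hI α z i n).const_mul s)).ennreal_ofReal
  have hM := meas_ge_le_lintegral_div (μ := gameLaw D) hm.aemeasurable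
    (ε := ENNReal.ofReal (Real.exp (n * R + L))) (by simp [Real.exp_pos]) ENNReal.ofReal_ne_top
  refine (measure_mono fun ω hω => ?_).trans (hM.trans ((ENNReal.div_le_div_right h _).trans ?_))
  · exact ENNReal.ofReal_le_ofReal (Real.exp_le_exp.2 hω)
  · rw [← ENNReal.ofReal_div_of_pos (Real.exp_pos _), ← Real.exp_sub]
    refine ENNReal.ofReal_le_ofReal (Real.exp_le_exp.2 ?_)
    linarith

theorem integrable_roundLoss_chosen (σ μ : ℝ) {π : X → Fin K} (hπ : Measurable π) (n : ℕ) :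
    Integrable (fun ω => roundLoss σ μ (pol (chosen pol I P n ω)) π (ω n)) (gameLaw D) := by
  have : IsProbabilityMeasure (gameLaw D) := by unfold gameLaw; infer_instance
  refine integrable_of_bounded ?_ 1 ?_
  · exact measurable_eval_of_countable (f := fun i (ω : ℕ → Obs X K × unitInterval) =>
      roundLoss σ μ (pol i) π (ω n)) (fun i => (measurable_roundLoss (hpol i) hπ).comp
        (measurable_pi_apply n)) (measurable_chosen hpol hI n)
  · filter_upwards [ae_gameLaw hD] with ω hω
    have h1 := (hω n (sampled σ μ (ω n).1.2.2 (pol (chosen pol I P n ω) (ω n).1.1) (ω n).2)).1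
    have h2 := (hω n (π (ω n).1.1)).1
    rw [roundLoss, abs_le]
    constructor <;> linarith [h1.1, h1.2, h2.1, h2.2]

theorem integral_roundLoss_chosen {π : X → Fin K} (hπ : Measurable π) (n : ℕ) :
    ∫ ω, roundLoss P.σ P.μ (pol (chosen pol I P n ω)) π (ω n) ∂(gameLaw D) =
      ∫ ω, (∫ y, roundLoss P.σ P.μ (pol (chosen pol I P n ω)) π y
        ∂(D.prod (volume : Measure unitInterval))) ∂(gameLaw D) := by
  refine integral_past_fresh (ν := D.prod (volume : Measure unitInterval)) (n := n)
    (A := chosen pol I P n) (G := fun p => roundLoss P.σ P.μ (pol p.1) π p.2)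
    (measurable_chosen hpol hI n) (fun ω ω' h => chosen_congr n ω ω' h) ?_
    (integrable_roundLoss_chosen hpol hI hD _ _ hπ n)
  exact measurable_eval_of_countable
    (f := fun i (p : Fin N × (Obs X K × unitInterval)) => roundLoss P.σ P.μ (pol i) π p.2)
    (fun i => (measurable_roundLoss (hpol i) hπ).comp measurable_snd) measurable_fst

end RoundLaw

/-! ### Comparison of approximate Catoni means -/

/-- If two antitone functions `Q` and `Q'` are approximately linear with slope `-n * α` and roots
`v` and `v'`, then an approximate root at which `Q' ≤ Q` shows that `v'` is not much larger
than `v`. -/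
theorem root_comparison {Q Q' : ℝ → ℝ} (hQ : Antitone Q) (hQ' : Antitone Q') {n α b δ v v' : ℝ}
    (hn : 0 < n) (hα : 0 < α) (hb : 0 < b) (hb1 : 8 * b ≤ 1) (hbα : 2 * b ≤ α) (hδ : δ ≤ 1)
    (hδ0 : 0 ≤ δ) (hαδ : (α * δ) ^ 2 ≤ b) (hv : |v| ≤ 1) (hv' : |v'| ≤ 1)
    (hc : ∀ z ∈ Set.Icc (-3 : ℝ) 3, |Q z - n * (α * (v - z))| ≤ n * ((α * (v - z)) ^ 2 + b))
    (hc' : ∀ z ∈ Set.Icc (-3 : ℝ) 3, |Q' z - n * (α * (v' - z))| ≤ n * ((α * (v' - z)) ^ 2 + b))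
    {zl zr : ℝ} (hz : zr - zl < δ) (hl : 0 ≤ Q zl) (hr : Q' zr ≤ 0) (hle : Q' zr ≤ Q zr) :
    α * (v' - v) ≤ 8 * b := by
  rcases le_or_gt v' v with h | hvv
  · have := mul_nonneg hα.le (sub_nonneg.2 h)
    linarith
  rw [abs_le] at hv hv'
  -- At distance `ε` from the root the linear term is `2b` in absolute value, while the error `4b² +
  -- b` is smaller, so the sign is known there; monotonicity extends it beyond. The condition `2b ≤
  -- α` keeps `ε ≤ 1` and the test points inside `[-3, 3]`.
  set ε := 2 * b / α with hε
  have hε0 : 0 < ε := by positivity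
  have hε1 : ε ≤ 1 := by rw [hε, div_le_one hα]; exact hbα
  have hαε : α * ε = 2 * b := by rw [hε]; field_simp
  have h1 : zl ≤ v + ε := by
    by_contra hcon
    have h2 := hQ (not_le.1 hcon).le
    have h3 := (abs_le.1 (hc (v + ε) ⟨by linarith, by linarith⟩)).2
    have h4 : α * (v - (v + ε)) = -(2 * b) := by rw [← hαε]; ring
    rw [h4] at h3
    have h5 : n * ((-(2 * b)) ^ 2 + b) < n * (2 * b) := by
      refine mul_lt_mul_of_pos_left ?_ hn
      nlinarith
    linarith
  have h2 : v' - ε ≤ zr := by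
    by_contra hcon
    have h2 := hQ' (not_le.1 hcon).le
    have h3 := (abs_le.1 (hc' (v' - ε) ⟨by linarith, by linarith⟩)).1
    have h4 : α * (v' - (v' - ε)) = 2 * b := by rw [← hαε]; ring
    rw [h4] at h3
    have h5 : n * ((2 * b) ^ 2 + b) < n * (2 * b) := by
      refine mul_lt_mul_of_pos_left ?_ hn
      nlinarith
    linarith
  -- From `v' - ε ≤ zr < zl + δ ≤ v + ε + δ`, where all of `|v|`, `|v'|`, `ε`, `δ` are at most `1`.
  have hzr : zr ∈ Set.Icc (-3 : ℝ) 3 := ⟨by linarith, by linarith⟩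
  have h3 := (abs_le.1 (hc zr hzr)).2
  have h4 := (abs_le.1 (hc' zr hzr)).1
  set w := α * (v - zr) with hw
  set w' := α * (v' - zr) with hw'
  have hww' : w ≤ w' := mul_le_mul_of_nonneg_left (by linarith) hα.le
  have hu : w' ≤ 2 * b := by
    rw [← hαε, hw']
    exact mul_le_mul_of_nonneg_left (by linarith) hα.le
  have hlo : -(2 * b + α * δ) ≤ w := by
    have : -(2 * b + α * δ) = α * (-(ε + δ)) := by rw [← hαε]; ring
    rw [this, hw]
    exact mul_le_mul_of_nonneg_left (by linarith) hα.le
  have hαδ0 : 0 ≤ α * δ := by positivity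
  have h5 : w ^ 2 ≤ (2 * b + α * δ) ^ 2 := sq_le_sq' hlo (by linarith)
  have h6 : w' ^ 2 ≤ (2 * b + α * δ) ^ 2 := sq_le_sq' (by linarith) (by linarith)
  have h7 : (2 * b + α * δ) ^ 2 ≤ 8 * b ^ 2 + 2 * (α * δ) ^ 2 := by
    nlinarith [sq_nonneg (2 * b - α * δ)]
  -- The oracle inequality at the common point `zr` between the two linear approximations. The
  -- squares sum to at most `16b² + 4(αδ)² ≤ 2b + 4b`, which with `2b` makes `8b`.
  have h8 : n * (w' - w) ≤ n * (2 * b + w ^ 2 + w' ^ 2) := by nlinarith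
  have h9 := le_of_mul_le_mul_left h8 hn
  have h10 : α * (v' - v) = w' - w := by rw [hw, hw']; ring
  rw [h10]
  nlinarith

/-- Concentration at a nearby point of a grid carries over. -/
theorem concentration_of_nearby {Q : ℝ → ℝ} {n α v z z' S L Λ : ℝ} (hn : 0 < n) (hα : 0 ≤ α)
    (hlip : |Q z - Q z'| ≤ n * (α * |z - z'|)) (hS : n * (α ^ 2 / 2 * S) ≤ 2 * Λ)
    (hL : L ≤ 7 * Λ) (h1 : α * |z - z'| ≤ 4 * Λ / n) (h2 : (α * |z - z'|) ^ 2 ≤ 8 * Λ / n)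
    (hup : Q z' ≤ n * (α * (v - z') + α ^ 2 / 2 * (S + (v - z') ^ 2)) + L)
    (hlo : -Q z' ≤ n * (-(α * (v - z')) + α ^ 2 / 2 * (S + (v - z') ^ 2)) + L) :
    |Q z - n * (α * (v - z))| ≤ n * ((α * (v - z)) ^ 2 + 25 * Λ / n) := by
  -- The constant `25` is `4 + 4 + 2 + 8 + 7`: the Lipschitz error, the shift `n|e|` of the linear
  -- term, the variance term, `n e²` and the confidence level, all in units of `Λ`.
  set e := α * (z - z') with he
  have habs : |e| = α * |z - z'| := by rw [he, abs_mul, abs_of_nonneg hα]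
  rw [← habs] at h1 h2 hlip
  have hw : α * (v - z') = α * (v - z) + e := by rw [he]; ring
  have hq : α ^ 2 / 2 * (v - z') ^ 2 ≤ (α * (v - z)) ^ 2 + e ^ 2 := by
    have : α ^ 2 / 2 * (v - z') ^ 2 = (α * (v - z) + e) ^ 2 / 2 := by rw [← hw]; ring
    rw [this]
    nlinarith [sq_nonneg (α * (v - z) - e)]
  have hq' := mul_le_mul_of_nonneg_left hq hn.le
  rw [sq_abs] at h2
  have h1' : n * |e| ≤ 4 * Λ := by rw [le_div_iff₀ hn] at h1; linarith
  have h2' : n * e ^ 2 ≤ 8 * Λ := by rw [le_div_iff₀ hn] at h2; linarith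
  have h3 : n * ((α * (v - z)) ^ 2 + 25 * Λ / n) = n * (α * (v - z)) ^ 2 + 25 * Λ := by
    field_simp
  have h4 : |n * e| ≤ 4 * Λ := by rw [abs_mul, abs_of_pos hn]; exact h1'
  rw [abs_le] at hlip h4
  rw [hw] at hup hlo
  have h5 : n * |e| ≤ 4 * Λ := h1'
  rw [h3, abs_le]
  constructor <;> nlinarith [hlip.1, hlip.2, h4.1, h4.2]

/-- A point of the interval `[-3, 3]` is close to a grid point. -/
theorem exists_grid_near {T : ℕ} (hT : 0 < T) {z : ℝ} (hz : z ∈ Set.Icc (-3 : ℝ) 3) :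
    ∃ j : Fin (6 * T ^ 2 + 1), |z - (-3 + (j : ℕ) / (T : ℝ) ^ 2)| ≤ 1 / (T : ℝ) ^ 2 := by
  have hT' : (0 : ℝ) < (T : ℝ) ^ 2 := by positivity
  have h0 : 0 ≤ (z + 3) * (T : ℝ) ^ 2 := mul_nonneg (by linarith [hz.1]) hT'.le
  have h1 : ⌊(z + 3) * (T : ℝ) ^ 2⌋₊ ≤ 6 * T ^ 2 := by
    refine Nat.floor_le_of_le ?_
    push_cast
    exact mul_le_mul_of_nonneg_right (by linarith [hz.2]) hT'.le
  refine ⟨⟨⌊(z + 3) * (T : ℝ) ^ 2⌋₊, by omega⟩, ?_⟩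
  have h2 := Nat.floor_le h0
  have h3 := Nat.lt_floor_add_one ((z + 3) * (T : ℝ) ^ 2)
  simp only
  set f : ℝ := (⌊(z + 3) * (T : ℝ) ^ 2⌋₊ : ℝ)
  have h4 : z - (-3 + f / (T : ℝ) ^ 2) = ((z + 3) * (T : ℝ) ^ 2 - f) / (T : ℝ) ^ 2 := by
    field_simp
    ring
  rw [h4, abs_div, abs_of_pos hT', abs_of_nonneg (by linarith)]
  gcongr
  linarith

/-! ### The scale of the influence function -/

/-- The denominator in the scale of round `n + 1`. -/
noncomputable def spread (K : ℕ) (P : Params) (n : ℕ) : ℝ :=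
  P.σ * P.σ * (n + 1) + K * P.E / P.μ

section Scale

variable {K : ℕ} {P : Params} {n : ℕ}

theorem spread_pos (hσ : 0 < P.σ) (hμ : 0 < P.μ) (hE : 0 ≤ P.E) : 0 < spread K P n := by
  unfold spread
  have : 0 ≤ K * P.E / P.μ := by positivity
  positivity

/-- This identity is how `α` enters every estimate below; it balances the variance term against `Λ`.
-/
theorem scale_sq (hσ : 0 < P.σ) (hμ : 0 < P.μ) (hE : 0 ≤ P.E)
    (hΛ : 0 ≤ Real.log (P.T * P.N)) :
    scale K P (n + 1) ^ 2 * spread K P n = 2 * Real.log (P.T * P.N) := by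
  have h := spread_pos (K := K) (n := n) hσ hμ hE
  have h2 : scale K P (n + 1) = √(2 * Real.log (P.T * P.N) / spread K P n) := by
    simp [scale, spread]
  rw [h2, Real.sq_sqrt (by positivity)]
  field_simp

theorem scale_pos (hσ : 0 < P.σ) (hμ : 0 < P.μ) (hE : 0 ≤ P.E)
    (hΛ : 0 < Real.log (P.T * P.N)) : 0 < scale K P (n + 1) := by
  have h := scale_sq (K := K) (n := n) hσ hμ hE hΛ.le
  rcases (Real.sqrt_nonneg (2 * Real.log (P.T * P.N) /
    (P.σ * P.σ * ((n + 1 : ℕ) : ℝ) + K * P.E / P.μ))).lt_or_eq with h0 | h0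
  · exact h0
  · change 0 = scale K P (n + 1) at h0
    rw [← h0, zero_pow two_ne_zero, zero_mul] at h
    linarith

/-- The conversion of multiples of `Λ / (n * α)` and of the trivial bound. -/
theorem div_scale_le (hσ : 0 < P.σ) (hμ : 0 < P.μ) (hE : 0 ≤ P.E)
    (hΛ : 0 < Real.log (P.T * P.N)) (hn : 1 ≤ n) {g : ℝ}
    (hg : scale K P (n + 1) * g ≤ 200 * Real.log (P.T * P.N) / n) :
    g ≤ 400 * √(Real.log (P.T * P.N) * spread K P n) / (n + 1) := by
  have hs := scale_sq (K := K) (n := n) hσ hμ hE hΛ.le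
  have hα := scale_pos (K := K) (n := n) hσ hμ hE hΛ
  have hD := spread_pos (K := K) (n := n) hσ hμ hE
  set Λ := Real.log (P.T * P.N)
  set α := scale K P (n + 1)
  set Dn := spread K P n
  have hn' : (1 : ℝ) ≤ n := by exact_mod_cast hn
  -- Since `α² * Dn = 2Λ`, the right side is `√2 * Λ`. The passage from `200 / n` to `400 / (n + 1)`
  -- uses `n ≥ 1`.
  have h1 : Λ ≤ α * √(Λ * Dn) := by
    have h2 : α * √(Λ * Dn) = √(α ^ 2 * (Λ * Dn)) := by
      rw [Real.sqrt_mul (sq_nonneg α), Real.sqrt_sq hα.le]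
    rw [h2]
    refine Real.le_sqrt_of_sq_le ?_
    have : α ^ 2 * (Λ * Dn) = Λ * (α ^ 2 * Dn) := by ring
    rw [this, hs]
    nlinarith
  have h3 : α * g ≤ α * (400 * √(Λ * Dn) / (n + 1)) := by
    refine hg.trans ?_
    calc 200 * Λ / n ≤ 200 * (α * √(Λ * Dn)) / n := by gcongr
      _ ≤ α * (400 * √(Λ * Dn) / (n + 1)) := by
        rw [← mul_div_assoc, div_le_div_iff₀ (by linarith) (by linarith)]
        have : 0 ≤ α * √(Λ * Dn) := by positivity
        nlinarith
  exact le_of_mul_le_mul_left h3 hα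

/-- For early rounds, where `Λ / n` is not small. Both `σ²` and `q` are at most `spread / (n + 1)`,
by `E = T * q`, `n + 1 ≤ T` and `K / μ ≥ 1`; then `n + 1 ≤ 400 * Λ` trades a factor `√(n + 1)` for
`20 * √Λ`. -/
theorem trivial_gap_le (hσ : 0 < P.σ) (hμ : 0 < P.μ) (hμ1 : P.μ ≤ 1) (hK : 1 ≤ K) {q : ℝ}
    (hq : 0 ≤ q) (hE : P.E = P.T * q) (hn : n + 1 ≤ P.T)
    (hΛ : (n : ℝ) + 1 ≤ 400 * Real.log (P.T * P.N)) :
    P.σ + 2 * √q ≤ 400 * √(Real.log (P.T * P.N) * spread K P n) / (n + 1) := by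
  have hE0 : 0 ≤ P.E := by rw [hE]; positivity
  have hD := spread_pos (K := K) (n := n) hσ hμ hE0
  have hn0 : (0 : ℝ) < (n : ℝ) + 1 := by positivity
  have hK' : (1 : ℝ) ≤ K := by exact_mod_cast hK
  have hn' : (n : ℝ) + 1 ≤ P.T := by exact_mod_cast hn
  have h0 : 0 ≤ K * P.E / P.μ := by positivity
  have h1 : P.σ ≤ √(spread K P n / (n + 1)) := by
    refine Real.le_sqrt_of_sq_le ?_
    rw [le_div_iff₀ hn0, spread]
    nlinarith
  have h2 : √q ≤ √(spread K P n / (n + 1)) := by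
    refine Real.sqrt_le_sqrt ?_
    rw [le_div_iff₀ hn0, spread]
    have h3 : P.T * q ≤ K * P.E / P.μ := by
      rw [le_div_iff₀ hμ, hE]
      have : 0 ≤ (P.T : ℝ) * q := by positivity
      nlinarith
    have h4 : q * (n + 1) ≤ P.T * q := by nlinarith
    have : 0 ≤ P.σ * P.σ * ((n : ℝ) + 1) := by positivity
    linarith
  have h3 : √(spread K P n / (n + 1)) ≤ 20 * √(Real.log (P.T * P.N) * spread K P n) / (n + 1) := by
    rw [le_div_iff₀ hn0]
    have h4 : √(spread K P n / (n + 1)) * (n + 1) = √(spread K P n * (n + 1)) := by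
      rw [← Real.sqrt_sq hn0.le, ← Real.sqrt_mul (by positivity), Real.sqrt_sq hn0.le]
      congr 1
      field_simp
    have h5 : 20 * √(Real.log (P.T * P.N) * spread K P n)
        = √(400 * Real.log (P.T * P.N) * spread K P n) := by
      rw [mul_assoc, Real.sqrt_mul (by norm_num) (_ * _)]
      congr 1
      rw [show (400 : ℝ) = 20 ^ 2 by norm_num, Real.sqrt_sq (by norm_num)]
    rw [h4, h5]
    refine Real.sqrt_le_sqrt ?_
    nlinarith
  have h6 : 400 * √(Real.log (P.T * P.N) * spread K P n) / (n + 1)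
      = 20 * (20 * √(Real.log (P.T * P.N) * spread K P n) / (n + 1)) := by ring
  have h7 := Real.sqrt_nonneg (spread K P n / (n + 1))
  rw [h6]
  linarith

/-- The spread dominates the cumulative second moment `n * (K * q / μ + σ²)`, because `K * E / μ`
already accounts for all `T` rounds. -/
theorem scale_variance_le (hσ : 0 < P.σ) (hμ : 0 < P.μ) {q : ℝ} (hq : 0 ≤ q)
    (hE : P.E = P.T * q) (hn : n + 1 ≤ P.T) (hΛ : 0 ≤ Real.log (P.T * P.N)) :
    n * (scale K P (n + 1) ^ 2 / 2 * (2 * (K * q / P.μ + P.σ ^ 2))) ≤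
      2 * Real.log (P.T * P.N) := by
  have hE0 : 0 ≤ P.E := by rw [hE]; positivity
  rw [← scale_sq (K := K) (n := n) hσ hμ hE0 hΛ]
  have hn' : (n : ℝ) + 1 ≤ P.T := by exact_mod_cast hn
  have h1 : n * (scale K P (n + 1) ^ 2 / 2 * (2 * (K * q / P.μ + P.σ ^ 2)))
      = scale K P (n + 1) ^ 2 * (n * (K * q / P.μ + P.σ ^ 2)) := by ring
  rw [h1, spread, hE]
  refine mul_le_mul_of_nonneg_left ?_ (sq_nonneg _)
  have h2 : K * (P.T * q) / P.μ = P.T * (K * q / P.μ) := by ring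
  have h3 : 0 ≤ K * q / P.μ := by positivity
  rw [h2]
  nlinarith [sq_nonneg P.σ]

/-- From `1 / T ≤ 2σ` and `σ² * n ≤ spread`. This is where the lower bound on `σ` is needed:
otherwise `α` may be so large that the search tolerance matters. -/
theorem scale_tolerance_sq_le (hσ : 0 < P.σ) (hμ : 0 < P.μ) (hE : 0 ≤ P.E) (hT : 1 ≤ P.T)
    (hσT : 1 ≤ 2 * P.T * P.σ) (hΛ : 0 ≤ Real.log (P.T * P.N)) (hn : 1 ≤ n) :
    (scale K P (n + 1) * (1 / P.T)) ^ 2 ≤ 8 * Real.log (P.T * P.N) / n := by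
  have hT' : (1 : ℝ) ≤ P.T := by exact_mod_cast hT
  have hn' : (1 : ℝ) ≤ n := by exact_mod_cast hn
  have h := scale_sq (K := K) (n := n) hσ hμ hE hΛ
  have h0 : 0 ≤ K * P.E / P.μ := by positivity
  rw [le_div_iff₀ (by linarith), mul_pow, div_pow, one_pow]
  have h1 : 1 ≤ 4 * (P.T : ℝ) ^ 2 * P.σ ^ 2 := by
    have : 1 ≤ (2 * P.T * P.σ) ^ 2 := one_le_pow₀ hσT
    linarith [mul_pow (2 * (P.T : ℝ)) P.σ 2, mul_pow 2 (P.T : ℝ) 2]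
  have h2 : 1 / (P.T : ℝ) ^ 2 ≤ 4 * P.σ ^ 2 := by
    rw [div_le_iff₀ (by positivity)]
    linarith
  calc scale K P (n + 1) ^ 2 * (1 / (P.T : ℝ) ^ 2) * n
      ≤ scale K P (n + 1) ^ 2 * (4 * P.σ ^ 2) * n := by gcongr
    _ = 4 * (scale K P (n + 1) ^ 2 * (P.σ ^ 2 * n)) := by ring
    _ ≤ 4 * (scale K P (n + 1) ^ 2 * spread K P n) := by
        gcongr
        rw [spread]
        nlinarith [sq_nonneg P.σ]
    _ = _ := by rw [h]; ring

/-- Why the grid has mesh `1 / T²`: rounding to it changes an influence sum by at most `4Λ`. The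
linear bound follows from the square of the tolerance bound with `1 / T² ≤ 1 / n`, and `8Λ ≤ 16Λ²`
by `Λ ≥ 1/2`. -/
theorem scale_mesh_le (hσ : 0 < P.σ) (hμ : 0 < P.μ) (hE : 0 ≤ P.E) (hT : n + 1 ≤ P.T)
    (hσT : 1 ≤ 2 * P.T * P.σ) (hΛ : 1 / 2 ≤ Real.log (P.T * P.N)) (hn : 1 ≤ n) :
    scale K P (n + 1) * (1 / (P.T : ℝ) ^ 2) ≤ 4 * Real.log (P.T * P.N) / n ∧
      (scale K P (n + 1) * (1 / (P.T : ℝ) ^ 2)) ^ 2 ≤ 8 * Real.log (P.T * P.N) / n := by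
  have hT' : (n : ℝ) + 1 ≤ P.T := by exact_mod_cast hT
  have hn' : (1 : ℝ) ≤ n := by exact_mod_cast hn
  have h := scale_tolerance_sq_le (K := K) hσ hμ hE (by omega) hσT (by linarith) hn
  set Λ := Real.log (P.T * P.N)
  have hα := Real.sqrt_nonneg (2 * Real.log (P.T * P.N) /
    (P.σ * P.σ * ((n + 1 : ℕ) : ℝ) + K * P.E / P.μ))
  change 0 ≤ scale K P (n + 1) at hα
  set α := scale K P (n + 1)
  have h1 : 1 / (P.T : ℝ) ≤ 1 := by rw [div_le_one (by linarith)]; linarith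
  have h1' : 0 ≤ 1 / (P.T : ℝ) := by positivity
  have h2 : (α * (1 / (P.T : ℝ) ^ 2)) ^ 2 = (α * (1 / P.T)) ^ 2 * (1 / (P.T : ℝ)) ^ 2 := by ring
  have h3 : 0 ≤ 8 * Λ / n := by positivity
  constructor
  · refine abs_le_of_sq_le_sq' ?_ (by positivity) |>.2
    rw [h2]
    calc (α * (1 / P.T)) ^ 2 * (1 / (P.T : ℝ)) ^ 2 ≤ (8 * Λ / n) * (1 / n) := by
          gcongr
          calc (1 / (P.T : ℝ)) ^ 2 ≤ 1 / P.T := by rw [sq]; exact mul_le_of_le_one_left h1' h1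
            _ ≤ 1 / n := by gcongr; linarith
      _ = 8 * Λ / n ^ 2 := by field_simp
      _ ≤ (4 * Λ / n) ^ 2 := by
          rw [div_pow]
          gcongr
          nlinarith
  · rw [h2]
    calc (α * (1 / P.T)) ^ 2 * (1 / (P.T : ℝ)) ^ 2 ≤ (8 * Λ / n) * 1 ^ 2 := by gcongr
      _ = _ := by ring

end Scale

/-! ### The regret of a round -/

section RoundRegret

variable {X : Type u} [MeasurableSpace X] {K : ℕ} [NeZero K] {N : ℕ}

/-- The event that the influence of the estimates for policy `i` at the grid point with index `j`
deviates from its expectation in direction `s`. -/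
def deviation (pol : Fin N → X → Fin K) (I : Dataset X K → Fin N) (P : Params)
    (D : Measure (Obs X K)) (L : ℝ) (n : ℕ) (i : Fin N) (j : ℕ) (s : ℝ) :
    Set (ℕ → Obs X K × unitInterval) :=
  {ω | n * (s * (scale K P (n + 1) * (value D P.σ (pol i) - (-3 + j / (P.T : ℝ) ^ 2))) +
    scale K P (n + 1) ^ 2 / 2 * (2 * (K * sqError D / P.μ + P.σ ^ 2) +
      (value D P.σ (pol i) - (-3 + j / (P.T : ℝ) ^ 2)) ^ 2)) + L ≤
    s * influenceSum (scale K P (n + 1)) (history pol I P n ω) (pol i) (-3 + j / (P.T : ℝ) ^ 2)}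

/-- The event that some deviation occurs before round `n + 1`. -/
def badEvent (pol : Fin N → X → Fin K) (I : Dataset X K → Fin N) (P : Params)
    (D : Measure (Obs X K)) (L : ℝ) (n : ℕ) : Set (ℕ → Obs X K × unitInterval) :=
  ⋃ i : Fin N, ⋃ j : Fin (6 * P.T ^ 2 + 1),
    deviation pol I P D L n i j 1 ∪ deviation pol I P D L n i j (-1)

variable {pol : Fin N → X → Fin K} {I : Dataset X K → Fin N} {P : Params}

/-- Off the bad event concentration at grid points extends to `[-3, 3]` by the Lipschitz property,
and `root_comparison` applies to the sums of policy `i` and of the chosen policy at the ends left by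
the search. -/
theorem value_gap_le_of_notMem_badEvent {pols : Finset (X → Fin K)}
    (hO : IsERM pols fun S => pol (I S)) (hmem : ∀ i, pol i ∈ pols)
    {D : Measure (Obs X K)} [IsProbabilityMeasure D] (hD : LossesBounded D)
    (hσ : 0 < P.σ) (hμ : 0 < P.μ) (hE : P.E = P.T * sqError D)
    {n : ℕ} (hn : 1 ≤ n) (hnT : n + 1 ≤ P.T) (hσT : 1 ≤ 2 * P.T * P.σ)
    (hΛ : 1 / 2 ≤ Real.log (P.T * P.N)) {L : ℝ} (hL : L ≤ 7 * Real.log (P.T * P.N))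
    (hsmall : 400 * Real.log (P.T * P.N) < n + 1)
    {ω : ℕ → Obs X K × unitInterval} (hω : ω ∉ badEvent pol I P D L n)
    (hh : ∀ e ∈ history pol I P n ω, ∀ a, |e.2 a| ≤ K / P.μ + 1) (i : Fin N) :
    value D P.σ (pol (chosen pol I P n ω)) - value D P.σ (pol i) ≤
      400 * √(Real.log (P.T * P.N) * spread K P n) / (n + 1) := by
  have hq : 0 ≤ sqError D := integral_nonneg fun z => by positivity
  have hE0 : 0 ≤ P.E := by rw [hE]; positivity
  have hT0 : 0 < P.T := by omega
  have hT1 : (1 : ℝ) ≤ P.T := by exact_mod_cast hT0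
  have hn1 : (1 : ℝ) ≤ n := by exact_mod_cast hn
  have hn0 : (0 : ℝ) < n := by linarith
  refine div_scale_le hσ hμ hE0 (by linarith) hn ?_
  have hα := scale_pos (K := K) (n := n) hσ hμ hE0 (by linarith : 0 < Real.log (P.T * P.N))
  have htol := scale_tolerance_sq_le (K := K) (n := n) hσ hμ hE0 hT0 hσT (by linarith) hn
  obtain ⟨hmesh, hmesh2⟩ := scale_mesh_le (K := K) (n := n) hσ hμ hE0 hnT hσT hΛ hn
  have hvar := scale_variance_le (K := K) (n := n) hσ hμ hq hE hnT (by linarith)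
  obtain ⟨⟨zl, hz, hzl⟩, hzr⟩ := searchValue_spec hO P hT0 (n + 1) _ hh
  rw [eval_choosePolicy_history] at hzr
  have hzr' := hO.influenceSum_le (scale K P (n + 1)) (searchValue (fun S => pol (I S)) P (n + 1)
    (history pol I P n ω)) (history pol I P n ω) (hmem i)
  change influenceSum _ _ (pol (chosen pol I P n ω)) _ ≤ _ at hzr'
  set Λ := Real.log (P.T * P.N)
  set α := scale K P (n + 1)
  set b := 25 * Λ / n with hb
  have hb0 : 0 < b := by positivity
  -- `8 * b` is `200 * Λ / n`, and `400 * Λ < n + 1 ≤ 2 * n`.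
  have hb1 : 8 * b ≤ 1 := by
    rw [hb, ← mul_div_assoc, div_le_one hn0]
    linarith
  have hconc : ∀ k : Fin N, ∀ z ∈ Set.Icc (-3 : ℝ) 3,
      |influenceSum α (history pol I P n ω) (pol k) z - n * (α * (value D P.σ (pol k) - z))| ≤
        n * ((α * (value D P.σ (pol k) - z)) ^ 2 + b) := by
    intro k z hz
    obtain ⟨j, hj⟩ := exists_grid_near hT0 hz
    simp only [badEvent, Set.mem_iUnion, Set.mem_union, not_exists, not_or, deviation,
      Set.mem_ofPred_eq, not_le] at hω
    have h1 := (hω k j).1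
    have h2 := (hω k j).2
    rw [one_mul, one_mul] at h1
    rw [neg_one_mul, neg_one_mul] at h2
    have hlip := abs_influenceSum_sub_le hα.le (history pol I P n ω) (pol k) z
      (-3 + (j : ℕ) / (P.T : ℝ) ^ 2)
    rw [length_history] at hlip
    have hαj : α * |z - (-3 + (j : ℕ) / (P.T : ℝ) ^ 2)| ≤ α * (1 / (P.T : ℝ) ^ 2) := by gcongr
    exact concentration_of_nearby (Q := influenceSum α (history pol I P n ω) (pol k)) hn0 hα.le hlip
      hvar hL (hαj.trans hmesh)
      ((pow_le_pow_left₀ (by positivity) hαj 2).trans hmesh2) h1.le h2.le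
  have hanti : ∀ k : Fin N, Antitone (influenceSum α (history pol I P n ω) (pol k)) :=
    fun k z z' h => influenceSum_anti hα.le _ _ h
  have h8 : 8 * b = 200 * Λ / n := by rw [hb]; ring
  rw [← h8]
  have hv := abs_value_le hD P.σ (pol i)
  have hv' := abs_value_le hD P.σ (pol (chosen pol I P n ω))
  -- If `α < 2 * b`, the trivial gap `2` already suffices: `α * 2 < 4 * b`.
  rcases le_or_gt (2 * b) α with hbα | hbα
  · refine root_comparison (hanti i) (hanti _) hn0 hα hb0 hb1 hbα (δ := 1 / P.T) ?_ (by positivity)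
      ?_ hv hv' (hconc i) (hconc _) hz (hzl _ (hmem i)) hzr hzr'
    · rw [div_le_one (by linarith)]
      exact hT1
    · refine htol.trans ?_
      rw [hb]
      gcongr
      norm_num
  · have h2 : value D P.σ (pol (chosen pol I P n ω)) - value D P.σ (pol i) ≤ 2 := by
      linarith [(abs_le.1 hv).1, (abs_le.1 hv').2]
    have h3 := mul_le_mul_of_nonneg_left h2 hα.le
    linarith

/-- The confidence level of the deviation bounds. -/
noncomputable def confidence (P : Params) : ℝ := Real.log (14 * P.N * (P.T : ℝ) ^ 3)

theorem confidence_le (hN : 2 ≤ P.N) (hT : 1 ≤ P.T) :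
    1 / 2 ≤ Real.log (P.T * P.N) ∧ confidence P ≤ 7 * Real.log (P.T * P.N) := by
  have hN' : (2 : ℝ) ≤ P.N := by exact_mod_cast hN
  have hT' : (1 : ℝ) ≤ P.T := by exact_mod_cast hT
  have h2 : 1 / 2 ≤ Real.log 2 := by have := Real.log_two_gt_d9; linarith
  have h3 : (2 : ℝ) ≤ P.T * P.N := by nlinarith
  have h4 : Real.log 2 ≤ Real.log (P.T * P.N) := Real.log_le_log (by norm_num) h3
  refine ⟨h2.trans h4, ?_⟩
  have h5 : (7 : ℝ) * Real.log (P.T * P.N) = Real.log ((P.T * P.N) ^ 7) := by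
    rw [Real.log_pow]; norm_num
  rw [h5, confidence]
  refine Real.log_le_log (by positivity) ?_
  have h6 : (16 : ℝ) ≤ ((P.T : ℝ) * P.N) ^ 4 := by
    calc (16 : ℝ) = 2 ^ 4 := by norm_num
      _ ≤ _ := pow_le_pow_left₀ (by norm_num) h3 4
  have h7 : (P.N : ℝ) ≤ (P.N : ℝ) ^ 3 := le_self_pow₀ (by linarith) (by norm_num)
  calc 14 * (P.N : ℝ) * (P.T : ℝ) ^ 3 ≤ 16 * (P.N : ℝ) ^ 3 * (P.T : ℝ) ^ 3 := by
        gcongr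
        norm_num
    _ = 16 * ((P.T : ℝ) * P.N) ^ 3 := by ring
    _ ≤ ((P.T : ℝ) * P.N) ^ 4 * ((P.T : ℝ) * P.N) ^ 3 := by gcongr
    _ = ((P.T : ℝ) * P.N) ^ 7 := by ring

variable (hpol : ∀ i, Measurable (pol i))
  (hI : ∀ n : ℕ, Measurable fun v : Fin n → X × (Fin K → ℝ) => I (List.ofFn v))
  {D : Measure (Obs X K)}

include hpol hI

theorem measurableSet_badEvent (L : ℝ) (n : ℕ) : MeasurableSet (badEvent pol I P D L n) := by
  refine MeasurableSet.iUnion fun i => MeasurableSet.iUnion fun j => MeasurableSet.union ?_ ?_ <;>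
  exact measurableSet_le measurable_const
    ((measurable_influenceSum_history hpol hI _ _ i n).const_mul _)

variable [IsProbabilityMeasure D] (hD : LossesBounded D)

include hD

theorem integrable_value_gap (σ : ℝ) (n : ℕ) (i : Fin N) :
    Integrable (fun ω => value D σ (pol (chosen pol I P n ω)) - value D σ (pol i))
      (gameLaw D) := by
  have hprob : IsProbabilityMeasure (gameLaw D) := by unfold gameLaw; infer_instance
  refine integrable_of_bounded (((measurable_of_countable fun k => value D σ (pol k)).comp
    (measurable_chosen hpol hI n)).sub_const _) 2 (Filter.Eventually.of_forall fun ω => ?_)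
  have h1 := abs_le.1 (abs_value_le hD σ (pol (chosen pol I P n ω)))
  have h2 := abs_le.1 (abs_value_le hD σ (pol i))
  rw [abs_le]
  constructor <;> linarith [h1.1, h1.2, h2.1, h2.2]

/-- The confidence level makes each deviation have probability at most `1 / (14 N T³)`; there are
`N` policies, at most `7 T²` grid points and two signs. -/
theorem measure_badEvent_le (hPN : P.N = N) (hT : 1 ≤ P.T) (hN : 1 ≤ N) (hσ : 0 ≤ P.σ)
    (hμ : 0 < P.μ) (hμ1 : P.μ ≤ 1) (n : ℕ) :
    (gameLaw D).real (badEvent pol I P D (confidence P) n) ≤ 1 / P.T := by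
  have hT' : (1 : ℝ) ≤ P.T := by exact_mod_cast hT
  have hN' : (1 : ℝ) ≤ P.N := by rw [hPN]; exact_mod_cast hN
  have hprob : IsProbabilityMeasure (gameLaw D) := by unfold gameLaw; infer_instance
  have hexp : Real.exp (-confidence P) = 1 / (14 * P.N * (P.T : ℝ) ^ 3) := by
    rw [confidence, Real.exp_neg, Real.exp_log (by positivity), one_div]
  have h1 : ∀ (i : Fin N) (j : ℕ) (s : ℝ), (s = 1 ∨ s = -1) →
      (gameLaw D).real (deviation pol I P D (confidence P) n i j s) ≤
        1 / (14 * P.N * (P.T : ℝ) ^ 3) := fun i j s hs => by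
    rw [← hexp]
    exact ENNReal.toReal_le_of_le_ofReal (Real.exp_pos _).le
      (measure_influenceSum_ge_le hpol hI hD hσ hμ hμ1 hs _ _ i n _)
  calc (gameLaw D).real (badEvent pol I P D (confidence P) n)
      ≤ ∑ i : Fin N, ∑ j : Fin (6 * P.T ^ 2 + 1), 2 * (1 / (14 * P.N * (P.T : ℝ) ^ 3)) := by
        refine (measureReal_iUnion_fintype_le _).trans (Finset.sum_le_sum fun i _ => ?_)
        refine (measureReal_iUnion_fintype_le _).trans (Finset.sum_le_sum fun j _ => ?_)
        refine (measureReal_union_le _ _).trans ?_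
        rw [two_mul]
        exact add_le_add (h1 _ _ _ (Or.inl rfl)) (h1 _ _ _ (Or.inr rfl))
    _ = P.N * (6 * (P.T : ℝ) ^ 2 + 1) * (2 * (1 / (14 * P.N * (P.T : ℝ) ^ 3))) := by
        simp [hPN, mul_assoc]
    _ ≤ P.N * (7 * (P.T : ℝ) ^ 2) * (2 * (1 / (14 * P.N * (P.T : ℝ) ^ 3))) := by
        gcongr
        nlinarith
    _ = 1 / P.T := by field_simp; norm_num

/-- The expected loss of the chosen policy compared with that of a fixed policy. -/
theorem integral_value_gap_le {pols : Finset (X → Fin K)} (hO : IsERM pols fun S => pol (I S))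
    (hmem : ∀ i, pol i ∈ pols) (hPN : P.N = N) (hN : 2 ≤ N) (hσ : 0 < P.σ) (hμ : 0 < P.μ)
    (hμ1 : P.μ ≤ 1) (hE : P.E = P.T * sqError D) (hσT : 1 ≤ 2 * P.T * P.σ) {n : ℕ}
    (hnT : n + 1 ≤ P.T) (i : Fin N) :
    ∫ ω, (value D P.σ (pol (chosen pol I P n ω)) - value D P.σ (pol i)) ∂(gameLaw D) ≤
      400 * √(Real.log (P.T * P.N) * spread K P n) / (n + 1) +
        1 / P.T * (P.σ + 2 * √(sqError D)) := by
  have hq : 0 ≤ sqError D := integral_nonneg fun z => by positivity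
  have hT0 : 1 ≤ P.T := by omega
  have hprob : IsProbabilityMeasure (gameLaw D) := by unfold gameLaw; infer_instance
  have hK : 1 ≤ K := Nat.one_le_iff_ne_zero.2 (NeZero.ne K)
  obtain ⟨hΛ, hL⟩ := confidence_le (by omega : 2 ≤ P.N) hT0
  set r := 400 * √(Real.log (P.T * P.N) * spread K P n) / (n + 1) with hr
  set c := P.σ + 2 * √(sqError D) with hc
  have hr0 : 0 ≤ r := by positivity
  have hc0 : 0 ≤ c := by positivity
  set B := badEvent pol I P D (confidence P) n with hB
  have hBm : MeasurableSet B := measurableSet_badEvent hpol hI _ n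
  have hBi : Integrable (B.indicator fun _ => c) (gameLaw D) := (integrable_const c).indicator hBm
  have hle : ∀ᵐ ω ∂(gameLaw D), value D P.σ (pol (chosen pol I P n ω)) - value D P.σ (pol i) ≤
      r + B.indicator (fun _ => c) ω := by
    filter_upwards [abs_history_le_ae (pol := pol) (I := I) (P := P) hD hσ.le hμ hμ1] with ω hω
    have htriv := value_sub_value_le hD hσ.le (hpol (chosen pol I P n ω)) (hpol i)
    by_cases hωB : ω ∈ B
    · rw [Set.indicator_of_mem hωB]
      linarith
    · rw [Set.indicator_of_notMem hωB, add_zero]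
      -- Early rounds use the trivial gap; later ones have `Λ / n` small enough for the comparison
      -- of roots.
      rcases le_or_gt ((n : ℝ) + 1) (400 * Real.log (P.T * P.N)) with hs | hs
      · exact htriv.trans (trivial_gap_le hσ hμ hμ1 hK hq hE hnT hs)
      -- The first round is always early, since `400 * Λ ≥ 200`.
      · have hn : 1 ≤ n := by
          rcases Nat.eq_zero_or_pos n with h0 | h0
          · rw [h0] at hs
            norm_num at hs
            linarith
          · exact h0
        exact value_gap_le_of_notMem_badEvent hO hmem hD hσ hμ hE hn hnT hσT hΛ hL hs hωB
          (hω n) i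
  calc _ ≤ ∫ ω, (r + B.indicator (fun _ => c) ω) ∂(gameLaw D) :=
        integral_mono_ae (integrable_value_gap hpol hI hD _ n i) ((integrable_const r).add hBi) hle
    _ = r + (gameLaw D).real B * c := by
        rw [integral_add (integrable_const r) hBi, integral_indicator_const c hBm]
        simp
    _ ≤ _ := by
        gcongr
        exact measure_badEvent_le hpol hI hD hPN hT0 (by omega) hσ.le hμ hμ1 n

theorem integral_excessLoss_eq {π : X → Fin K} (hπ : Measurable π) :
    Integrable (excessLoss (fun S => pol (I S)) P π) (gameLaw D) ∧
      ∫ ω, excessLoss (fun S => pol (I S)) P π ω ∂(gameLaw D) = ∑ n ∈ Finset.range P.T,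
        ∫ ω, (∫ y, roundLoss P.σ P.μ (pol (chosen pol I P n ω)) π y
          ∂(D.prod (volume : Measure unitInterval))) ∂(gameLaw D) := by
  have h1 : excessLoss (fun S => pol (I S)) P π = fun ω => ∑ n ∈ Finset.range P.T,
      roundLoss P.σ P.μ (pol (chosen pol I P n ω)) π (ω n) := funext fun ω => excessLoss_eq π ω
  rw [h1]
  refine ⟨integrable_finsetSum _ fun n _ => integrable_roundLoss_chosen hpol hI hD _ _ hπ n, ?_⟩
  rw [integral_finsetSum _ fun n _ => integrable_roundLoss_chosen hpol hI hD _ _ hπ n]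
  exact Finset.sum_congr rfl fun n _ => integral_roundLoss_chosen hpol hI hD hπ n

theorem integrable_integral_roundLoss (σ μ : ℝ) {π : X → Fin K} (n : ℕ) :
    Integrable (fun ω => ∫ y, roundLoss σ μ (pol (chosen pol I P n ω)) π y
      ∂(D.prod (volume : Measure unitInterval))) (gameLaw D) := by
  have hprob : IsProbabilityMeasure (gameLaw D) := by unfold gameLaw; infer_instance
  refine integrable_of_bounded ((measurable_of_countable fun k =>
    ∫ y, roundLoss σ μ (pol k) π y ∂(D.prod (volume : Measure unitInterval))).comp
      (measurable_chosen hpol hI n)) 1 (Filter.Eventually.of_forall fun ω => ?_)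
  have := norm_integral_le_of_norm_le_const (f := roundLoss σ μ (pol (chosen pol I P n ω)) π)
    (C := 1) (abs_roundLoss_le_ae hD σ μ (pol (chosen pol I P n ω)) π)
  simpa using this

/-- The regret is small if the threshold is small. -/
theorem integral_excessLoss_le_of_small (hσ : 0 < P.σ) (hμ : 0 < P.μ) (hμ1 : P.μ ≤ 1)
    {π : X → Fin K} (hπ : Measurable π) :
    ∫ ω, excessLoss (fun S => pol (I S)) P π ω ∂(gameLaw D) ≤
      2 * P.T * P.σ + P.T * sqError D / P.σ := by
  have hprob : IsProbabilityMeasure (gameLaw D) := by unfold gameLaw; infer_instance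
  rw [(integral_excessLoss_eq hpol hI hD hπ).2]
  calc _ ≤ ∑ n ∈ Finset.range P.T, (2 * P.σ + sqError D / P.σ) := by
        refine Finset.sum_le_sum fun n _ => ?_
        refine (integral_mono (integrable_integral_roundLoss hpol hI hD _ _ n)
          (integrable_const (2 * P.σ + sqError D / P.σ)) fun ω =>
          integral_roundLoss_le' hD hσ hμ hμ1 (hpol _) hπ).trans (le_of_eq (by simp))
    _ = _ := by
        rw [Finset.sum_const, Finset.card_range, nsmul_eq_mul]
        ring

/-- The regret in terms of the remapped losses of the chosen policies. -/
theorem integral_excessLoss_le (hσ : 0 < P.σ) (hμ : 0 < P.μ) (hμ1 : P.μ ≤ 1) (i : Fin N) :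
    ∫ ω, excessLoss (fun S => pol (I S)) P (pol i) ω ∂(gameLaw D) ≤
      ∑ n ∈ Finset.range P.T,
        (∫ ω, (value D P.σ (pol (chosen pol I P n ω)) - value D P.σ (pol i)) ∂(gameLaw D)) +
      P.T * (P.μ * (P.σ + 2 * √(sqError D)) + sqError D / P.σ) := by
  have hprob : IsProbabilityMeasure (gameLaw D) := by unfold gameLaw; infer_instance
  rw [(integral_excessLoss_eq hpol hI hD (hpol i)).2]
  have h1 := fun n => integrable_value_gap (P := P) hpol hI hD P.σ n i
  calc _ ≤ ∑ n ∈ Finset.range P.T,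
        ((∫ ω, (value D P.σ (pol (chosen pol I P n ω)) - value D P.σ (pol i)) ∂(gameLaw D)) +
          (P.μ * (P.σ + 2 * √(sqError D)) + sqError D / P.σ)) := by
        refine Finset.sum_le_sum fun n _ => ?_
        refine (integral_mono (integrable_integral_roundLoss hpol hI hD _ _ n)
          ((h1 n).add (integrable_const (P.μ * (P.σ + 2 * √(sqError D)) + sqError D / P.σ)))
          fun ω => ?_).trans (le_of_eq ?_)
        · have := integral_roundLoss_le hD hσ hμ hμ1 (hpol (chosen pol I P n ω)) (hpol i)
          simp only [Pi.add_apply]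
          linarith
        · rw [integral_add' (h1 n) (integrable_const _)]
          simp
    _ = _ := by
        rw [Finset.sum_add_distrib, Finset.sum_const, Finset.card_range, nsmul_eq_mul]

end RoundRegret

/-! ### The total regret -/

/-- The sum of the five terms of the regret bound. -/
noncomputable def regretTerms (d E σ μ : ℝ) (T : ℕ) : ℝ :=
  √(d * E / μ) + σ * √(d * T) + μ * T * σ + μ * √(E * T) + E / σ

theorem sum_inv_sqrt_le (T : ℕ) : ∑ n ∈ Finset.range T, 1 / √((n : ℝ) + 1) ≤ 2 * √T := by
  induction T with
  | zero => simp
  | succ T ih =>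
    rw [Finset.sum_range_succ]
    push_cast
    have h0 : 0 < √((T : ℝ) + 1) := Real.sqrt_pos.2 (by positivity)
    have h1 : √((T : ℝ) + 1) ^ 2 = T + 1 := Real.sq_sqrt (by positivity)
    have h2 : √(T : ℝ) ^ 2 = T := Real.sq_sqrt (by positivity)
    have h3 : 1 / √((T : ℝ) + 1) ≤ 2 * (√((T : ℝ) + 1) - √T) := by
      rw [div_le_iff₀ h0]
      nlinarith [sq_nonneg (√((T : ℝ) + 1) - √T)]
    linarith

theorem sum_inv_le (T : ℕ) : ∑ n ∈ Finset.range T, 1 / ((n : ℝ) + 1) ≤ 1 + Real.log T := by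
  have h := harmonic_le_one_add_log T
  simpa [harmonic] using h

theorem sqrt_add_le_sqrt_add_sqrt {a b : ℝ} (ha : 0 ≤ a) (hb : 0 ≤ b) : √(a + b) ≤ √a + √b := by
  refine Real.sqrt_le_iff.2 ⟨by positivity, ?_⟩
  nlinarith [Real.sq_sqrt ha, Real.sq_sqrt hb, mul_nonneg (Real.sqrt_nonneg a) (Real.sqrt_nonneg b)]

/-- The square root of the spread splits into `σ * √(n + 1)` and `√(K * E / μ)`. After division by
`n + 1` the first part sums to `2 * σ * √T`, the second harmonically. -/
theorem sum_round_bound_le {K : ℕ} {P : Params} (hσ : 0 < P.σ) (hμ : 0 < P.μ) (hE : 0 ≤ P.E)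
    (hΛ : 0 ≤ Real.log (P.T * P.N)) :
    ∑ n ∈ Finset.range P.T, 400 * √(Real.log (P.T * P.N) * spread K P n) / ((n : ℝ) + 1) ≤
      400 * √(Real.log (P.T * P.N)) *
        (2 * P.σ * √P.T + √(K * P.E / P.μ) * (1 + Real.log P.T)) := by
  have h0 : 0 ≤ K * P.E / P.μ := by positivity
  have h1 : ∀ n : ℕ, 400 * √(Real.log (P.T * P.N) * spread K P n) / ((n : ℝ) + 1) ≤
      400 * √(Real.log (P.T * P.N)) * (P.σ * (1 / √((n : ℝ) + 1)) +
        √(K * P.E / P.μ) * (1 / ((n : ℝ) + 1))) := fun n => by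
    have hn : (0 : ℝ) < n + 1 := by positivity
    have h2 : √(spread K P n) ≤ P.σ * √((n : ℝ) + 1) + √(K * P.E / P.μ) := by
      unfold spread
      refine (sqrt_add_le_sqrt_add_sqrt (by positivity) h0).trans (le_of_eq ?_)
      rw [Real.sqrt_mul (by positivity), Real.sqrt_mul_self hσ.le]
    have h3 : √((n : ℝ) + 1) / (n + 1) = 1 / √((n : ℝ) + 1) := by
      rw [div_eq_div_iff hn.ne' (Real.sqrt_pos.2 hn).ne', one_mul, Real.mul_self_sqrt hn.le]
    rw [Real.sqrt_mul hΛ]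
    calc 400 * (√(Real.log (P.T * P.N)) * √(spread K P n)) / ((n : ℝ) + 1)
        ≤ 400 * (√(Real.log (P.T * P.N)) * (P.σ * √((n : ℝ) + 1) + √(K * P.E / P.μ))) /
          ((n : ℝ) + 1) := by gcongr
      _ = 400 * √(Real.log (P.T * P.N)) * (P.σ * (√((n : ℝ) + 1) / (n + 1)) +
          √(K * P.E / P.μ) * (1 / ((n : ℝ) + 1))) := by ring
      _ = _ := by rw [h3]
  refine (Finset.sum_le_sum fun n _ => h1 n).trans ?_
  rw [← Finset.mul_sum, Finset.sum_add_distrib, ← Finset.mul_sum, ← Finset.mul_sum]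
  have h4 := mul_le_mul_of_nonneg_left (sum_inv_sqrt_le P.T) hσ.le
  have h5 := mul_le_mul_of_nonneg_left (sum_inv_le P.T) (Real.sqrt_nonneg (K * P.E / P.μ))
  refine mul_le_mul_of_nonneg_left ?_ (by positivity)
  linarith

/-- Replaces `ln (TN)` by `ln N`, as required by `d = K * ln N`; `ln N ≥ 1/2` lets `ln T` be
absorbed as a factor. -/
theorem sqrt_log_mul_le {T N : ℕ} (hT : 1 ≤ T) (hN : 2 ≤ N) :
    √(Real.log (T * N)) ≤ 2 * (1 + Real.log T) * √(Real.log N) := by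
  have hT' : (1 : ℝ) ≤ T := by exact_mod_cast hT
  have hN' : (2 : ℝ) ≤ N := by exact_mod_cast hN
  have h2 : 1 / 2 ≤ Real.log N := by
    have h1 := Real.log_two_gt_d9
    have h3 : Real.log 2 ≤ Real.log N := Real.log_le_log (by norm_num) hN'
    linarith
  have hl : 0 ≤ Real.log T := Real.log_nonneg hT'
  have h3 : 2 * (1 + Real.log T) * √(Real.log N)
      = √((2 * (1 + Real.log T)) ^ 2 * Real.log N) := by
    rw [Real.sqrt_mul (sq_nonneg _), Real.sqrt_sq (by positivity)]
  rw [h3, Real.log_mul (by positivity) (by positivity)]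
  refine Real.sqrt_le_sqrt ?_
  nlinarith [mul_nonneg hl hl, mul_nonneg (mul_nonneg hl hl) (by linarith : 0 ≤ Real.log N),
    mul_nonneg hl (by linarith : 0 ≤ Real.log N - 1 / 2)]

theorem exploration_bound_le {K T N : ℕ} (hT : 1 ≤ T) (hN : 2 ≤ N) {σ μ E q : ℝ} (hσ : 0 < σ)
    (hμ : 0 < μ) (hμ1 : μ ≤ 1) (hK : (1 : ℝ) ≤ K) (hE : 0 ≤ E) (hqE : q ≤ E) :
    400 * √(Real.log (T * N)) * (2 * σ * √T + √(K * E / μ) * (1 + Real.log T)) + (σ + 2 * √q) ≤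
      1604 * ((1 + Real.log T) ^ 2 * (√(K * Real.log N * E / μ) + σ * √(K * Real.log N * T))) := by
  have hT' : (1 : ℝ) ≤ T := by exact_mod_cast hT
  have hN' : (2 : ℝ) ≤ N := by exact_mod_cast hN
  have hl : 0 ≤ Real.log T := Real.log_nonneg hT'
  have hlog2 : 1 / 2 ≤ Real.log N := by
    have h1 := Real.log_two_gt_d9
    have h3 : Real.log 2 ≤ Real.log N := Real.log_le_log (by norm_num) hN'
    linarith
  have hlogN : 0 ≤ Real.log N := by linarith
  have h6 : 1 / 2 ≤ K * Real.log N := by nlinarith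
  have hs := sqrt_log_mul_le hT hN
  set t1 := √(K * Real.log N * E / μ) with ht1
  set t2 := σ * √(K * Real.log N * T) with ht2
  have h1 : 0 ≤ t1 := Real.sqrt_nonneg _
  have h2 : 0 ≤ t2 := by positivity
  set ll := 1 + Real.log T with hll
  have hll1 : 1 ≤ ll := by linarith
  have hll2 : 1 ≤ ll ^ 2 := one_le_pow₀ hll1
  have ha : √(Real.log N) * (σ * √T) ≤ t2 := by
    rw [ht2, mul_left_comm, ← Real.sqrt_mul hlogN]
    refine mul_le_mul_of_nonneg_left (Real.sqrt_le_sqrt ?_) hσ.le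
    exact mul_le_mul_of_nonneg_right (le_mul_of_one_le_left hlogN hK) (by linarith)
  have hb : √(Real.log N) * √(K * E / μ) = t1 := by
    rw [ht1, ← Real.sqrt_mul hlogN]
    congr 1
    ring
  have hc : 400 * √(Real.log (T * N)) * (2 * σ * √T + √(K * E / μ) * ll) ≤
      1600 * ll ^ 2 * (t1 + t2) := by
    calc _ ≤ 400 * (2 * ll * √(Real.log N)) * (2 * σ * √T + √(K * E / μ) * ll) := by
          gcongr
      _ = 1600 * ll * (√(Real.log N) * (σ * √T)) +
          800 * ll ^ 2 * (√(Real.log N) * √(K * E / μ)) := by ring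
      _ ≤ 1600 * ll ^ 2 * t2 + 1600 * ll ^ 2 * t1 := by
          rw [hb]
          have : ll ≤ ll ^ 2 := le_self_pow₀ hll1 (by norm_num)
          gcongr
          norm_num
      _ = _ := by ring
  -- The contribution of the bad events, `σ + 2√q`, fits into the main terms because `d ≥ 1/2`. It
  -- accounts for the `4` in `1604`.
  have hd : σ ≤ 2 * t2 := by
    have : 1 / 2 ≤ √(K * Real.log N * T) := by
      refine Real.le_sqrt_of_sq_le ?_
      nlinarith
    rw [ht2]
    nlinarith
  have he : √q ≤ 2 * t1 := by
    have : 2 * t1 = √(4 * (K * Real.log N * E / μ)) := by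
      rw [Real.sqrt_mul (by norm_num), show (4 : ℝ) = 2 ^ 2 by norm_num,
        Real.sqrt_sq (by norm_num)]
    rw [this]
    refine Real.sqrt_le_sqrt ?_
    have h8 : K * Real.log N * E ≤ K * Real.log N * E / μ :=
      le_div_self (by positivity) hμ hμ1
    nlinarith
  have hg : t1 + t2 ≤ ll ^ 2 * (t1 + t2) := le_mul_of_one_le_left (by linarith) hll2
  have hj : 1600 * ll ^ 2 * (t1 + t2) = 1600 * (ll ^ 2 * (t1 + t2)) := by ring
  rw [hj] at hc
  linarith

section TotalRegret

variable {X : Type u} [MeasurableSpace X] {K : ℕ} [NeZero K] {N : ℕ}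
  {pol : Fin N → X → Fin K} {I : Dataset X K → Fin N} {P : Params}
  {D : Measure (Obs X K)} [IsProbabilityMeasure D]

/-- The main regime, where `σ` is not below half the search tolerance. Bad events cost `σ + 2√q` in
total, since each of the `T` rounds fails with probability at most `1 / T`. -/
theorem integral_excessLoss_le_regretTerms (hpol : ∀ i, Measurable (pol i))
    (hI : ∀ n : ℕ, Measurable fun v : Fin n → X × (Fin K → ℝ) => I (List.ofFn v))
    (hD : LossesBounded D) {pols : Finset (X → Fin K)} (hO : IsERM pols fun S => pol (I S))
    (hmem : ∀ i, pol i ∈ pols) (hPN : P.N = N) (hT : 1 ≤ P.T) (hσ : 0 < P.σ) (hμ : 0 < P.μ)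
    (hμ1 : P.μ ≤ 1) (hE : P.E = P.T * sqError D) (hσT : 1 ≤ 2 * P.T * P.σ) (i : Fin N) :
    ∫ ω, excessLoss (fun S => pol (I S)) P (pol i) ω ∂(gameLaw D) ≤
      2000 * (1 + Real.log P.T) ^ 2 *
        regretTerms (K * Real.log P.N) P.E P.σ P.μ P.T := by
  have hq : 0 ≤ sqError D := integral_nonneg fun z => by positivity
  have hE0 : 0 ≤ P.E := by rw [hE]; positivity
  have hT' : (1 : ℝ) ≤ P.T := by exact_mod_cast hT
  have hK : (1 : ℝ) ≤ K := by exact_mod_cast Nat.one_le_iff_ne_zero.2 (NeZero.ne K)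
  have hl : 0 ≤ Real.log P.T := Real.log_nonneg hT'
  have hreg := integral_excessLoss_le (P := P) hpol hI hD hσ hμ hμ1 i
  have hET : √(P.E * P.T) = P.T * √(sqError D) := by
    rw [hE, show (P.T : ℝ) * sqError D * P.T = P.T ^ 2 * sqError D by ring,
      Real.sqrt_mul (by positivity), Real.sqrt_sq (by linarith)]
  have hlast : P.T * (P.μ * (P.σ + 2 * √(sqError D)) + sqError D / P.σ) =
      P.μ * P.T * P.σ + 2 * (P.μ * √(P.E * P.T)) + P.E / P.σ := by
    rw [hET, hE]
    ring
  rw [hlast] at hreg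
  unfold regretTerms
  have hN1 : 1 ≤ N := i.pos
  have hlogN : 0 ≤ Real.log P.N := Real.log_nonneg (by rw [hPN]; exact_mod_cast hN1)
  set t1 := √(K * Real.log P.N * P.E / P.μ) with ht1
  set t2 := P.σ * √(K * Real.log P.N * P.T) with ht2
  have h1 : 0 ≤ t1 := Real.sqrt_nonneg _
  have h2 : 0 ≤ t2 := by positivity
  have h3 : 0 ≤ P.μ * P.T * P.σ := by positivity
  have h4 : 0 ≤ P.μ * √(P.E * P.T) := by positivity
  have h5 : 0 ≤ P.E / P.σ := by positivity
  set ll := 1 + Real.log P.T with hll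
  have hll1 : 1 ≤ ll := by linarith
  have hll2 : 1 ≤ ll ^ 2 := one_le_pow₀ hll1
  -- A single policy is treated apart: `ln N = 0`, so nothing could absorb the learning error, but
  -- there is also nothing to learn and the value gap vanishes.
  rcases Nat.lt_or_ge N 2 with hN | hN
  · have hsub : Subsingleton (Fin N) := Fin.subsingleton_iff_le_one.2 (by omega)
    have hz : ∀ n, (∫ ω, (value D P.σ (pol (chosen pol I P n ω)) - value D P.σ (pol i))
        ∂(gameLaw D)) = 0 := fun n => by
      have : ∀ ω, chosen pol I P n ω = i := fun ω => Subsingleton.elim _ _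
      simp [this]
    simp only [hz, Finset.sum_const_zero, zero_add] at hreg
    refine hreg.trans ?_
    nlinarith
  · have hPN2 : 2 ≤ P.N := by omega
    have hPN' : (2 : ℝ) ≤ P.N := by exact_mod_cast hPN2
    have hlog2 : 1 / 2 ≤ Real.log P.N := by
      have h1 := Real.log_two_gt_d9
      have h3 : Real.log 2 ≤ Real.log P.N := Real.log_le_log (by norm_num) hPN'
      linarith
    have hΛ : 0 ≤ Real.log (P.T * P.N) := Real.log_nonneg (by nlinarith)
    have hgap : ∑ n ∈ Finset.range P.T, (∫ ω, (value D P.σ (pol (chosen pol I P n ω)) -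
        value D P.σ (pol i)) ∂(gameLaw D)) ≤
        400 * √(Real.log (P.T * P.N)) *
          (2 * P.σ * √P.T + √(K * P.E / P.μ) * ll) + (P.σ + 2 * √(sqError D)) := by
      calc _ ≤ ∑ n ∈ Finset.range P.T,
            (400 * √(Real.log (P.T * P.N) * spread K P n) / ((n : ℝ) + 1) +
              1 / P.T * (P.σ + 2 * √(sqError D))) :=
            Finset.sum_le_sum fun n hn => integral_value_gap_le hpol hI hD hO hmem hPN hN hσ hμ hμ1
              hE hσT (Finset.mem_range.1 hn) i
        _ ≤ _ := by
            rw [Finset.sum_add_distrib, Finset.sum_const, Finset.card_range, nsmul_eq_mul]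
            refine add_le_add (sum_round_bound_le hσ hμ hE0 hΛ) (le_of_eq ?_)
            field_simp
    have hexp := exploration_bound_le (K := K) (q := sqError D) hT hPN2 hσ hμ hμ1 hK hE0
      ((le_mul_of_one_le_left hq hT').trans_eq hE.symm)
    rw [← hll, ← ht1, ← ht2] at hexp
    have hg : 0 ≤ ll ^ 2 * (t1 + t2) := by positivity
    have hh : P.μ * P.T * P.σ + 2 * (P.μ * √(P.E * P.T)) + P.E / P.σ ≤
        2 * (ll ^ 2 * (P.μ * P.T * P.σ + P.μ * √(P.E * P.T) + P.E / P.σ)) := by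
      have := le_mul_of_one_le_left
        (by linarith : 0 ≤ P.μ * P.T * P.σ + P.μ * √(P.E * P.T) + P.E / P.σ) hll2
      linarith
    have hi : 0 ≤ ll ^ 2 * (P.μ * P.T * P.σ + P.μ * √(P.E * P.T) + P.E / P.σ) := by positivity
    have hj : 2000 * ll ^ 2 * (t1 + t2 + P.μ * P.T * P.σ + P.μ * √(P.E * P.T) + P.E / P.σ) =
        2000 * (ll ^ 2 * (t1 + t2)) +
          2000 * (ll ^ 2 * (P.μ * P.T * P.σ + P.μ * √(P.E * P.T) + P.E / P.σ)) := by ring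
    rw [hj]
    linarith

end TotalRegret

/-- The regret bounds for arbitrary parameters. -/
theorem regret_bounds {X : Type u} [MeasurableSpace X] {K : ℕ} [NeZero K]
    {D : Measure (Obs X K)} [IsProbabilityMeasure D] {pols : Finset (X → Fin K)}
    (hne : pols.Nonempty) {O : Dataset X K → (X → Fin K)} {P : Params}
    (hpol : ∀ π ∈ pols, Measurable π) (hD : LossesBounded D) (hO : IsERM pols O)
    (hOm : ∀ n : ℕ, ∀ π ∈ pols,
      MeasurableSet {v : Fin n → X × (Fin K → ℝ) | O (List.ofFn v) = π})
    (hPN : P.N = pols.card) (hT : 1 ≤ P.T) (hσ : 0 < P.σ) (hμ : 0 < P.μ) (hμ1 : P.μ ≤ 1)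
    (hE : P.E = P.T * sqError D) :
    (∀ π ∈ pols, Integrable (excessLoss O P π) (gameLaw D)) ∧
      regret D pols hne O P ≤ 2000 * (1 + Real.log P.T) ^ 2 *
        regretTerms (K * Real.log P.N) P.E P.σ P.μ P.T + 1 ∧
      (1 / P.T ≤ P.σ → regret D pols hne O P ≤ 2000 * (1 + Real.log P.T) ^ 2 *
        regretTerms (K * Real.log P.N) P.E P.σ P.μ P.T) := by
  have hT' : (1 : ℝ) ≤ P.T := by exact_mod_cast hT
  have hq : 0 ≤ sqError D := integral_nonneg fun z => by positivity
  have hE0 : 0 ≤ P.E := by rw [hE]; positivity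
  -- Policies are enumerated so that the oracle becomes a map into a finite type, where the
  -- measurability hypothesis on its fibres makes the chosen index a random variable.
  let pol : Fin pols.card → X → Fin K := fun i => (pols.equivFin.symm i).1
  let I : Dataset X K → Fin pols.card := fun S => pols.equivFin ⟨O S, (hO S).1⟩
  have hOI : O = fun S => pol (I S) := by
    funext S
    simp [pol, I]
  have hmem : ∀ i, pol i ∈ pols := fun i => (pols.equivFin.symm i).2
  have hpol' : ∀ i, Measurable (pol i) := fun i => hpol _ (hmem i)
  have hsurj : ∀ π ∈ pols, ∃ i, pol i = π := fun π hπ => ⟨pols.equivFin ⟨π, hπ⟩, by simp [pol]⟩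
  have hI : ∀ n : ℕ, Measurable fun v : Fin n → X × (Fin K → ℝ) => I (List.ofFn v) := fun n => by
    refine measurable_to_countable' fun i => ?_
    convert hOm n (pol i) (hmem i) using 1
    ext v
    simp only [Set.mem_preimage, Set.mem_singleton_iff, Set.mem_ofPred_eq, I, pol]
    rw [← Equiv.eq_symm_apply, Subtype.ext_iff]
  clear_value pol I
  subst hOI
  have hcore : 1 ≤ 2 * P.T * P.σ → regret D pols hne (fun S => pol (I S)) P ≤
      2000 * (1 + Real.log P.T) ^ 2 * regretTerms (K * Real.log P.N) P.E P.σ P.μ P.T := by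
    intro hσT
    refine Finset.sup'_le _ _ fun π hπ => ?_
    obtain ⟨i, rfl⟩ := hsurj π hπ
    exact integral_excessLoss_le_regretTerms hpol' hI hD hO hmem hPN hT hσ hμ hμ1 hE hσT i
  refine ⟨fun π hπ => (integral_excessLoss_eq hpol' hI hD (hpol π hπ)).1, ?_, fun h => hcore ?_⟩
  -- Below the threshold `σ = 1 / (2T)` the crude bound `2Tσ + E/σ` applies, and `2Tσ ≤ 1` is the
  -- additive constant.
  · rcases le_total 1 (2 * P.T * P.σ) with h | h
    · linarith [hcore h]
    · have h1 : regret D pols hne (fun S => pol (I S)) P ≤ 1 + P.E / P.σ := by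
        refine Finset.sup'_le _ _ fun π hπ => ?_
        refine (integral_excessLoss_le_of_small hpol' hI hD hσ hμ hμ1 (hpol π hπ)).trans ?_
        rw [hE]
        linarith
      have hlogN : 0 ≤ Real.log P.N := Real.log_natCast_nonneg _
      have h2 : P.E / P.σ ≤ regretTerms (K * Real.log P.N) P.E P.σ P.μ P.T := by
        unfold regretTerms
        have : 0 ≤ √(K * Real.log P.N * P.E / P.μ) + P.σ * √(K * Real.log P.N * P.T) +
          P.μ * P.T * P.σ + P.μ * √(P.E * P.T) := by positivity
        linarith
      have h3 : 0 ≤ P.E / P.σ := by positivity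
      have h4 : 1 ≤ 2000 * (1 + Real.log P.T) ^ 2 := by
        have : 1 ≤ (1 + Real.log P.T) ^ 2 := one_le_pow₀ (by linarith [Real.log_nonneg hT'])
        linarith
      have h5 := le_mul_of_one_le_left (h3.trans h2) h4
      linarith
  · rw [div_le_iff₀ (by linarith)] at h
    linarith

/-- The regret terms for the tuned parameters. -/
theorem regretTerms_tuned_le {d E : ℝ} {T : ℕ} (hd : 0 < d) (hE : 0 < E) (hT : 1 ≤ T) :
    regretTerms d E (√E * (d * T) ^ (-(1 / 4) : ℝ)) (min (√(d / T)) 1) T ≤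
      4 * (√E * (d * T) ^ (1 / 4 : ℝ) + √(d * E)) := by
  have hT' : (1 : ℝ) ≤ T := by exact_mod_cast hT
  have hdT : 0 < d * T := by positivity
  -- With `x² = √(dT)` and `σ = √E / x`, the second and last terms both equal `√E * x`, the third is
  -- at most that, and the fourth is at most `√(dE)`.
  set x : ℝ := (d * T) ^ (1 / 4 : ℝ) with hx
  have hx0 : 0 < x := Real.rpow_pos_of_pos hdT _
  have hxi : (d * T) ^ (-(1 / 4) : ℝ) = x⁻¹ := Real.rpow_neg hdT.le _
  have hx2 : x ^ 2 = √(d * T) := by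
    rw [Real.sqrt_eq_rpow, hx, ← Real.rpow_natCast, ← Real.rpow_mul hdT.le]
    norm_num
  set μ := min (√(d / T)) 1 with hμ
  have hs : 0 < √(d / T) := Real.sqrt_pos.2 (by positivity)
  have hμ0 : 0 < μ := lt_min hs one_pos
  have hμs : μ ≤ √(d / T) := min_le_left _ _
  have hsT : √(d / T) * T = x ^ 2 := by
    rw [hx2, Real.sqrt_div hd.le, Real.sqrt_mul hd.le]
    have h := Real.mul_self_sqrt (by linarith : (0 : ℝ) ≤ T)
    have h' : √(T : ℝ) ≠ 0 := (Real.sqrt_pos.2 (by linarith)).ne'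
    field_simp
    rw [sq, h]
  -- The quotient is `√(dT) = x²` or `d`, according to which argument attains the minimum.
  have hdμ : d / μ ≤ x ^ 2 + d := by
    rcases min_cases (√(d / T)) 1 with h | h
    · rw [hμ, h.1, div_le_iff₀ hs]
      have h1 : x ^ 2 * √(d / T) = d := by
        rw [← hsT, mul_right_comm, Real.mul_self_sqrt (by positivity)]
        field_simp
      rw [add_mul, h1]
      have : 0 ≤ d * √(d / T) := by positivity
      linarith
    · rw [hμ, h.1, div_one]
      have : 0 ≤ x ^ 2 := by positivity
      linarith
  have hE' : 0 < √E := Real.sqrt_pos.2 hE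
  have hEE : √E * √E = E := Real.mul_self_sqrt hE.le
  unfold regretTerms
  rw [hxi, ← hx2]
  have h1 : √(d * E / μ) ≤ √E * x + √(d * E) := by
    have h2 : d * E / μ ≤ (√E * x) ^ 2 + d * E := by
      have : d * E / μ = d / μ * E := by ring
      rw [this, mul_pow, Real.sq_sqrt hE.le]
      nlinarith
    refine (Real.sqrt_le_sqrt h2).trans ((sqrt_add_le_sqrt_add_sqrt (by positivity)
      (by positivity)).trans ?_)
    rw [Real.sqrt_sq (by positivity)]
  have h2 : √E * x⁻¹ * x ^ 2 = √E * x := by field_simp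
  have h3 : μ * T * (√E * x⁻¹) ≤ √E * x := by
    calc μ * T * (√E * x⁻¹) ≤ √(d / T) * T * (√E * x⁻¹) := by gcongr
      _ = √E * x := by rw [hsT, ← h2]; ring
  have h4 : μ * √(E * T) ≤ √(d * E) := by
    calc μ * √(E * T) ≤ √(d / T) * √(E * T) := by gcongr
      _ = √(d * E) := by
        rw [← Real.sqrt_mul (by positivity)]
        congr 1
        field_simp
  have h5 : E / (√E * x⁻¹) = √E * x := by
    rw [div_eq_iff (by positivity)]
    field_simp
    linarith
  rw [h2, h5]
  have h6 : 0 ≤ √(d * E) := Real.sqrt_nonneg _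
  linarith

/-- The cost bounds for the tuned exploration probability are polynomial. -/
theorem tuned_cost_le {K T : ℕ} {d : ℝ} (hK : 1 ≤ K) (hT : 1 ≤ T) (hKd : (K : ℝ) ≤ 2 * d) :
    (T : ℝ) * (1 + Real.log (T * K / min (√(d / T)) 1)) ≤ 4 * (T + d) ^ 6 ∧
      (T : ℝ) ^ 2 * K * (1 + Real.log (T * K / min (√(d / T)) 1)) ≤ 8 * (T + d) ^ 6 := by
  have hT' : (1 : ℝ) ≤ T := by exact_mod_cast hT
  have hK' : (1 : ℝ) ≤ K := by exact_mod_cast hK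
  have hd : 1 / 2 ≤ d := by linarith
  set s := T + d with hs
  have hs1 : 1 ≤ s := by linarith
  set μ := min (√(d / T)) 1 with hμ
  -- A polynomial lower bound on `μ`: `d ≥ 1/2` and `T ≤ s` give `d / T ≥ 1 / (2s)²`.
  have hμ0 : 1 ≤ μ * (2 * s) := by
    rcases min_cases (√(d / T)) 1 with h | h
    · rw [hμ, h.1]
      have h1 : 1 / (2 * s) ≤ √(d / T) := by
        refine Real.le_sqrt_of_sq_le ?_
        rw [div_pow, one_pow, div_le_div_iff₀ (by positivity) (by positivity)]
        nlinarith
      rwa [div_le_iff₀ (by positivity)] at h1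
    · rw [hμ, h.1]
      linarith
  have hμpos : 0 < μ := lt_min (Real.sqrt_pos.2 (by positivity)) one_pos
  have hR : 0 < T * K / μ := by positivity
  -- Only polynomial growth is claimed, so the logarithm may be bounded by its argument.
  have hlog : 1 + Real.log (T * K / μ) ≤ T * K / μ := by
    linarith [Real.log_le_sub_one_of_pos hR]
  have hR2 : T * K / μ ≤ s * (2 * s) * (2 * s) := by
    rw [div_le_iff₀ hμpos]
    calc (T : ℝ) * K ≤ s * (2 * s) :=
          mul_le_mul (by linarith) (by linarith) (by linarith) (by linarith)
      _ ≤ s * (2 * s) * (μ * (2 * s)) := le_mul_of_one_le_right (by positivity) hμ0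
      _ = _ := by ring
  have hl := hlog.trans hR2
  constructor
  · calc (T : ℝ) * (1 + Real.log (T * K / μ)) ≤ T * (s * (2 * s) * (2 * s)) := by gcongr
      _ ≤ s * (s * (2 * s) * (2 * s)) := by gcongr; linarith
      _ = 4 * s ^ 4 := by ring
      _ ≤ 4 * s ^ 6 := by gcongr; linarith
  · calc (T : ℝ) ^ 2 * K * (1 + Real.log (T * K / μ))
        ≤ T ^ 2 * K * (s * (2 * s) * (2 * s)) := by gcongr
      _ ≤ s ^ 2 * (2 * s) * (s * (2 * s) * (2 * s)) := by gcongr <;> linarith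
      _ = 8 * s ^ 6 := by ring

end ArcBandit
-- Assembly: arbitrary and tuned parameters.
theorem theorem7 :
    ∃ (C : ℝ) (k : ℕ), 0 < C ∧
      ∀ (X : Type*) [MeasurableSpace X] (K : ℕ) [NeZero K]
        (D : Measure (ArcBandit.Obs X K)) [IsProbabilityMeasure D]
        (pols : Finset (X → Fin K)) (hne : pols.Nonempty)
        (O : ArcBandit.Dataset X K → (X → Fin K)) (T : ℕ),
        (∀ π ∈ pols, Measurable π) →
        (∀ᵐ z ∂D, ∀ a, z.2.1 a ∈ Set.Icc (0 : ℝ) 1 ∧ z.2.2 a ∈ Set.Icc (0 : ℝ) 1) →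
        ArcBandit.IsERM pols O →
        (∀ (n : ℕ), ∀ π ∈ pols,
          MeasurableSet {v : Fin n → X × (Fin K → ℝ) | O (List.ofFn v) = π}) →
        1 ≤ T →
        let N : ℕ := pols.card
        let d : ℝ := K * Real.log N
        let E : ℝ := ArcBandit.totalError D T
        -- arbitrary parameters
        (∀ σ μ : ℝ, 0 < σ → 0 < μ → μ ≤ 1 →
          let P : ArcBandit.Params := ⟨T, N, σ, μ, E⟩
          let bound : ℝ := C * (1 + Real.log T) ^ k *
            (√(d * E / μ) + σ * √(d * T) + μ * T * σ + μ * √(E * T) + E / σ)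
          (∀ π ∈ pols, Integrable (ArcBandit.excessLoss O P π) (ArcBandit.gameLaw D)) ∧
          ArcBandit.regret D pols hne O P ≤ bound + 1 ∧
          (1 / T ≤ σ → ArcBandit.regret D pols hne O P ≤ bound) ∧
          ∀ ω : ℕ → ArcBandit.Obs X K × unitInterval,
            ((ArcBandit.play P ω T).calls O : ℝ) ≤ C * T * (1 + Real.log (T * K / μ)) ∧
            ((ArcBandit.play P ω T).steps O : ℝ) ≤
              C * T ^ 2 * K * (1 + Real.log (T * K / μ))) ∧
        -- tuned parameters
        (2 ≤ N → 0 < E →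
          let μ : ℝ := min (√(d / T)) 1
          let σ : ℝ := √E * (d * T) ^ (-(1 / 4) : ℝ)
          let P : ArcBandit.Params := ⟨T, N, σ, μ, E⟩
          let bound : ℝ := C * (1 + Real.log T) ^ k * (√E * (d * T) ^ (1 / 4 : ℝ) + √(d * E))
          (∀ π ∈ pols, Integrable (ArcBandit.excessLoss O P π) (ArcBandit.gameLaw D)) ∧
          ArcBandit.regret D pols hne O P ≤ bound + 1 ∧
          (1 / T ≤ σ → ArcBandit.regret D pols hne O P ≤ bound) ∧
          ∀ ω : ℕ → ArcBandit.Obs X K × unitInterval,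
            ((ArcBandit.play P ω T).calls O : ℝ) ≤ C * (T + d) ^ k ∧
            ((ArcBandit.play P ω T).steps O : ℝ) ≤ C * (T + d) ^ k) := by
  -- The regret needs only the square of `1 + ln T` and the factor `2000 * 4`; the exponent `6` is
  -- dictated by the polynomial cost bounds, whose factor is at most `160 * 8`.
  refine ⟨10000, 6, by norm_num, ?_⟩
  intro X _ K _ D _ pols hne O T hpol hD hO hOm hT N d E
  have hT' : (1 : ℝ) ≤ T := by exact_mod_cast hT
  have hK : 1 ≤ K := Nat.one_le_iff_ne_zero.2 (NeZero.ne K)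
  have hK' : (1 : ℝ) ≤ K := by exact_mod_cast hK
  have hl : 1 ≤ 1 + Real.log (T : ℝ) := by linarith [Real.log_nonneg hT']
  have hpow : (1 + Real.log (T : ℝ)) ^ 2 ≤ (1 + Real.log (T : ℝ)) ^ 6 :=
    pow_le_pow_right₀ hl (by norm_num)
  have hq : 0 ≤ ArcBandit.sqError D := integral_nonneg fun z => by positivity
  have hE0 : 0 ≤ E := mul_nonneg (by linarith) hq
  have hd0 : 0 ≤ d := mul_nonneg (by linarith) (Real.log_natCast_nonneg _)
  constructor
  · intro σ μ hσ hμ hμ1 P bound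
    obtain ⟨h1, h2, h3⟩ := ArcBandit.regret_bounds (P := P) hne hpol hD hO hOm rfl hT hσ hμ hμ1 rfl
    have hcost := ArcBandit.play_cost_le O P hT hμ hμ1
    have hterms : 0 ≤ ArcBandit.regretTerms d E σ μ T := by
      unfold ArcBandit.regretTerms
      positivity
    have hb : 2000 * (1 + Real.log (T : ℝ)) ^ 2 * ArcBandit.regretTerms d E σ μ T ≤ bound := by
      change _ ≤ 10000 * (1 + Real.log (T : ℝ)) ^ 6 * ArcBandit.regretTerms d E σ μ T
      gcongr
      norm_num
    have hR : 1 ≤ (T : ℝ) * K / μ := by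
      rw [le_div_iff₀ hμ]
      nlinarith
    have hlog : 0 ≤ 1 + Real.log (T * K / μ) := by linarith [Real.log_nonneg hR]
    refine ⟨h1, h2.trans (by linarith), fun h => (h3 h).trans hb, fun ω => ⟨?_, ?_⟩⟩
    · refine (hcost ω).1.trans ?_
      change 6 * (T : ℝ) * (1 + Real.log (T * K / μ)) ≤ _
      gcongr
      norm_num
    · refine (hcost ω).2.trans ?_
      change 160 * (T : ℝ) ^ 2 * K * (1 + Real.log (T * K / μ)) ≤ _
      gcongr
      norm_num
  · intro hN hE μ σ P bound
    have hN' : (2 : ℝ) ≤ N := by exact_mod_cast hN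
    have hlogN : 1 / 2 ≤ Real.log N := by
      have h1 := Real.log_two_gt_d9
      have h2 : Real.log 2 ≤ Real.log N := Real.log_le_log (by norm_num) hN'
      linarith
    have hKd : (K : ℝ) ≤ 2 * d := by
      change (K : ℝ) ≤ 2 * (K * Real.log N)
      nlinarith
    have hd : 0 < d := by linarith
    have hμ : 0 < μ := lt_min (Real.sqrt_pos.2 (by positivity)) one_pos
    have hμ1 : μ ≤ 1 := min_le_right _ _
    have hσ : 0 < σ := mul_pos (Real.sqrt_pos.2 hE) (Real.rpow_pos_of_pos (by positivity) _)
    obtain ⟨h1, h2, h3⟩ := ArcBandit.regret_bounds (P := P) hne hpol hD hO hOm rfl hT hσ hμ hμ1 rfl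
    have hcost := ArcBandit.play_cost_le O P hT hμ hμ1
    have hterms : ArcBandit.regretTerms d E σ μ T ≤ 4 * (√E * (d * T) ^ (1 / 4 : ℝ) + √(d * E)) :=
      ArcBandit.regretTerms_tuned_le hd hE hT
    have hstep := mul_le_mul (by linarith : 2000 * (1 + Real.log (T : ℝ)) ^ 2 ≤
      2000 * (1 + Real.log (T : ℝ)) ^ 6) hterms (by unfold ArcBandit.regretTerms; positivity)
      (by positivity)
    have hb : 2000 * (1 + Real.log (T : ℝ)) ^ 2 * ArcBandit.regretTerms d E σ μ T ≤ bound := by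
      calc 2000 * (1 + Real.log (T : ℝ)) ^ 2 * ArcBandit.regretTerms d E σ μ T
          ≤ 2000 * (1 + Real.log (T : ℝ)) ^ 6 *
            (4 * (√E * (d * T) ^ (1 / 4 : ℝ) + √(d * E))) := hstep
        _ = 8000 * (1 + Real.log (T : ℝ)) ^ 6 * (√E * (d * T) ^ (1 / 4 : ℝ) + √(d * E)) := by ring
        _ ≤ 10000 * (1 + Real.log (T : ℝ)) ^ 6 * (√E * (d * T) ^ (1 / 4 : ℝ) + √(d * E)) := by
          gcongr
          norm_num
    obtain ⟨hc1, hc2⟩ := ArcBandit.tuned_cost_le hK hT hKd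
    have hs : 0 ≤ ((T : ℝ) + d) ^ 6 := by positivity
    refine ⟨h1, h2.trans (by linarith), fun h => (h3 h).trans hb, fun ω => ⟨?_, ?_⟩⟩
    · refine (hcost ω).1.trans ?_
      change 6 * (T : ℝ) * (1 + Real.log (T * K / min (√(d / T)) 1)) ≤ 10000 * (T + d) ^ 6
      linarith
    · refine (hcost ω).2.trans ?_
      change 160 * (T : ℝ) ^ 2 * K * (1 + Real.log (T * K / min (√(d / T)) 1)) ≤
        10000 * (T + d) ^ 6
      linarith
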